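/- Let $d\ge2$, $0<\alpha\le d$, $I=[0,1]$, and let $\gamma\in C^{d+1}(I;\mathbb R^d)$ satisfy $\det(\gamma'(t),\gamma''(t),\dots,\gamma^{(d)}(t))\ne0$ for all $t\in I$. Write $[x]$ and $\langle x\rangle$ for the integer and the fractional part of $x\ge 0$, and put $m=[d-\alpha]$. For a positive Borel measure $\mu$ on $\mathbb R^d$ set $\langle\mu\rangle_\alpha=\sup_{x\in\mathbb R^d,\,r>0}r^{-\alpha}\mu(B(x,r))$, and for $\lambda\ge1$ let $$\mathcal E^\gamma_\lambda f(x)=a(x)\int_I e^{i\lambda x\cdot\gamma(t)}f(t)\,dt,$$ where $a:\mathbb R^d\to\mathbb C$ is measurable, supported in the closed unit ball $B(0,1)$, and $|a|\le1$. For $1\le j\le d$ and $0<s\le j$ let $\beta_j(s)=([j-s]+1)s+\tfrac12(j-1-[j-s])(j-[j-s])$. For integers $0\le\ell\le d-2-m$ let $|J(\ell)|$ be the length of the interval $$J(\ell)=[2\beta_{d-\ell-1}(\alpha-\ell-1),\,2\beta_{d-\ell}(\alpha-\ell)]\ \text{ if } \ell\le d-3-m,\qquad J(\ell)=[2(m+1),\,2\beta_{d-\ell}(\alpha-\ell)]\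 \text{ if }\ell=d-2-m.$$ For integers $-1\le\ell\le d-1-m$ let $\mathscr A(\ell)$ be the set of points $(\frac1p,\frac1q)$ with $1\le p\le2$, $1\le q\le\infty$ and * $\ell=-1$: $\ \frac{\beta_d(\alpha)}q+\frac1p<1$ and $\frac1q\le1-\frac1p$ (the second condition follows from the first unless $d\alpha<1$); * $0\le\ell\le d-3-m$: $\ \frac{\beta_{d-\ell-1}(\alpha-\ell-1)}q+\frac1p<1\le\frac{\beta_{d-\ell}(\alpha-\ell)}q+\frac1p$; * $\ell=d-2-m\ge0$: $\ \frac{m+1}q+\frac1p\le1\le\frac{\beta_{m+2}(2-\langle d-\alpha\rangle)}q+\frac1p$; * $\ell=d-1-m$, $m\ge1$: $\ \frac1{m+1}(1-\frac1p)\le\frac1q\le1-\frac1p$, $\ q\ge m+1$ and $\frac{\beta_{m+1}(1-\langle d-\alpha\rangle)}q+\frac1p<1$; * $\ell=d-1$, $m=0$: $\ \frac1p+\frac1q=1$. Define $$\eta(\alpha,p,q,\ell)=\begin{cases}\frac\alpha q,&\ell=-1,\\ \frac{\alpha-\ell}q-\frac2{|J(\ell)|}\Big(\frac{\beta_{d-\ell}(\alpha-\ell)}q+\frac1p-1\Big),&0\le\ell\le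 d-2-m,\\ \frac{\alpha-d}q+1-\frac1p,&\ell=d-1-m.\end{cases}$$ Then for every integer $-1\le\ell\le d-1-m$, every $(\frac1p,\frac1q)\in\mathscr A(\ell)$ and every $\epsilon>0$ there is a constant $C>0$, depending only on $d,\alpha,\gamma,\ell,p,q,\epsilon$, such that $$\|\mathcal E^\gamma_\lambda f\|_{L^q(d\mu)}\le C\,\langle\mu\rangle_\alpha^{1/q}\,\lambda^{-\eta(\alpha,p,q,\ell)+\epsilon}\,\|f\|_{L^p(I)}$$ for all $\lambda\ge1$, all $f\in L^p(I)$, all $a$ as above, and all positive Borel measures $\mu$ supported in $B(0,1)$ for which there is $C_\mu$ with $\mu(B(x,r))\le C_\mu r^\alpha$ for all $x\in\mathbb R^d$, $r>0$. In particular, $\mathcal E^\gamma_\lambda f\in L^q(d\mu)$. -/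

import Mathlib

open MeasureTheory Set
open scoped ENNReal

namespace OscCurve

noncomputable section

/-- Nondegeneracy of a curve on `I = [0,1]`: `det (γ'(t), γ''(t), …, γ⁽ᵈ⁾(t)) ≠ 0` for `t ∈ I`.
Column `j` of the matrix is the derivative of order `j + 1` (one-sided at the endpoints). -/
def Nondegenerate {d : ℕ} (γ : ℝ → EuclideanSpace ℝ (Fin d)) : Prop :=
  ∀ t ∈ Icc (0 : ℝ) 1,
    (Matrix.of fun i j : Fin d => iteratedDerivWithin (j.val + 1) γ (Icc 0 1) t i).det ≠ 0

/-- The growth condition `μ(B(x,r)) ≤ C_μ r^α` for all `x` and all `r > 0`. -/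
def HasGrowth {d : ℕ} (α : ℝ) (μ : Measure (EuclideanSpace ℝ (Fin d))) : Prop :=
  ∃ Cμ : ℝ, ∀ (x : EuclideanSpace ℝ (Fin d)) (r : ℝ), 0 < r →
    μ (Metric.ball x r) ≤ ENNReal.ofReal (Cμ * r ^ α)

/-- `⟨μ⟩_α = sup_{x, r > 0} r^{-α} μ(B(x,r))`, with values in `[0,∞]`. -/
def growthNorm {d : ℕ} (α : ℝ) (μ : Measure (EuclideanSpace ℝ (Fin d))) : ℝ≥0∞ :=
  ⨆ (x : EuclideanSpace ℝ (Fin d)) (r : ℝ) (_ : 0 < r),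
    ENNReal.ofReal (r ^ (-α)) * μ (Metric.ball x r)

/-- The oscillatory integral operator `a(x) ∫_0^1 e^{i λ x · γ(t)} f(t) dt`. -/
def oscOp {d : ℕ} (γ : ℝ → EuclideanSpace ℝ (Fin d)) (a : EuclideanSpace ℝ (Fin d) → ℂ)
    (lam : ℝ) (f : ℝ → ℂ) (x : EuclideanSpace ℝ (Fin d)) : ℂ :=
  a x * ∫ t in Icc (0 : ℝ) 1, Complex.exp (Complex.I * ((lam * inner ℝ x (γ t) : ℝ) : ℂ)) * f t

/-- `[d - α]`, the integer part of `d - α`. -/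
def codim (d : ℕ) (α : ℝ) : ℤ := ⌊(d : ℝ) - α⌋

/-- `β_j(α) = ([j-α]+1) α + (j-1-[j-α]) (j-[j-α]) / 2`. -/
def beta (j : ℤ) (α : ℝ) : ℝ :=
  ((⌊(j : ℝ) - α⌋ : ℝ) + 1) * α
    + ((j : ℝ) - 1 - (⌊(j : ℝ) - α⌋ : ℝ)) * ((j : ℝ) - (⌊(j : ℝ) - α⌋ : ℝ)) / 2

/-- The finite part of the interval `J(ℓ)` (the point `∞` belongs to `J(-1)` as well, but the
interval is only used through its length, for `0 ≤ ℓ ≤ d-2-[d-α]`). -/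
def intervalJ (d : ℕ) (α : ℝ) (l : ℤ) : Set ℝ :=
  if l = -1 then Ici (2 * beta d α)
  else if l ≤ d - 3 - codim d α then
    Icc (2 * beta (d - l - 1) (α - l - 1)) (2 * beta (d - l) (α - l))
  else if l = d - 2 - codim d α then
    Icc (2 * ((codim d α : ℝ) + 1)) (2 * beta (d - l) (α - l))
  else Icc 1 (2 * ((codim d α : ℝ) + 1))

/-- `|J(ℓ)|`, the length of `J(ℓ)`. -/
def lengthJ (d : ℕ) (α : ℝ) (l : ℤ) : ℝ := (volume (intervalJ d α l)).toReal

/-- The set `𝒜(ℓ)` of points `(x, y) = (1/p, 1/q)`, for `-1 ≤ ℓ ≤ d-1-[d-α]`.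
The inequality `y ≤ 1 - x` for `ℓ = -1` follows from the other one except when `d α < 1`.
If `[d-α] = 0`, the last set is the segment `x + y = 1`. -/
def regionA (d : ℕ) (α : ℝ) (l : ℤ) : Set (ℝ × ℝ) :=
  {z | 1 / 2 ≤ z.1 ∧ z.1 ≤ 1 ∧ 0 ≤ z.2 ∧ z.2 ≤ 1 ∧
    if l = -1 then
      beta d α * z.2 + z.1 < 1 ∧ z.2 ≤ 1 - z.1
    else if l ≤ d - 3 - codim d α then
      beta (d - l - 1) (α - l - 1) * z.2 + z.1 < 1 ∧ 1 ≤ beta (d - l) (α - l) * z.2 + z.1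
    else if l = d - 2 - codim d α then
      ((codim d α : ℝ) + 1) * z.2 + z.1 ≤ 1 ∧
        1 ≤ beta (codim d α + 2) (2 - Int.fract ((d : ℝ) - α)) * z.2 + z.1
    else if codim d α = 0 then
      z.1 + z.2 = 1
    else
      (1 - z.1) / ((codim d α : ℝ) + 1) ≤ z.2 ∧ z.2 ≤ 1 - z.1 ∧
        ((codim d α : ℝ) + 1) * z.2 ≤ 1 ∧
        beta (codim d α + 1) (1 - Int.fract ((d : ℝ) - α)) * z.2 + z.1 < 1}

/-- The exponent `η(α,p,q,ℓ)`, as a function of `x = 1/p` and `y = 1/q`. -/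
def eta (d : ℕ) (α x y : ℝ) (l : ℤ) : ℝ :=
  if l = -1 then α * y
  else if l ≤ d - 2 - codim d α then
    (α - l) * y - 2 / lengthJ d α l * (beta (d - l) (α - l) * y + x - 1)
  else (α - d) * y + 1 - x

end

end OscCurve

namespace OscCurve

/-! Since |a| ≤ 1, it is enough to bound Tf(x) = ∫_I e^{iλx·γ(t)} f(t) dt. Put m = [d-α]. The basic
estimates are L² → L^q bounds with decay λ^{-(α-d+k)/q}, up to λ^ε, for m+1 ≤ k ≤ d and q ≥ 2 max(k,
β_k(α-d+k)); the index ℓ of the theorem corresponds to k = d-ℓ.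

They come from a multilinear L² estimate (`IsNondegBy.multilinear`). On an interval of length h,
rescaling by the frame γ', …, γ^(d) makes γ resemble the moment curve. A product of T over k
separated subintervals is the extension operator of the sum map (t_1,…,t_k) ↦ ∑ γ(t_i). This map is
bounded from below in the first k frame coordinates (`sum_curve_lower_bound`): given two tuples, a
polynomial with prescribed signs on the intervals yields one combination of coordinates whose
increments are all nonnegative. A Gaussian-weighted T T* argument with Schur's test gives an L²
bound for Lebesgue measure, and local constancy on boxes transfers it to μ, at the price of the
ratio of μ-mass to volume of a box (`lintegral_extension_sq_le`). The boxes are chosen to pull back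
into balls of radius comparable to 1/(λh^r); the choice r = m+1 produces β_k.

The Bourgain–Guth dichotomy, iterated over K-adic scales, makes this linear
(`IsNondegBy.linear_estimate`). The broad part at scale h, combined with the trivial sup bound,
carries a nonnegative power of h once q ≥ 2β_k; the narrow part passes to the next scale. There are
O(log λ) steps, which cost λ^ε when K is large, and they stop when λh^r is about 1.

If m+1 = d, the range q > 2dα may reach below 2k = 2d. There the decay |z|^{-1/d} of the Fourier
transform of the curve, from van der Corput's lemma, and T T* in L^q are used
(`IsNondegBy.extBound_of_decay`).

Hölder's inequality in q between neighbouring values of k, and finally between q = 2(m+1) and q = 2,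
covers the line p = 2. The exponent η is linear in (1-1/p, 1/q), so interpolation with the trivial
L¹ → L^∞ bound reaches p < 2. As λ^ε may be lost, it is enough to cut f into boundedly many pieces
on each of which |f| varies by a factor of at most λ^{ε/2} (`ExtBound.of_half`). -/

/-! ### The T T* inequality and Schur's test -/

/-- The `T T*` inequality: the square norm of an operator with bounded kernel is controlled by the
composed kernel. -/
theorem lintegral_enorm_sq_le_kernel {A B : Type*} [MeasurableSpace A] [MeasurableSpace B]
    (σ : Measure A) [IsFiniteMeasure σ] (τ : Measure B) [SFinite τ] (e : A → B → ℂ)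
    (he : Measurable (Function.uncurry e)) (he1 : ∀ t x, ‖e t x‖ ≤ 1) (b : B → ℂ)
    (hb : Integrable b τ) :
    ∫⁻ t, ‖∫ x, e t x * b x ∂τ‖ₑ ^ 2 ∂σ ≤
      ∫⁻ x, ∫⁻ x', ‖b x‖ₑ * ‖b x'‖ₑ * ‖∫ t, e t x * (starRingEnd ℂ) (e t x') ∂σ‖ₑ ∂τ ∂τ := by
  have het : ∀ t, Measurable (e t) := fun t => he.comp measurable_prodMk_left
  have hint : ∀ t, Integrable (fun x => e t x * b x) τ := fun t =>
    hb.bdd_mul (c := 1) (het t).aestronglyMeasurable (ae_of_all _ (he1 t))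
  set g : A → ℂ := fun t => ∫ x, e t x * b x ∂τ with hg
  have hgm : AEStronglyMeasurable g σ := by
    have h1 : AEStronglyMeasurable (fun p : A × B => e p.1 p.2 * b p.2) (σ.prod τ) :=
      he.aestronglyMeasurable.mul hb.aestronglyMeasurable.comp_snd
    exact h1.integral_prod_right'
  have hgb : ∀ t, ‖g t‖ ≤ ∫ x, ‖b x‖ ∂τ := fun t => by
    refine norm_integral_le_of_norm_le hb.norm (ae_of_all _ fun x => ?_)
    rw [norm_mul]
    exact mul_le_of_le_one_left (norm_nonneg _) (he1 t x)
  have hHint : Integrable (fun q : A × (B × B) =>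
      (e q.1 q.2.1 * (starRingEnd ℂ) (e q.1 q.2.2)) * (b q.2.1 * (starRingEnd ℂ) (b q.2.2)))
      (σ.prod (τ.prod τ)) := by
    have h0 : Integrable (fun p : B × B => b p.1 * (starRingEnd ℂ) (b p.2)) (τ.prod τ) :=
      hb.mul_prod (Complex.conjLIE.toContinuousLinearEquiv.integrable_comp_iff.mpr hb)
    have h1 : Integrable (fun q : A × (B × B) => b q.2.1 * (starRingEnd ℂ) (b q.2.2))
      (σ.prod (τ.prod τ)) := h0.comp_snd σ
    refine h1.bdd_mul (c := 1) ?_ (ae_of_all _ fun q => ?_)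
    · refine (Measurable.mul ?_ ?_).aestronglyMeasurable
      · exact he.comp (measurable_fst.prodMk (measurable_fst.comp measurable_snd))
      · exact Complex.continuous_conj.measurable.comp
          (he.comp (measurable_fst.prodMk (measurable_snd.comp measurable_snd)))
    · rw [norm_mul, RCLike.norm_conj]
      exact mul_le_one₀ (he1 _ _) (norm_nonneg _) (he1 _ _)
  -- |g|² is written as one integral over B × B, so that Fubini can bring the integral in t inside.
  have hsq : ∀ t, ((‖g t‖ ^ 2 : ℝ) : ℂ) = ∫ p : B × B,
      (e t p.1 * (starRingEnd ℂ) (e t p.2)) * (b p.1 * (starRingEnd ℂ) (b p.2)) ∂(τ.prod τ) := by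
    intro t
    have : (fun p : B × B =>
      (e t p.1 * (starRingEnd ℂ) (e t p.2)) * (b p.1 * (starRingEnd ℂ) (b p.2))) =
      fun p : B × B => (e t p.1 * b p.1) * ((starRingEnd ℂ) (e t p.2 * b p.2)) := by
      ext p; rw [map_mul]; ring
    rw [this, integral_prod_mul (fun x => e t x * b x) (fun x => (starRingEnd ℂ) (e t x * b x)),
      integral_conj]
    change _ = g t * (starRingEnd ℂ) (g t)
    rw [Complex.mul_conj, Complex.normSq_eq_norm_sq]
  have hgi : Integrable (fun t => ‖g t‖ ^ 2) σ := by
    refine Integrable.of_bound (hgm.norm.pow 2) ((∫ x, ‖b x‖ ∂τ) ^ 2) (ae_of_all _ fun t => ?_)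
    rw [norm_pow, norm_norm]
    exact pow_le_pow_left₀ (norm_nonneg _) (hgb t) 2
  have e1 : ∫⁻ t, ‖g t‖ₑ ^ 2 ∂σ = ‖∫ t, ((‖g t‖ ^ 2 : ℝ) : ℂ) ∂σ‖ₑ := by
    rw [integral_complex_ofReal, ← ofReal_norm, Complex.norm_real, Real.norm_of_nonneg
      (integral_nonneg fun t => by positivity),
      ofReal_integral_eq_lintegral_ofReal hgi (ae_of_all _ fun t => by positivity)]
    refine lintegral_congr fun t => ?_
    rw [ENNReal.ofReal_pow (norm_nonneg _), ofReal_norm]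
  rw [e1]
  simp_rw [hsq]
  rw [integral_integral_swap hHint]
  refine (enorm_integral_le_lintegral_enorm _).trans ?_
  have hm : AEMeasurable (fun p : B × B => ‖b p.1‖ₑ * ‖b p.2‖ₑ *
      ‖∫ t, e t p.1 * (starRingEnd ℂ) (e t p.2) ∂σ‖ₑ) (τ.prod τ) := by
    refine AEMeasurable.mul (hb.aestronglyMeasurable.comp_fst.enorm.mul
      hb.aestronglyMeasurable.comp_snd.enorm) ?_
    have : StronglyMeasurable (fun q : (B × B) × A => e q.2 q.1.1 * (starRingEnd ℂ) (e q.2 q.1.2)) :=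
      ((he.comp (measurable_snd.prodMk (measurable_fst.comp measurable_fst))).mul
        (Complex.continuous_conj.measurable.comp
          (he.comp (measurable_snd.prodMk (measurable_snd.comp measurable_fst))))).stronglyMeasurable
    exact this.integral_prod_right'.aestronglyMeasurable.enorm
  rw [← lintegral_prod (fun p : B × B => ‖b p.1‖ₑ * ‖b p.2‖ₑ *
      ‖∫ t, e t p.1 * (starRingEnd ℂ) (e t p.2) ∂σ‖ₑ) hm]
  refine lintegral_mono fun p => ?_
  rw [integral_mul_const, enorm_mul, enorm_mul, mul_comm]
  rw [RCLike.enorm_conj]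

/-- Schur test for a symmetric kernel. -/
theorem lintegral_schur {B : Type*} [MeasurableSpace B] (τ : Measure B) [SFinite τ]
    (b : B → ℝ≥0∞) (hb : AEMeasurable b τ) (k : B → B → ℝ≥0∞)
    (hk : Measurable (Function.uncurry k)) (hs : ∀ x y, k x y = k y x) (D : ℝ≥0∞)
    (hD : ∀ x, ∫⁻ y, k x y ∂τ ≤ D) :
    ∫⁻ x, ∫⁻ y, b x * b y * k x y ∂τ ∂τ ≤ 2 * D * ∫⁻ x, b x ^ 2 ∂τ := by
  -- The product of values of b is replaced by the sum of the squares; by symmetry of k both terms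
  -- obey the same row bound D.
  have key : ∀ x y, b x * b y * k x y ≤ b x ^ 2 * k x y + b y ^ 2 * k x y := by
    intro x y
    rw [← add_mul]
    gcongr
    rcases le_total (b x) (b y) with h | h
    · exact (by rw [sq]; gcongr : b x * b y ≤ b y ^ 2).trans le_add_self
    · exact (by rw [sq]; gcongr : b x * b y ≤ b x ^ 2).trans le_self_add
  have hkx : ∀ x, Measurable (k x) := fun x => hk.comp measurable_prodMk_left
  have hm2 : AEMeasurable (fun p : B × B => b p.2 ^ 2 * k p.1 p.2) (τ.prod τ) :=
    (hb.comp_snd.pow_const 2).mul hk.aemeasurable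
  have hm1 : AEMeasurable (fun p : B × B => b p.1 ^ 2 * k p.1 p.2) (τ.prod τ) :=
    (hb.comp_fst.pow_const 2).mul hk.aemeasurable
  have h1 : ∫⁻ x, ∫⁻ y, b x ^ 2 * k x y ∂τ ∂τ ≤ D * ∫⁻ x, b x ^ 2 ∂τ := by
    rw [← lintegral_const_mul'' _ (hb.pow_const 2)]
    refine lintegral_mono fun x => ?_
    rw [lintegral_const_mul _ (hkx x), mul_comm]
    gcongr
    exact hD x
  have h2 : ∫⁻ x, ∫⁻ y, b y ^ 2 * k x y ∂τ ∂τ ≤ D * ∫⁻ x, b x ^ 2 ∂τ := by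
    rw [lintegral_lintegral_swap hm2]
    simp_rw [fun x y => hs x y]
    exact h1
  calc ∫⁻ x, ∫⁻ y, b x * b y * k x y ∂τ ∂τ
      ≤ ∫⁻ x, ∫⁻ y, (b x ^ 2 * k x y + b y ^ 2 * k x y) ∂τ ∂τ :=
        lintegral_mono fun x => lintegral_mono fun y => key x y
    _ = ∫⁻ x, (∫⁻ y, b x ^ 2 * k x y ∂τ) + (∫⁻ y, b y ^ 2 * k x y ∂τ) ∂τ :=
        lintegral_congr fun x => lintegral_add_left ((hkx x).const_mul _) _
    _ = (∫⁻ x, ∫⁻ y, b x ^ 2 * k x y ∂τ ∂τ) + ∫⁻ x, ∫⁻ y, b y ^ 2 * k x y ∂τ ∂τ :=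
        lintegral_add_left' hm1.lintegral_prod_right' _
    _ ≤ D * ∫⁻ x, b x ^ 2 ∂τ + D * ∫⁻ x, b x ^ 2 ∂τ := by gcongr
    _ = 2 * D * ∫⁻ x, b x ^ 2 ∂τ := by ring

/-! ### Extension operators in L² of a Gaussian weight -/

/-- The measure with density `exp (-∑ v_j² / (2 R_j²))`. -/
noncomputable def gaussWeight {ι : Type*} [Fintype ι] (R : ι → ℝ) : Measure (ι → ℝ) :=
  volume.withDensity fun v => ENNReal.ofReal (Real.exp (-∑ j, v j ^ 2 / (2 * R j ^ 2)))

section Gauss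

variable {ι κ : Type*} [Fintype ι] [Fintype κ]

theorem measurable_gaussDensity (R : ι → ℝ) :
    Measurable fun v : ι → ℝ => Real.exp (-∑ j, v j ^ 2 / (2 * R j ^ 2)) := by
  fun_prop

/-- Puts the density times a character into the shape required by
`GaussianFourier.integral_cexp_neg_sum_mul_add`. -/
theorem gauss_mul_cexp {R : ι → ℝ} (ξ v : ι → ℝ) :
    Complex.exp (-∑ j, ((1 / (2 * R j ^ 2) : ℝ) : ℂ) * (v j : ℂ) ^ 2
      + ∑ j, (Complex.I * (ξ j : ℂ)) * v j) =
    Real.exp (-∑ j, v j ^ 2 / (2 * R j ^ 2)) • Complex.exp (Complex.I * ((∑ j, v j * ξ j : ℝ) : ℂ))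
    := by
  rw [Complex.real_smul, Complex.ofReal_exp, ← Complex.exp_add]
  congr 2
  · push_cast
    congr 1
    refine Finset.sum_congr rfl fun j _ => ?_
    ring
  · push_cast
    rw [Finset.mul_sum]
    refine Finset.sum_congr rfl fun j _ => ?_
    ring

theorem isFiniteMeasure_gaussWeight {R : ι → ℝ} (hR : ∀ j, 0 < R j) :
    IsFiniteMeasure (gaussWeight R) := by
  refine isFiniteMeasure_withDensity_ofReal (Integrable.hasFiniteIntegral ?_)
  have := (GaussianFourier.integrable_cexp_neg_sum_mul_add (ι := ι)
    (b := fun j => ((1 / (2 * R j ^ 2) : ℝ) : ℂ))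
    (fun j => by rw [Complex.ofReal_re]; have := hR j; positivity)
    (fun j => Complex.I * ((0 : ℝ) : ℂ))).norm
  refine this.congr (ae_of_all _ fun v => ?_)
  simp only
  rw [gauss_mul_cexp (fun _ => (0 : ℝ)) v]
  rw [norm_smul, mul_comm Complex.I, Complex.norm_exp_ofReal_mul_I, mul_one,
    Real.norm_of_nonneg (Real.exp_pos _).le]

/-- The Fourier transform of a Gaussian is a positive Gaussian, decreasing in each |ξ j|. This is
the reason for the weight: a lower bound on differences of frequencies is at once an upper bound on
the T T* kernel. -/
theorem enorm_integral_gaussWeight {R : ι → ℝ} (hR : ∀ j, 0 < R j) (ξ : ι → ℝ) :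
    ‖∫ v, Complex.exp (Complex.I * ((∑ j, v j * ξ j : ℝ) : ℂ)) ∂(gaussWeight R)‖ₑ =
      ENNReal.ofReal ((∏ j, (√(2 * Real.pi) * R j)) *
        Real.exp (-(∑ j, R j ^ 2 * ξ j ^ 2) / 2)) := by
  rw [gaussWeight, integral_withDensity_eq_integral_toReal_smul
    (measurable_gaussDensity R).ennreal_ofReal (ae_of_all _ fun v => ENNReal.ofReal_lt_top)]
  simp_rw [ENNReal.toReal_ofReal (Real.exp_pos _).le, ← gauss_mul_cexp]
  rw [GaussianFourier.integral_cexp_neg_sum_mul_add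
    (fun j => by rw [Complex.ofReal_re]; have := hR j; positivity), ← ofReal_norm]
  congr 1
  rw [norm_prod, neg_div, Finset.sum_div, ← Finset.sum_neg_distrib, Real.exp_sum,
    ← Finset.prod_mul_distrib]
  refine Finset.prod_congr rfl fun j _ => ?_
  have hj := hR j
  rw [norm_mul]
  congr 1
  · rw [← Complex.ofReal_div, Complex.norm_cpow_eq_rpow_re_of_pos (by positivity)]
    rw [show Real.pi / (1 / (2 * R j ^ 2)) = (2 * Real.pi) * R j ^ 2 by field_simp,
      show ((1 / 2 : ℂ)).re = 1 / 2 by norm_num, ← Real.sqrt_eq_rpow,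
      Real.sqrt_mul (by positivity), Real.sqrt_sq hj.le]
  · rw [Complex.norm_exp]
    congr 1
    rw [mul_pow, Complex.I_sq]
    have : (-1 * (ξ j : ℂ) ^ 2 / (4 * ((1 / (2 * R j ^ 2) : ℝ) : ℂ))) =
        ((-(R j ^ 2 * ξ j ^ 2 / 2) : ℝ) : ℂ) := by
      have : (R j : ℂ) ≠ 0 := by exact_mod_cast hj.ne'
      push_cast
      field_simp
      ring
    rw [this, Complex.ofReal_re]

/-- By translation invariance the integral does not depend on s; it is the row bound in Schur's
test. -/
theorem lintegral_gauss_pi {B : ℝ} (hB : 0 < B) (s : κ → ℝ) :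
    ∫⁻ s' : κ → ℝ, ENNReal.ofReal (Real.exp (-(∑ i, B ^ 2 * (s i - s' i) ^ 2) / 2)) =
      ENNReal.ofReal ((√(2 * Real.pi) / B) ^ Fintype.card κ) := by
  have h := lintegral_sub_left_eq_self (μ := (volume : Measure (κ → ℝ)))
    (fun s' => ENNReal.ofReal (Real.exp (-(∑ i, B ^ 2 * (s' i) ^ 2) / 2))) s
  simp only [Pi.sub_apply] at h
  rw [h]
  have e : (fun s' : κ → ℝ => Real.exp (-(∑ i, B ^ 2 * (s' i) ^ 2) / 2)) =
      fun s' => ∏ i, Real.exp (-(B ^ 2 / 2) * (s' i) ^ 2) := by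
    ext s'
    rw [← Real.exp_sum, neg_div, Finset.sum_div, ← Finset.sum_neg_distrib]
    congr 1
    exact Finset.sum_congr rfl fun i _ => by ring
  have hi : Integrable (fun s' : κ → ℝ => Real.exp (-(∑ i, B ^ 2 * (s' i) ^ 2) / 2)) := by
    rw [e]
    exact Integrable.fintype_prod (f := fun _ x => Real.exp (-(B ^ 2 / 2) * x ^ 2))
      fun i => integrable_exp_neg_mul_sq (by positivity)
  rw [← ofReal_integral_eq_lintegral_ofReal hi (ae_of_all _ fun _ => (Real.exp_pos _).le), e,
    integral_fintype_prod_volume_eq_pow (fun x => Real.exp (-(B ^ 2 / 2) * x ^ 2)),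
    integral_gaussian]
  congr 2
  rw [show Real.pi / (B ^ 2 / 2) = (2 * Real.pi) / B ^ 2 by field_simp, Real.sqrt_div
    (by positivity), Real.sqrt_sq hB.le]

/-- `L²` estimate with a gaussian weight for the extension operator of a map `Φ` which is bounded
from below on the support of `f`. -/
theorem lintegral_extension_gaussWeight {R : ι → ℝ} (hR : ∀ j, 0 < R j) {B : ℝ} (hB : 0 < B)
    {Φ : (κ → ℝ) → ι → ℝ} (hΦ : Measurable Φ) {S : Set (κ → ℝ)}
    (hlow : ∀ s ∈ S, ∀ s' ∈ S,
      ∑ i, B ^ 2 * (s i - s' i) ^ 2 ≤ ∑ j, R j ^ 2 * (Φ s j - Φ s' j) ^ 2)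
    {f : (κ → ℝ) → ℂ} (hf : Integrable f) (hfS : ∀ s, s ∉ S → f s = 0) :
    ∫⁻ v, ‖∫ s, Complex.exp (Complex.I * ((∑ j, v j * Φ s j : ℝ) : ℂ)) * f s‖ₑ ^ 2
        ∂(gaussWeight R) ≤
      ENNReal.ofReal (2 * ((∏ j, (√(2 * Real.pi) * R j)) * (√(2 * Real.pi) / B) ^ Fintype.card κ))
        * ∫⁻ s, ‖f s‖ₑ ^ 2 := by
  have := isFiniteMeasure_gaussWeight hR
  have hP : 0 ≤ ∏ j, (√(2 * Real.pi) * R j) :=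
    Finset.prod_nonneg fun j _ => mul_nonneg (Real.sqrt_nonneg _) (hR j).le
  refine (lintegral_enorm_sq_le_kernel (gaussWeight R) volume
    (fun v s => Complex.exp (Complex.I * ((∑ j, v j * Φ s j : ℝ) : ℂ))) ?_ ?_ f hf).trans ?_
  · refine Complex.measurable_exp.comp (measurable_const.mul (Complex.measurable_ofReal.comp ?_))
    refine Finset.measurable_sum _ fun j _ => ?_
    exact ((measurable_pi_apply j).comp measurable_fst).mul
      ((measurable_pi_apply j).comp (hΦ.comp measurable_snd))
  · intro v s
    rw [mul_comm, Complex.norm_exp_ofReal_mul_I]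
  -- Majorant of the T T* kernel: on S × S the lower bound for Φ replaces Φ s - Φ s' by B(s - s') in
  -- the Gaussian, and outside S the function f vanishes.
  set k : (κ → ℝ) → (κ → ℝ) → ℝ≥0∞ := fun s s' =>
    ENNReal.ofReal (∏ j, (√(2 * Real.pi) * R j)) *
      ENNReal.ofReal (Real.exp (-(∑ i, B ^ 2 * (s i - s' i) ^ 2) / 2)) with hk
  have hkm : Measurable (Function.uncurry k) := by
    refine measurable_const.mul (Measurable.ennreal_ofReal ?_)
    fun_prop
  have h2 := lintegral_schur volume (fun s => ‖f s‖ₑ) hf.aestronglyMeasurable.enorm k hkm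
    (fun s s' => by simp only [hk]; congr 4; congr 1; exact Finset.sum_congr rfl fun i _ => by ring)
    (ENNReal.ofReal (∏ j, (√(2 * Real.pi) * R j)) *
      ENNReal.ofReal ((√(2 * Real.pi) / B) ^ Fintype.card κ)) (fun s => by
        simp only [hk]
        rw [lintegral_const_mul' _ _ ENNReal.ofReal_ne_top, lintegral_gauss_pi hB])
  refine le_trans (lintegral_mono fun s => lintegral_mono fun s' => ?_) (h2.trans_eq ?_)
  · by_cases hs : s ∈ S
    swap
    · simp [hfS s hs]
    by_cases hs' : s' ∈ S
    swap
    · simp [hfS s' hs']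
    simp only [hk]
    gcongr
    have e : ∀ v : ι → ℝ, Complex.exp (Complex.I * ((∑ j, v j * Φ s j : ℝ) : ℂ)) *
        (starRingEnd ℂ) (Complex.exp (Complex.I * ((∑ j, v j * Φ s' j : ℝ) : ℂ))) =
        Complex.exp (Complex.I * ((∑ j, v j * (Φ s j - Φ s' j) : ℝ) : ℂ)) := by
      intro v
      rw [← Complex.exp_conj, ← Complex.exp_add]
      congr 1
      simp only [map_mul, Complex.conj_I, Complex.conj_ofReal, mul_sub, Finset.sum_sub_distrib]
      push_cast
      ring
    simp_rw [e]
    rw [enorm_integral_gaussWeight hR, ENNReal.ofReal_mul hP]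
    gcongr
    exact hlow s hs s' hs'
  · rw [ENNReal.ofReal_mul (by norm_num : (0 : ℝ) ≤ 2), ENNReal.ofReal_mul hP]
    simp

end Gauss

/-! ### Local constancy and transfer to general measures -/

theorem sq_lintegral_mul_le {A : Type*} [MeasurableSpace A] (μ : Measure A) {g h : A → ℝ≥0∞}
    (hg : AEMeasurable g μ) (hh : AEMeasurable h μ) :
    (∫⁻ a, g a * h a ∂μ) ^ 2 ≤ (∫⁻ a, g a ^ 2 ∂μ) * ∫⁻ a, h a ^ 2 ∂μ := by
  have h2 := ENNReal.lintegral_mul_le_Lp_mul_Lq μ Real.HolderConjugate.two_two hg hh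
  calc (∫⁻ a, g a * h a ∂μ) ^ 2
      ≤ ((∫⁻ a, g a ^ (2 : ℝ) ∂μ) ^ (1 / 2 : ℝ) * (∫⁻ a, h a ^ (2 : ℝ) ∂μ) ^ (1 / 2 : ℝ)) ^ 2 := by
        gcongr; exact h2
    _ = _ := by
        rw [mul_pow, ← ENNReal.rpow_natCast, ← ENNReal.rpow_natCast, ← ENNReal.rpow_mul,
          ← ENNReal.rpow_mul]
        norm_num

theorem sq_lintegral_le {A : Type*} [MeasurableSpace A] (μ : Measure A) {g : A → ℝ≥0∞}
    (hg : AEMeasurable g μ) : (∫⁻ a, g a ∂μ) ^ 2 ≤ μ univ * ∫⁻ a, g a ^ 2 ∂μ := by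
  simpa using sq_lintegral_mul_le μ (g := fun _ => 1) aemeasurable_const hg

section Smoothing

variable {ι κ : Type*} [Fintype ι] [Fintype κ]

/-- The phase function `exp (i v · w)`. -/
noncomputable def expDot (v w : ι → ℝ) : ℂ := Complex.exp (Complex.I * ((∑ j, v j * w j : ℝ) : ℂ))

theorem norm_expDot (v w : ι → ℝ) : ‖expDot v w‖ = 1 := by
  rw [expDot, mul_comm, Complex.norm_exp_ofReal_mul_I]

theorem expDot_add (v z w : ι → ℝ) : expDot (v + z) w = expDot v w * expDot z w := by
  simp only [expDot, ← Complex.exp_add, ← mul_add, ← Complex.ofReal_add,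
    ← Finset.sum_add_distrib, Pi.add_apply, add_mul]

theorem continuous_expDot : Continuous fun p : (ι → ℝ) × (ι → ℝ) => expDot p.1 p.2 := by
  unfold expDot; fun_prop

/-- The box `∏ [-δ_j, δ_j]`. -/
def box (δ : ι → ℝ) : Set (ι → ℝ) := {z | ∀ j, |z j| ≤ δ j}

theorem box_eq (δ : ι → ℝ) : box δ = Icc (-δ) δ := by
  ext z
  simp only [box, mem_ofPred_eq, mem_Icc, Pi.le_def, Pi.neg_apply, abs_le]
  exact forall_and

theorem measurableSet_box (δ : ι → ℝ) : MeasurableSet (box δ) := by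
  rw [box_eq]; exact measurableSet_Icc

theorem volume_box (δ : ι → ℝ) : volume (box δ) = ∏ j, ENNReal.ofReal (2 * δ j) := by
  rw [box_eq, Real.volume_Icc_pi]
  refine Finset.prod_congr rfl fun j _ => ?_
  congr 1
  simp only [Pi.neg_apply]; ring

theorem volume_box_ne_top (δ : ι → ℝ) : volume (box δ) ≠ ⊤ := by
  rw [volume_box]; exact ENNReal.prod_ne_top fun _ _ => ENNReal.ofReal_ne_top

/-- The Fourier transform of the indicator function of a box. -/
noncomputable def boxHat (δ w : ι → ℝ) : ℂ := ∫ z in box δ, expDot z w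

/-- On the box the phase is at most 1 in absolute value, so its cosine is at least 1/2 and there is
no cancellation. -/
theorem le_norm_boxHat {δ : ι → ℝ} (hδ : ∀ j, 0 < δ j) {w : ι → ℝ}
    (hw : ∑ j, δ j * |w j| ≤ 1) : ∏ j, δ j ≤ 2 * ‖boxHat δ w‖ := by
  have hfin := volume_box_ne_top δ
  have hi : IntegrableOn (fun z => expDot z w) (box δ) := by
    refine Measure.integrableOn_of_bounded (M := 1) hfin ?_ (ae_of_all _ fun z => ?_)
    · exact (continuous_expDot.comp (continuous_id.prodMk continuous_const)).aestronglyMeasurable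
    · rw [norm_expDot]
  have hre : ∀ z ∈ box δ, (1 / 2 : ℝ) ≤ (expDot z w).re := by
    intro z hz
    have : |∑ j, z j * w j| ≤ 1 := by
      refine (Finset.abs_sum_le_sum_abs _ _).trans (le_trans ?_ hw)
      refine Finset.sum_le_sum fun j _ => ?_
      rw [abs_mul]
      exact mul_le_mul_of_nonneg_right (hz j) (abs_nonneg _)
    rw [expDot, mul_comm, Complex.exp_ofReal_mul_I_re]
    have h1 := Real.one_sub_sq_div_two_le_cos (x := ∑ j, z j * w j)
    have h2 : (∑ j, z j * w j) ^ 2 ≤ 1 := by rw [← sq_abs]; exact pow_le_one₀ (abs_nonneg _) this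
    linarith
  have h1 : (1 / 2 : ℝ) * (volume (box δ)).toReal ≤ (boxHat δ w).re := by
    have e : (boxHat δ w).re = ∫ z in box δ, (expDot z w).re := (integral_re hi).symm
    rw [e]
    have := setIntegral_mono_on (μ := volume) (s := box δ) (f := fun _ => (1 / 2 : ℝ))
      (integrableOn_const hfin) hi.re (measurableSet_box δ) hre
    simpa [mul_comm, Measure.real] using this
  have h2 : (volume (box δ)).toReal = ∏ j, (2 * δ j) := by
    rw [volume_box, ENNReal.toReal_prod]
    exact Finset.prod_congr rfl fun j _ => ENNReal.toReal_ofReal (by have := hδ j; positivity)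
  have h3 : ∏ j, δ j ≤ ∏ j, (2 * δ j) :=
    Finset.prod_le_prod (fun j _ => (hδ j).le) fun j _ => by have := hδ j; linarith
  have h4 := Complex.re_le_norm (boxHat δ w)
  rw [h2] at h1
  linarith

theorem measurable_boxHat (δ : ι → ℝ) : Measurable (boxHat δ) := by
  have : StronglyMeasurable (fun p : (ι → ℝ) × (ι → ℝ) => expDot p.2 p.1) :=
    (continuous_expDot.comp continuous_swap).stronglyMeasurable
  exact (this.integral_prod_right' (ν := volume.restrict (box δ))).measurable

theorem continuous_extension {Φ : (κ → ℝ) → ι → ℝ} (hΦ : Measurable Φ)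
    {f : (κ → ℝ) → ℂ} (hf : Integrable f) :
    Continuous fun v => ∫ s, expDot v (Φ s) * f s := by
  refine continuous_of_dominated (bound := fun s => ‖f s‖) (fun v => ?_)
    (fun v => ae_of_all _ fun s => ?_) hf.norm (ae_of_all _ fun s => ?_)
  · exact ((continuous_expDot.measurable.comp
      (measurable_const.prodMk hΦ)).aestronglyMeasurable).mul hf.aestronglyMeasurable
  · rw [norm_mul, norm_expDot, one_mul]
  · exact (continuous_expDot.comp (continuous_id.prodMk continuous_const)).mul continuous_const

/-- Local constancy: an extension operator is an average over boxes of another one. -/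
theorem extension_eq_average {δ : ι → ℝ} (hδ : ∀ j, 0 < δ j) {Φ : (κ → ℝ) → ι → ℝ}
    (hΦ : Measurable Φ) {S : Set (κ → ℝ)} (hS : ∀ s ∈ S, ∑ j, δ j * |Φ s j| ≤ 1)
    {f : (κ → ℝ) → ℂ} (hf : Integrable f) (hfS : ∀ s, s ∉ S → f s = 0) :
    ∃ g : (κ → ℝ) → ℂ, Integrable g ∧ (∀ s, s ∉ S → g s = 0) ∧
      (∀ s, (∏ j, δ j) * ‖g s‖ ≤ 2 * ‖f s‖) ∧
      ∀ v, ∫ s, expDot v (Φ s) * f s = ∫ z in box δ, ∫ s, expDot (v + z) (Φ s) * g s := by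
  classical
  have hP : 0 < ∏ j, δ j := Finset.prod_pos fun j _ => hδ j
  have hb : ∀ s, (∏ j, δ j) * ‖(boxHat δ (Φ s))⁻¹ * f s‖ ≤ 2 * ‖f s‖ := by
    intro s
    by_cases hs : s ∈ S
    · have h1 := le_norm_boxHat hδ (hS s hs)
      have h2 : 0 < ‖boxHat δ (Φ s)‖ := by linarith
      rw [norm_mul, norm_inv]
      calc (∏ j, δ j) * (‖boxHat δ (Φ s)‖⁻¹ * ‖f s‖)
          ≤ (2 * ‖boxHat δ (Φ s)‖) * (‖boxHat δ (Φ s)‖⁻¹ * ‖f s‖) := by gcongr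
        _ = 2 * ‖f s‖ := by field_simp
    · simp [hfS s hs]
  have hgi : Integrable fun s => (boxHat δ (Φ s))⁻¹ * f s := by
    refine Integrable.mono' (hf.norm.const_mul (2 / ∏ j, δ j))
      (((measurable_boxHat δ).comp hΦ).inv.aestronglyMeasurable.mul hf.aestronglyMeasurable)
      (ae_of_all _ fun s => ?_)
    rw [div_mul_eq_mul_div, le_div_iff₀ hP, mul_comm]
    exact hb s
  -- Integrating over the translates by the box multiplies the frequency Φ s by `boxHat δ (Φ s)`,
  -- which is bounded away from 0 on S; the witness divides by it.
  refine ⟨fun s => (boxHat δ (Φ s))⁻¹ * f s, hgi, fun s hs => by simp [hfS s hs], hb, fun v => ?_⟩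
  have : IsFiniteMeasure (volume.restrict (box δ)) :=
    ⟨by rw [Measure.restrict_apply_univ]; exact (volume_box_ne_top δ).lt_top⟩
  have hint : Integrable (fun p : (ι → ℝ) × (κ → ℝ) =>
      expDot (v + p.1) (Φ p.2) * ((boxHat δ (Φ p.2))⁻¹ * f p.2))
      ((volume.restrict (box δ)).prod volume) := by
    refine (hgi.comp_snd (volume.restrict (box δ))).bdd_mul (c := 1) ?_
      (ae_of_all _ fun p => (norm_expDot _ _).le)
    exact (continuous_expDot.measurable.comp ((measurable_const.add measurable_fst).prodMk
      (hΦ.comp measurable_snd))).aestronglyMeasurable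
  rw [integral_integral_swap hint]
  refine integral_congr_ae (ae_of_all _ fun s => ?_)
  simp only
  by_cases hs : s ∈ S
  · have h1 := le_norm_boxHat hδ (hS s hs)
    have h2 : boxHat δ (Φ s) ≠ 0 := by
      rw [← norm_pos_iff]; linarith
    rw [integral_mul_const]
    simp_rw [expDot_add]
    rw [integral_const_mul]
    change _ = expDot v (Φ s) * boxHat δ (Φ s) * _
    field_simp
  · simp [hfS s hs]

/-- A constant depending only on the numbers of variables. -/
noncomputable def extConst (ι κ : Type*) [Fintype ι] [Fintype κ] : ℝ :=
  8 * 2 ^ Fintype.card ι * Real.exp (2 * Fintype.card ι) *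
    √(2 * Real.pi) ^ (Fintype.card ι + Fintype.card κ)

/-- `L²(ν)` estimate for the extension operator of a map which is bounded from below, for a
measure `ν` with prescribed mass on boxes. -/
theorem lintegral_extension_sq_le (ν : Measure (ι → ℝ)) [IsFiniteMeasure ν] {R δ : ι → ℝ}
    (hδ : ∀ j, 0 < δ j) (hδR : ∀ j, δ j ≤ R j) (hν : ∀ᵐ v ∂ν, ∀ j, |v j| ≤ R j) {N : ℝ≥0∞}
    (hN : ∀ y : ι → ℝ, ν {v | ∀ j, |y j - v j| ≤ δ j} ≤ N) {B : ℝ} (hB : 0 < B)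
    {Φ : (κ → ℝ) → ι → ℝ} (hΦ : Measurable Φ) {S : Set (κ → ℝ)}
    (hS : ∀ s ∈ S, ∑ j, δ j * |Φ s j| ≤ 1)
    (hlow : ∀ s ∈ S, ∀ s' ∈ S,
      ∑ i, B ^ 2 * (s i - s' i) ^ 2 ≤ ∑ j, R j ^ 2 * (Φ s j - Φ s' j) ^ 2)
    {f : (κ → ℝ) → ℂ} (hf : Integrable f) (hfS : ∀ s, s ∉ S → f s = 0) :
    ∫⁻ v, ‖∫ s, expDot v (Φ s) * f s‖ₑ ^ 2 ∂ν ≤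
      ENNReal.ofReal (extConst ι κ * (∏ j, R j / δ j) / B ^ Fintype.card κ) * N *
        ∫⁻ s, ‖f s‖ₑ ^ 2 := by
  obtain ⟨g, hgi, hgS, hgf, hav⟩ := extension_eq_average hδ hΦ hS hf hfS
  have hR : ∀ j, 0 < R j := fun j => (hδ j).trans_le (hδR j)
  have hP : 0 < ∏ j, δ j := Finset.prod_pos fun j _ => hδ j
  set G : (ι → ℝ) → ℂ := fun v => ∫ s, expDot v (Φ s) * g s with hG
  have hGc : Continuous G := continuous_extension hΦ hgi
  have hGm : Measurable fun y => ‖G y‖ₑ ^ 2 := (hGc.measurable.enorm).pow_const 2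
  set V := volume (box δ) with hV
  have hVtop : V ≠ ⊤ := volume_box_ne_top δ
  have hVpos : V ≠ 0 := by
    rw [hV, volume_box]
    refine Finset.prod_ne_zero_iff.mpr fun j _ => ?_
    have := hδ j
    simp only [ne_eq, ENNReal.ofReal_eq_zero, not_le]; positivity
  have hbox := measurableSet_box δ
  set χ : (ι → ℝ) → ℝ≥0∞ := (box δ).indicator 1 with hχ
  have hχm : Measurable χ := measurable_one.indicator hbox
  -- Cauchy–Schwarz in the integral over the box, then the change of variable y = v + z.
  have s1 : ∀ v, ‖∫ s, expDot v (Φ s) * f s‖ₑ ^ 2 ≤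
      V * ∫⁻ y, χ (y - v) * ‖G y‖ₑ ^ 2 := by
    intro v
    rw [hav v]
    calc ‖∫ z in box δ, G (v + z)‖ₑ ^ 2 ≤ (∫⁻ z in box δ, ‖G (v + z)‖ₑ) ^ 2 := by
          gcongr; exact enorm_integral_le_lintegral_enorm _
      _ ≤ V * ∫⁻ z in box δ, ‖G (v + z)‖ₑ ^ 2 := by
          refine (sq_lintegral_le _ ?_).trans_eq ?_
          · exact (hGc.comp (continuous_const.add continuous_id)).measurable.enorm.aemeasurable
          · rw [Measure.restrict_apply_univ]
      _ = V * ∫⁻ y, χ (y - v) * ‖G y‖ₑ ^ 2 := by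
          congr 1
          rw [← lintegral_indicator hbox,
            ← lintegral_add_left_eq_self (fun y => χ (y - v) * ‖G y‖ₑ ^ 2) v]
          refine lintegral_congr fun z => ?_
          rw [add_sub_cancel_left]
          by_cases hz : z ∈ box δ <;> simp [hχ, hz]
  have hmeas : Measurable fun p : (ι → ℝ) × (ι → ℝ) =>
      χ (p.2 - p.1) * ‖G p.2‖ₑ ^ 2 :=
    (hχm.comp (measurable_snd.sub measurable_fst)).mul
      (hGm.comp measurable_snd)
  -- After exchanging the integrals, ν enters only through the masses of translated boxes. If |y j|
  -- ≤ 2 R j for all j, the Gaussian weight is at least exp(-2 card ι), whence the inserted factor;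
  -- otherwise the box around y carries no ν-mass because δ ≤ R.
  have s2 : ∀ y, (∫⁻ v, χ (y - v) ∂ν) * ‖G y‖ₑ ^ 2 ≤
      (N * ENNReal.ofReal (Real.exp (2 * Fintype.card ι))) *
        (ENNReal.ofReal (Real.exp (-∑ j, y j ^ 2 / (2 * R j ^ 2))) * ‖G y‖ₑ ^ 2) := by
    intro y
    rw [← mul_assoc]
    gcongr
    have e : ∫⁻ v, χ (y - v) ∂ν = ν {v | ∀ j, |y j - v j| ≤ δ j} := by
      have hm : MeasurableSet {v : ι → ℝ | ∀ j, |y j - v j| ≤ δ j} :=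
        (measurable_const.sub measurable_id : Measurable fun v : ι → ℝ => y - v) hbox
      rw [← lintegral_indicator_one hm]
      rfl
    rw [e]
    by_cases hy : ∀ j, |y j| ≤ 2 * R j
    · calc ν {v | ∀ j, |y j - v j| ≤ δ j} ≤ N * 1 := by rw [mul_one]; exact hN y
        _ ≤ N * (ENNReal.ofReal (Real.exp (2 * Fintype.card ι)) *
            ENNReal.ofReal (Real.exp (-∑ j, y j ^ 2 / (2 * R j ^ 2)))) := by
            gcongr
            rw [← ENNReal.ofReal_mul (Real.exp_pos _).le, ← Real.exp_add, ENNReal.one_le_ofReal,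
              Real.one_le_exp_iff]
            have : ∑ j, y j ^ 2 / (2 * R j ^ 2) ≤ ∑ _j : ι, (2 : ℝ) := by
              refine Finset.sum_le_sum fun j _ => ?_
              have hj := hR j
              rw [div_le_iff₀ (by positivity), ← sq_abs]
              calc |y j| ^ 2 ≤ (2 * R j) ^ 2 := by gcongr; exact hy j
                _ = _ := by ring
            simp at this
            linarith
        _ = _ := by ring
    · push Not at hy
      obtain ⟨j, hj⟩ := hy
      have : ν {v | ∀ j, |y j - v j| ≤ δ j} = 0 := by
        rw [← nonpos_iff_eq_zero, ← (ae_iff.mp hν)]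
        refine measure_mono fun v hv => ?_
        simp only [mem_ofPred_eq, not_forall, not_le] at hv ⊢
        refine ⟨j, ?_⟩
        have h1 := hv j
        have h2 := abs_sub_abs_le_abs_sub (y j) (v j)
        have h3 := hδR j
        linarith
      rw [this]; exact zero_le
  have s3 : ∫⁻ y, ENNReal.ofReal (Real.exp (-∑ j, y j ^ 2 / (2 * R j ^ 2))) * ‖G y‖ₑ ^ 2 ≤
      ENNReal.ofReal (2 * ((∏ j, (√(2 * Real.pi) * R j)) * (√(2 * Real.pi) / B) ^ Fintype.card κ))
        * ∫⁻ s, ‖g s‖ₑ ^ 2 := by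
    have h := lintegral_extension_gaussWeight hR hB hΦ hlow hgi hgS
    rw [gaussWeight, lintegral_withDensity_eq_lintegral_mul _
      (measurable_gaussDensity R).ennreal_ofReal (by exact hGm)] at h
    exact h
  have hVr : V = ENNReal.ofReal (2 ^ Fintype.card ι * ∏ j, δ j) := by
    rw [hV, volume_box, ← ENNReal.ofReal_prod_of_nonneg fun j _ => by have := hδ j; positivity,
      Finset.prod_mul_distrib]
    simp
  have s4 : V ^ 2 * ∫⁻ s, ‖g s‖ₑ ^ 2 ≤ ENNReal.ofReal (4 * (2 ^ Fintype.card ι) ^ 2) *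
      ∫⁻ s, ‖f s‖ₑ ^ 2 := by
    rw [← lintegral_const_mul' _ _ (by finiteness), ← lintegral_const_mul' _ _ (by finiteness)]
    refine lintegral_mono fun s => ?_
    rw [hVr, ← ofReal_norm, ← ofReal_norm, ← ENNReal.ofReal_pow (by positivity),
      ← ENNReal.ofReal_pow (by positivity), ← ENNReal.ofReal_pow (by positivity),
      ← ENNReal.ofReal_mul (by positivity), ← ENNReal.ofReal_mul (by positivity)]
    refine ENNReal.ofReal_le_ofReal ?_
    calc (2 ^ Fintype.card ι * ∏ j, δ j) ^ 2 * ‖g s‖ ^ 2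
        = (2 ^ Fintype.card ι) ^ 2 * ((∏ j, δ j) * ‖g s‖) ^ 2 := by ring
      _ ≤ (2 ^ Fintype.card ι) ^ 2 * (2 * ‖f s‖) ^ 2 :=
          mul_le_mul_of_nonneg_left (pow_le_pow_left₀ (by positivity) (hgf s) 2) (by positivity)
      _ = _ := by ring
  set K1 := ENNReal.ofReal (2 * ((∏ j, (√(2 * Real.pi) * R j)) *
    (√(2 * Real.pi) / B) ^ Fintype.card κ)) with hK1
  set E := ENNReal.ofReal (Real.exp (2 * Fintype.card ι)) with hE
  have s5 : ∫⁻ v, ‖∫ s, expDot v (Φ s) * f s‖ₑ ^ 2 ∂ν ≤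
      V * ((N * E) * (K1 * ∫⁻ s, ‖g s‖ₑ ^ 2)) := by
    calc ∫⁻ v, ‖∫ s, expDot v (Φ s) * f s‖ₑ ^ 2 ∂ν
        ≤ ∫⁻ v, (V * ∫⁻ y, χ (y - v) * ‖G y‖ₑ ^ 2) ∂ν := lintegral_mono s1
      _ = V * ∫⁻ y, ∫⁻ v, χ (y - v) * ‖G y‖ₑ ^ 2 ∂ν := by
          rw [lintegral_const_mul' _ _ hVtop, lintegral_lintegral_swap hmeas.aemeasurable]
      _ = V * ∫⁻ y, (∫⁻ v, χ (y - v) ∂ν) * ‖G y‖ₑ ^ 2 := by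
          congr 1
          refine lintegral_congr fun y => ?_
          rw [lintegral_mul_const' _ _ (by finiteness)]
      _ ≤ V * ∫⁻ y, (N * E) *
          (ENNReal.ofReal (Real.exp (-∑ j, y j ^ 2 / (2 * R j ^ 2))) * ‖G y‖ₑ ^ 2) := by
          exact mul_le_mul_right (lintegral_mono s2) _
      _ = V * ((N * E) *
          ∫⁻ y, (ENNReal.ofReal (Real.exp (-∑ j, y j ^ 2 / (2 * R j ^ 2))) * ‖G y‖ₑ ^ 2)) := by
          rw [lintegral_const_mul (N * E)
            (f := fun y => ENNReal.ofReal (Real.exp (-∑ j, y j ^ 2 / (2 * R j ^ 2))) * ‖G y‖ₑ ^ 2)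
            (((measurable_gaussDensity R).ennreal_ofReal).mul hGm)]
      _ ≤ _ := by gcongr
  -- An extra factor V is carried along: s1 supplies one V, while the bound for g in s4 needs V². It
  -- is cancelled at the end.
  have s6 : V * ∫⁻ v, ‖∫ s, expDot v (Φ s) * f s‖ₑ ^ 2 ∂ν ≤ V *
      (ENNReal.ofReal (extConst ι κ * (∏ j, R j / δ j) / B ^ Fintype.card κ) * N *
        ∫⁻ s, ‖f s‖ₑ ^ 2) := by
    calc V * ∫⁻ v, ‖∫ s, expDot v (Φ s) * f s‖ₑ ^ 2 ∂ν
        ≤ V * (V * ((N * E) * (K1 * ∫⁻ s, ‖g s‖ₑ ^ 2))) := by gcongr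
      _ = (N * E) * K1 * (V ^ 2 * ∫⁻ s, ‖g s‖ₑ ^ 2) := by ring
      _ ≤ (N * E) * K1 * (ENNReal.ofReal (4 * (2 ^ Fintype.card ι) ^ 2) * ∫⁻ s, ‖f s‖ₑ ^ 2) := by
          gcongr
      _ = (E * K1 * ENNReal.ofReal (4 * (2 ^ Fintype.card ι) ^ 2)) * (N * ∫⁻ s, ‖f s‖ₑ ^ 2) := by
          ring
      _ ≤ (V * ENNReal.ofReal (extConst ι κ * (∏ j, R j / δ j) / B ^ Fintype.card κ)) *
          (N * ∫⁻ s, ‖f s‖ₑ ^ 2) := by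
          refine mul_le_mul_left ?_ _
          rw [hE, hK1, hVr, ← ENNReal.ofReal_mul (by positivity), ← ENNReal.ofReal_mul
            (mul_nonneg (by positivity) (mul_nonneg (by positivity) (mul_nonneg
              (Finset.prod_nonneg fun j _ => mul_nonneg (by positivity) (hR j).le)
              (by positivity)))), ← ENNReal.ofReal_mul (mul_nonneg (by positivity) hP.le)]
          refine ENNReal.ofReal_le_ofReal (le_of_eq ?_)
          rw [extConst, Finset.prod_div_distrib, Finset.prod_mul_distrib, Finset.prod_const,
            Finset.card_univ, div_pow]
          have hBk : B ^ Fintype.card κ ≠ 0 := (pow_pos hB _).ne'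
          field_simp
          ring
      _ = _ := by ring
  exact (ENNReal.mul_le_mul_iff_right hVpos hVtop).mp s6

end Smoothing

/-! ### Quantitative nondegeneracy and rescaled coordinates -/

/-- Quantitative nondegeneracy of a curve on `[0,1]`: `D j` is the derivative of order `j`, and `M`
bounds the derivatives and the coordinates with respect to the frame `D 1, …, D d`. -/
structure IsNondegBy {d : ℕ} (γ : ℝ → EuclideanSpace ℝ (Fin d))
    (D : ℕ → ℝ → EuclideanSpace ℝ (Fin d)) (M : ℝ) : Prop where
  one_le : 1 ≤ M
  zero : D 0 = γ
  deriv : ∀ j ≤ d, ∀ t ∈ Icc (0 : ℝ) 1, HasDerivWithinAt (D j) (D (j + 1) t) (Icc 0 1) t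
  bound : ∀ j ≤ d + 1, ∀ t ∈ Icc (0 : ℝ) 1, ‖D j t‖ ≤ M
  frame : ∀ t ∈ Icc (0 : ℝ) 1, ∃ c : EuclideanSpace ℝ (Fin d) →ₗ[ℝ] (Fin d → ℝ),
    (∀ w, ∑ j : Fin d, c w j • D (j + 1) t = w) ∧
    (∀ i j : Fin d, c (D (i + 1) t) j = if i = j then 1 else 0) ∧ ∀ w j, |c w j| ≤ M * ‖w‖
  lower : ∀ t ∈ Icc (0 : ℝ) 1, ∀ x, ∀ ρ : ℝ, 0 ≤ ρ →
    (∀ j : Fin d, |inner ℝ x (D (j + 1) t)| ≤ ρ) → ‖x‖ ≤ M * ρ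

/-- Coordinates in the frame are given by the inverse of the matrix of derivatives. Its determinant
does not vanish, so the inverse is continuous on the compact interval and its entries are bounded.
-/
theorem exists_frame_bound {d : ℕ} {γ : ℝ → EuclideanSpace ℝ (Fin d)}
    (hγ : ContDiffOn ℝ ((d + 1 : ℕ) : WithTop ℕ∞) γ (Icc 0 1)) (hnd : Nondegenerate γ) :
    ∃ M : ℝ, 0 ≤ M ∧ ∀ t ∈ Icc (0 : ℝ) 1, ∃ c : EuclideanSpace ℝ (Fin d) →ₗ[ℝ] (Fin d → ℝ),
      (∀ w, ∑ j : Fin d, c w j • iteratedDerivWithin (j + 1) γ (Icc 0 1) t = w) ∧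
      (∀ i j : Fin d, c (iteratedDerivWithin (i + 1) γ (Icc 0 1) t) j = if i = j then 1 else 0) ∧
      ∀ w j, |c w j| ≤ M * ‖w‖ := by
  classical
  set A : ℝ → Matrix (Fin d) (Fin d) ℝ := fun t =>
    Matrix.of fun i j : Fin d => iteratedDerivWithin (j.val + 1) γ (Icc 0 1) t i with hA
  have hu : UniqueDiffOn ℝ (Icc (0 : ℝ) 1) := uniqueDiffOn_Icc zero_lt_one
  have hAc : ContinuousOn A (Icc 0 1) := by
    refine continuousOn_pi.mpr fun i => continuousOn_pi.mpr fun j => ?_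
    have h1 := hγ.continuousOn_iteratedDerivWithin (m := j.val + 1)
      (by exact_mod_cast Nat.succ_le_succ j.2.le) hu
    exact (EuclideanSpace.proj i).continuous.comp_continuousOn h1
  have hdet : ∀ t ∈ Icc (0 : ℝ) 1, (A t).det ≠ 0 := hnd
  have hinv : ContinuousOn (fun t => (A t)⁻¹) (Icc 0 1) := by
    have h1 : ContinuousOn (fun t => (A t).det) (Icc 0 1) :=
      (Continuous.matrix_det continuous_id).comp_continuousOn hAc
    have h2 : ContinuousOn (fun t => (A t).adjugate) (Icc 0 1) :=
      (Continuous.matrix_adjugate continuous_id).comp_continuousOn hAc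
    simp_rw [Matrix.inv_def, Ring.inverse_eq_inv']
    exact (h1.inv₀ hdet).smul h2
  have hb : ∀ i j : Fin d, ∃ C, ∀ t ∈ Icc (0 : ℝ) 1, ‖(A t)⁻¹ i j‖ ≤ C := fun i j =>
    isCompact_Icc.exists_bound_of_continuousOn
      (continuousOn_pi.mp (continuousOn_pi.mp hinv i) j)
  choose C hC using hb
  refine ⟨∑ i, ∑ j, |C i j|, by positivity, fun t ht => ?_⟩
  have hunit : IsUnit (A t).det := (hdet t ht).isUnit
  refine ⟨(Matrix.mulVecLin (A t)⁻¹).comp (WithLp.linearEquiv 2 ℝ (Fin d → ℝ)).toLinearMap,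
    fun w => ?_, fun i j => ?_, fun w j => ?_⟩
  · have h1 : (A t).mulVec ((A t)⁻¹.mulVec (WithLp.ofLp w)) = WithLp.ofLp w := by
      rw [Matrix.mulVec_mulVec, Matrix.mul_nonsing_inv _ hunit, Matrix.one_mulVec]
    ext i
    have h2 := congrFun h1 i
    rw [← h2]
    simp only [Matrix.mulVec, dotProduct, hA, Matrix.of_apply]
    simp [Matrix.mulVec, dotProduct, mul_comm]
  · have h1 : (A t)⁻¹.mulVec ((A t).col i) = Pi.single i 1 := by
      rw [← Matrix.mulVec_single_one, Matrix.mulVec_mulVec, Matrix.nonsing_inv_mul _ hunit,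
        Matrix.one_mulVec]
    have h2 := congrFun h1 j
    have h3 : (Pi.single i (1 : ℝ) : Fin d → ℝ) j = if i = j then 1 else 0 := by
      simp [Pi.single_apply, eq_comm]
    rw [← h3, ← h2]
    rfl
  · change |∑ i, (A t)⁻¹ j i * w i| ≤ _
    refine (Finset.abs_sum_le_sum_abs _ _).trans ?_
    have h1 : ∀ i, |(A t)⁻¹ j i * w i| ≤ |C j i| * ‖w‖ := fun i => by
      rw [abs_mul]
      have h2 : |w i| ≤ ‖w‖ := by simpa using PiLp.norm_apply_le w i
      have h3 := (hC j i t ht).trans (le_abs_self _)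
      rw [Real.norm_eq_abs] at h3
      gcongr
    refine (Finset.sum_le_sum fun i _ => h1 i).trans ?_
    rw [← Finset.sum_mul]
    exact mul_le_mul_of_nonneg_right (Finset.single_le_sum (f := fun j => ∑ i, |C j i|)
      (fun _ _ => by positivity) (Finset.mem_univ j)) (norm_nonneg _)

theorem exists_isNondegBy {d : ℕ} {γ : ℝ → EuclideanSpace ℝ (Fin d)}
    (hγ : ContDiffOn ℝ ((d + 1 : ℕ) : WithTop ℕ∞) γ (Icc 0 1)) (hnd : Nondegenerate γ) :
    ∃ D M, IsNondegBy γ D M := by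
  have hu : UniqueDiffOn ℝ (Icc (0 : ℝ) 1) := uniqueDiffOn_Icc zero_lt_one
  obtain ⟨M₀, hM₀, hfr⟩ := exists_frame_bound hγ hnd
  have hb : ∀ j : ℕ, ∃ C, j ≤ d + 1 → ∀ t ∈ Icc (0 : ℝ) 1,
      ‖iteratedDerivWithin j γ (Icc 0 1) t‖ ≤ C := by
    intro j
    by_cases hj : j ≤ d + 1
    · obtain ⟨C, hC⟩ := isCompact_Icc.exists_bound_of_continuousOn
        (hγ.continuousOn_iteratedDerivWithin (m := j) (by exact_mod_cast hj) hu)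
      exact ⟨C, fun _ => hC⟩
    · exact ⟨0, fun h => absurd h hj⟩
  choose C hC using hb
  set M₁ := ∑ j ∈ Finset.range (d + 2), |C j| with hM₁
  have hM₁0 : 0 ≤ M₁ := by positivity
  refine ⟨fun j => iteratedDerivWithin j γ (Icc 0 1), 1 + M₁ + (1 + d) * M₀, ?_, ?_, ?_, ?_, ?_, ?_⟩
  · have : 0 ≤ (1 + (d : ℝ)) * M₀ := by positivity
    linarith
  · exact iteratedDerivWithin_zero
  · intro j hj t ht
    have h1 := hγ.differentiableOn_iteratedDerivWithin (m := j)
      (by exact_mod_cast Nat.lt_succ_of_le hj) hu t ht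
    simp only [iteratedDerivWithin_succ]
    exact h1.hasDerivWithinAt
  · intro j hj t ht
    have h1 : |C j| ≤ M₁ := Finset.single_le_sum (f := fun j => |C j|) (fun _ _ => abs_nonneg _)
      (Finset.mem_range.mpr (by omega))
    have h2 : 0 ≤ (1 + (d : ℝ)) * M₀ := by positivity
    have h3 := hC j hj t ht
    have h4 := le_abs_self (C j)
    linarith
  · intro t ht
    obtain ⟨c, h1, h2, h3⟩ := hfr t ht
    refine ⟨c, h1, h2, fun w j => (h3 w j).trans ?_⟩
    gcongr
    nlinarith [(Nat.cast_nonneg d : (0 : ℝ) ≤ d)]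
  · intro t ht x ρ hρ hx
    obtain ⟨c, h1, -, h3⟩ := hfr t ht
    -- Expanding one copy of x in the frame writes ‖x‖² through the inner products assumed small,
    -- with coefficients of size M₀‖x‖.
    have h4 : ‖x‖ * ‖x‖ ≤ ‖x‖ * (d * M₀ * ρ) := by
      rw [← real_inner_self_eq_norm_mul_norm]
      nth_rewrite 2 [← h1 x]
      rw [inner_sum]
      refine (Finset.sum_le_sum (g := fun _ => M₀ * ‖x‖ * ρ) fun j _ => ?_).trans (le_of_eq ?_)
      · rw [inner_smul_right]
        refine (le_abs_self _).trans ?_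
        rw [abs_mul]
        exact mul_le_mul (h3 x j) (hx j) (abs_nonneg _) (by positivity)
      · simp; ring
    by_cases hx0 : ‖x‖ = 0
    · rw [hx0]
      positivity
    · have h5 : ‖x‖ ≤ d * M₀ * ρ := le_of_mul_le_mul_left h4 (by positivity)
      refine h5.trans ?_
      gcongr
      nlinarith

/-- Taylor's formula along a chain of derivatives. -/
theorem taylor_chain {E : Type*} [NormedAddCommGroup E] [NormedSpace ℝ E] {I : Set ℝ}
    (hI : Convex ℝ I) {M : ℝ} (m : ℕ) : ∀ F : ℕ → ℝ → E,
    (∀ j < m, ∀ t ∈ I, HasDerivWithinAt (F j) (F (j + 1) t) I t) → (∀ t ∈ I, ‖F m t‖ ≤ M) →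
    ∀ t₀ ∈ I, ∀ t ∈ I,
      ‖F 0 t - ∑ i ∈ Finset.range m, ((t - t₀) ^ i / (i.factorial : ℝ)) • F i t₀‖ ≤
        M * |t - t₀| ^ m := by
  induction m with
  | zero => intro F _ hM t₀ _ t ht; simpa using hM t ht
  | succ m ih =>
    intro F hF hM t₀ ht₀ t ht
    have hsub : uIcc t₀ t ⊆ I := by
      rw [← segment_eq_uIcc]; exact hI.segment_subset ht₀ ht
    have hM0 : 0 ≤ M := (norm_nonneg _).trans (hM t ht)
    -- The derivative of the Taylor remainder is the remainder of the shifted chain, so the mean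
    -- value inequality raises the order by one; the factorial in the error term is given up.
    have h1 := ih (fun j => F (j + 1)) (fun j hj => hF (j + 1) (by omega)) hM t₀ ht₀
    set g : ℝ → E := fun t => F 0 t - ∑ i ∈ Finset.range (m + 1),
      ((t - t₀) ^ i / (i.factorial : ℝ)) • F i t₀ with hg
    have hd : ∀ u ∈ uIcc t₀ t, HasDerivWithinAt g
        (F 1 u - ∑ i ∈ Finset.range m, ((u - t₀) ^ i / (i.factorial : ℝ)) • F (i + 1) t₀)
        (uIcc t₀ t) u := by
      intro u hu
      refine ((hF 0 (by omega) u (hsub hu)).mono hsub).sub ?_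
      simp only [Finset.sum_range_succ' _ m]
      simp only [pow_zero, Nat.factorial_zero, Nat.cast_one, div_one, one_smul]
      refine HasDerivWithinAt.add_const _ ?_
      refine HasDerivWithinAt.fun_sum fun i _ => ?_
      refine HasDerivWithinAt.smul_const ?_ _
      have h2 : HasDerivAt (fun x : ℝ => (x - t₀) ^ (i + 1)) (((i + 1 : ℕ) : ℝ) * (u - t₀) ^ i * 1)
        u := by
        have := ((hasDerivAt_id u).sub_const t₀).fun_pow (i + 1)
        simpa only [Nat.add_sub_cancel, id] using this
      have h3 := (h2.div_const ((i + 1).factorial : ℝ)).hasDerivWithinAt (s := uIcc t₀ t)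
      refine h3.congr_deriv ?_
      rw [Nat.factorial_succ]
      have := Nat.factorial_ne_zero i
      push_cast
      field_simp
    have h2 := Convex.norm_image_sub_le_of_norm_hasDerivWithin_le (C := M * |t - t₀| ^ m) hd
      (fun u hu => (h1 u (hsub hu)).trans (
        mul_le_mul_of_nonneg_left
          (pow_le_pow_left₀ (abs_nonneg _) (abs_sub_left_of_mem_uIcc hu) m) hM0))
      (convex_uIcc t₀ t) left_mem_uIcc right_mem_uIcc
    have h3 : g t₀ = 0 := by
      simp [hg, Finset.sum_range_succ']
    rw [h3, sub_zero, Real.norm_eq_abs] at h2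
    rw [pow_succ, ← mul_assoc]
    exact h2

/-- After rescaling by the frame at t₀, a short arc resembles the moment curve: in the variable u =
(t-t₀)/h the j-th coordinate has derivative u^j/j! up to O(h). G consists of the frame coordinates
of γ - γ(t₀), the j-th one divided by h^(j+1). -/
theorem IsNondegBy.exists_coords {d : ℕ} {γ : ℝ → EuclideanSpace ℝ (Fin d)}
    {D : ℕ → ℝ → EuclideanSpace ℝ (Fin d)} {M : ℝ} (hD : IsNondegBy γ D M) {t₀ h : ℝ}
    (ht₀ : 0 ≤ t₀) (hh : 0 < h) (ht₁ : t₀ + h ≤ 1) :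
    ∃ G G' : ℝ → Fin d → ℝ, Continuous G ∧
      (∀ t ∈ Icc t₀ (t₀ + h), ∀ x, inner ℝ x (γ t - γ t₀) =
        ∑ j : Fin d, h ^ (j.val + 1) * inner ℝ x (D (j + 1) t₀) * G t j) ∧
      (∀ t ∈ Icc t₀ (t₀ + h), ∀ j,
        HasDerivWithinAt (fun t => G t j) (G' t j) (Icc t₀ (t₀ + h)) t) ∧
      (∀ t ∈ Icc t₀ (t₀ + h), ∀ j : Fin d,
        |h * G' t j - ((t - t₀) / h) ^ j.val / (j.val.factorial : ℝ)| ≤ M ^ 2 * h) ∧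
      ∀ t ∈ Icc t₀ (t₀ + h), ∀ j, |G t j| ≤ 1 + M ^ 2 := by
  have hM := hD.one_le
  have hh1 : h ≤ 1 := by linarith
  have hle : t₀ ≤ t₀ + h := by linarith
  have hsub : Icc t₀ (t₀ + h) ⊆ Icc 0 1 := Icc_subset_Icc ht₀ ht₁
  have ht₀' : t₀ ∈ Icc t₀ (t₀ + h) := ⟨le_rfl, hle⟩
  obtain ⟨c, hc1, hc2, hc3⟩ := hD.frame t₀ (hsub ht₀')
  have hγd : ∀ t ∈ Icc (0 : ℝ) 1, HasDerivWithinAt γ (D 1 t) (Icc 0 1) t := by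
    have := hD.deriv 0 (Nat.zero_le _)
    rw [hD.zero] at this
    exact this
  have hγc : ContinuousOn γ (Icc t₀ (t₀ + h)) :=
    (HasDerivWithinAt.continuousOn hγd).mono hsub
  have hcc : Continuous c := LinearMap.continuous_of_finiteDimensional c
  -- Extending γ by its endpoint values makes G continuous on all of ℝ, as needed for measurability
  -- of the sum map.
  set G : ℝ → Fin d → ℝ := fun t j =>
    c (IccExtend hle ((Icc t₀ (t₀ + h)).restrict γ) t - γ t₀) j / h ^ (j.val + 1) with hG
  have hGe : ∀ t ∈ Icc t₀ (t₀ + h), ∀ j, G t j = c (γ t - γ t₀) j / h ^ (j.val + 1) := by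
    intro t ht j
    simp only [hG, IccExtend_of_mem hle _ ht]
    rfl
  set G' : ℝ → Fin d → ℝ := fun t j => c (D 1 t) j / h ^ (j.val + 1) with hG'
  have hderiv : ∀ t ∈ Icc t₀ (t₀ + h), ∀ j,
      HasDerivWithinAt (fun t => G t j) (G' t j) (Icc t₀ (t₀ + h)) t := by
    intro t ht j
    have h1 : HasDerivWithinAt (fun t => γ t - γ t₀) (D 1 t) (Icc t₀ (t₀ + h)) t :=
      ((hγd t (hsub ht)).mono hsub).sub_const _
    have h2 := (LinearMap.toContinuousLinearMap c).hasFDerivAt.comp_hasDerivWithinAt t h1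
    have h3 := (hasDerivWithinAt_pi.mp h2 j).div_const (h ^ (j.val + 1))
    refine h3.congr (fun u hu => ?_) ?_
    · exact hGe u hu j
    · exact hGe t ht j
  have happ : ∀ t ∈ Icc t₀ (t₀ + h), ∀ j : Fin d,
      |h * G' t j - ((t - t₀) / h) ^ j.val / (j.val.factorial : ℝ)| ≤ M ^ 2 * h := by
    intro t ht j
    have h1 := taylor_chain (convex_Icc (0 : ℝ) 1) (M := M) d (fun i => D (i + 1))
      (fun i hi => hD.deriv (i + 1) (by omega)) (hD.bound (d + 1) le_rfl) t₀ (hsub ht₀') t (hsub ht)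
    rw [Finset.sum_range (fun i => ((t - t₀) ^ i / (i.factorial : ℝ)) • D (i + 1) t₀)] at h1
    have h2 := hc3 (D 1 t - ∑ i : Fin d, ((t - t₀) ^ i.val / (i.val.factorial : ℝ)) • D (i + 1) t₀) j
    have h3 : c (D 1 t - ∑ i : Fin d, ((t - t₀) ^ i.val / (i.val.factorial : ℝ)) • D (i + 1) t₀) j =
        c (D 1 t) j - (t - t₀) ^ j.val / (j.val.factorial : ℝ) := by
      rw [map_sub, map_sum, Pi.sub_apply, Finset.sum_apply]
      congr 1
      rw [Finset.sum_eq_single j]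
      · simp [hc2]
      · intro i _ hij
        simp [hc2, hij]
      · simp
    rw [h3] at h2
    have h4 : |c (D 1 t) j - (t - t₀) ^ j.val / (j.val.factorial : ℝ)| ≤ M * (M * h ^ d) := by
      refine h2.trans ?_
      gcongr
      refine h1.trans ?_
      gcongr
      rw [abs_of_nonneg (by linarith [ht.1])]
      linarith [ht.2]
    have h5 : h * G' t j - ((t - t₀) / h) ^ j.val / (j.val.factorial : ℝ) =
        (c (D 1 t) j - (t - t₀) ^ j.val / (j.val.factorial : ℝ)) / h ^ j.val := by
      simp only [hG']
      rw [pow_succ, div_pow]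
      field_simp
    rw [h5, abs_div, abs_of_pos (pow_pos hh j.val), div_le_iff₀ (pow_pos hh j.val)]
    refine h4.trans ?_
    -- The Taylor error h^d is divided by h^j with j < d, so one power of h survives in every
    -- coordinate.
    have h6 : h ^ d ≤ h ^ (j.val + 1) := pow_le_pow_of_le_one hh.le hh1 j.2
    rw [pow_succ] at h6
    nlinarith [mul_le_mul_of_nonneg_left h6 (by positivity : 0 ≤ M ^ 2)]
  refine ⟨G, G', ?_, ?_, hderiv, happ, ?_⟩
  · refine continuous_pi fun j => ?_
    refine ((continuous_apply j).comp (hcc.comp (Continuous.sub ?_ continuous_const))).div_const _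
    exact (continuousOn_iff_continuous_domRestrict.mp hγc).Icc_extend'
  · intro t ht x
    nth_rewrite 1 [← hc1 (γ t - γ t₀)]
    rw [inner_sum]
    refine Finset.sum_congr rfl fun j _ => ?_
    rw [inner_smul_right, hGe t ht]
    field_simp
  · intro t ht j
    have h0 : G t₀ j = 0 := by simp [hGe t₀ ht₀']
    have h1 : ∀ u ∈ Icc t₀ (t₀ + h), ‖G' u j‖ ≤ (1 + M ^ 2) / h := by
      intro u hu
      rw [Real.norm_eq_abs, le_div_iff₀ hh, mul_comm]
      nth_rewrite 1 [← abs_of_pos hh]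
      rw [← abs_mul]
      have h2 := happ u hu j
      have h3 : |((u - t₀) / h) ^ j.val / (j.val.factorial : ℝ)| ≤ 1 := by
        have h4 : 0 ≤ (u - t₀) / h := div_nonneg (by linarith [hu.1]) hh.le
        have h5 : (u - t₀) / h ≤ 1 := by rw [div_le_one hh]; linarith [hu.2]
        rw [abs_of_nonneg (by positivity)]
        refine div_le_one_of_le₀ ((pow_le_one₀ h4 h5).trans ?_) (by positivity)
        exact_mod_cast Nat.factorial_pos _
      have h6 : M ^ 2 * h ≤ M ^ 2 := mul_le_of_le_one_right (by positivity) hh1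
      have h7 := abs_sub_abs_le_abs_sub (h * G' u j) (((u - t₀) / h) ^ j.val / (j.val.factorial : ℝ))
      linarith
    have h2 := Convex.norm_image_sub_le_of_norm_hasDerivWithin_le (f := fun t => G t j)
      (fun u hu => hderiv u hu j) h1 (convex_Icc _ _) ht₀' ht
    simp only [h0, sub_zero, Real.norm_eq_abs] at h2
    refine h2.trans ?_
    rw [div_mul_eq_mul_div, div_le_iff₀ hh, abs_of_nonneg (by linarith [ht.1])]
    have := ht.2
    gcongr
    linarith

/-! ### The sum map over separated intervals -/

/-- A polynomial with prescribed signs on separated intervals. -/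
theorem exists_polynomial_sign {lo hi s : ℕ → ℝ} {σ : ℝ} (hσ : 0 < σ) (hσ1 : σ ≤ 1)
    (hs : ∀ i, s i = 1 ∨ s i = -1) (k : ℕ) (h0 : ∀ i ≤ k, 0 ≤ lo i) (h1 : ∀ i ≤ k, hi i ≤ 1)
    (hle : ∀ i ≤ k, lo i ≤ hi i) (hsep : ∀ i < k, hi i + σ ≤ lo (i + 1))  :
    ∃ P : Polynomial ℝ, P.natDegree ≤ k ∧ (∀ n, |P.coeff n| ≤ 2 ^ k) ∧
      (∀ i ≤ k, ∀ x ∈ Icc (lo i) (hi i), (σ / 2) ^ k ≤ s i * P.eval x) ∧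
      (∀ x, lo k ≤ x → (σ / 2) ^ k ≤ s k * P.eval x) ∧ ∀ i ≤ k, hi i ≤ hi k := by
  have hss : ∀ i, s i * s i = 1 := fun i => by rcases hs i with h | h <;> rw [h] <;> norm_num
  -- The last two clauses serve the induction: the sign of the last interval persists to its right,
  -- and `hi k` dominates the earlier right ends.
  induction k with
  | zero =>
    refine ⟨Polynomial.C (s 0), by simp, fun n => ?_, ?_, ?_, ?_⟩
    · rw [Polynomial.coeff_C]
      split_ifs
      · rcases hs 0 with h | h <;> rw [h] <;> norm_num
      · simp
    · intro i hi x _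
      obtain rfl : i = 0 := by omega
      simp [hss]
    · intro x _; simp [hss]
    · intro i hi
      obtain rfl : i = 0 := by omega
      exact le_rfl
  | succ k ih =>
    obtain ⟨P, hP1, hP2, hP3, hP4, hP5⟩ := ih (fun i hi => h0 i (by omega))
      (fun i hi => h1 i (by omega)) (fun i hi => hle i (by omega)) (fun i hi => hsep i (by omega))
    have e1 := hsep k (Nat.lt_succ_self k)
    have e2 := hle (k + 1) le_rfl
    have e3 := hle k (Nat.le_succ k)
    have e4 := h1 (k + 1) le_rfl
    have e5 := h0 k (Nat.le_succ k)
    have hmono : ∀ i ≤ k + 1, hi i ≤ hi (k + 1) := by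
      intro i hi'
      rcases Nat.le_succ_iff.mp hi' with h | h
      · have := hP5 i h
        linarith
      · rw [h]
    have hpow : (σ / 2) ^ (k + 1) = (σ / 2) ^ k * (σ / 2) := pow_succ _ _
    have hp0 : 0 < (σ / 2) ^ k := by positivity
    by_cases hk : s (k + 1) = s k
    · have hp : (σ / 2) ^ (k + 1) ≤ (σ / 2) ^ k := by rw [hpow]; nlinarith
      refine ⟨P, by omega, fun n => (hP2 n).trans ?_, ?_, ?_, hmono⟩
      · exact pow_le_pow_right₀ (by norm_num) (Nat.le_succ k)
      · intro i hi' x hx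
        rcases Nat.le_succ_iff.mp hi' with h | h
        · exact hp.trans (hP3 i h x hx)
        · subst h
          rw [hk]
          exact hp.trans (hP4 x (by linarith [hx.1]))
      · intro x hx
        rw [hk]
        exact hp.trans (hP4 x (by linarith))
    · have hk' : s (k + 1) = - s k := by
        rcases hs k with h | h <;> rcases hs (k + 1) with h' | h' <;> simp_all
      -- A sign change is produced by a simple root inside the gap, at distance at least σ/2 from
      -- all intervals. The factor costs σ/2 in the lower bound and, as 0 ≤ z ≤ 1, at most doubles
      -- the coefficients.
      set z := hi k + σ / 2 with hz
      have hz0 : 0 ≤ z := by linarith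
      have hz1 : z ≤ 1 := by linarith
      have hev : ∀ x, (P * (Polynomial.C z - Polynomial.X)).eval x = P.eval x * (z - x) := by
        intro x; simp
      have hlast : ∀ x, lo (k + 1) ≤ x →
          (σ / 2) ^ (k + 1) ≤ s (k + 1) * (P * (Polynomial.C z - Polynomial.X)).eval x := by
        intro x hx
        have h2 := hP4 x (by linarith)
        rw [hev, hk', hpow]
        calc (σ / 2) ^ k * (σ / 2) ≤ (s k * P.eval x) * (x - z) := by
              exact mul_le_mul h2 (by rw [hz]; linarith) (by positivity) (hp0.le.trans h2)
          _ = _ := by ring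
      refine ⟨P * (Polynomial.C z - Polynomial.X), ?_, fun n => ?_, ?_, hlast, hmono⟩
      · refine Polynomial.natDegree_mul_le.trans ?_
        gcongr
        refine (Polynomial.natDegree_sub_le _ _).trans ?_
        simp
      · rw [mul_sub, Polynomial.coeff_sub, Polynomial.coeff_mul_C]
        have h2 : |P.coeff n * z| ≤ 2 ^ k := by
          rw [abs_mul, abs_of_nonneg hz0]
          exact (mul_le_of_le_one_right (abs_nonneg _) hz1).trans (hP2 n)
        have h3 : |(P * Polynomial.X).coeff n| ≤ 2 ^ k := by
          cases n with
          | zero => simp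
          | succ n => rw [Polynomial.coeff_mul_X]; exact hP2 n
        calc |P.coeff n * z - (P * Polynomial.X).coeff n|
            ≤ |P.coeff n * z| + |(P * Polynomial.X).coeff n| := abs_sub _ _
          _ ≤ 2 ^ (k + 1) := by rw [pow_succ]; linarith
      · intro i hi' x hx
        rcases Nat.le_succ_iff.mp hi' with h | h
        · have h2 := hP3 i h x hx
          have h3 := hP5 i h
          rw [hev, hpow, ← mul_assoc]
          exact mul_le_mul h2 (by have := hx.2; rw [hz]; linarith) (by positivity) (hp0.le.trans h2)
        · subst h
          exact hlast x hx.1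

/-- Lower bound for the sum map of a curve over separated intervals. -/
theorem sum_curve_lower_bound {d k K : ℕ} (hk : k + 1 ≤ d) (hK : 0 < K) {M h t₀ : ℝ}
    (hh : 0 < h)
    (hsmall : (k + 1) * (2 ^ k * k.factorial) * (M ^ 2 * h) ≤ (1 / (2 * K : ℝ)) ^ k / 2)
    {G G' : ℝ → Fin d → ℝ}
    (hG' : ∀ t ∈ Icc t₀ (t₀ + h), ∀ j,
        HasDerivWithinAt (fun t => G t j) (G' t j) (Icc t₀ (t₀ + h)) t)
    (happ : ∀ t ∈ Icc t₀ (t₀ + h), ∀ j : Fin d,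
        |h * G' t j - ((t - t₀) / h) ^ j.val / (j.val.factorial : ℝ)| ≤ M ^ 2 * h)
    {b : Fin (k + 1) → ℕ} (hbK : ∀ i, b i < K) (hb : ∀ i j, i < j → b i + 2 ≤ b j)
    {t t' : Fin (k + 1) → ℝ}
    (ht : ∀ i, t i ∈ Icc (t₀ + b i * (h / K)) (t₀ + (b i + 1) * (h / K)))
    (ht' : ∀ i, t' i ∈ Icc (t₀ + b i * (h / K)) (t₀ + (b i + 1) * (h / K))) :
    (1 / (2 * K : ℝ)) ^ k / 2 / h * ∑ i, |t i - t' i| ≤ 2 ^ k * k.factorial *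
      ∑ j : Fin (k + 1), |∑ i, (G (t i) (Fin.castLE hk j) - G (t' i) (Fin.castLE hk j))| := by
  classical
  have hKr : (0 : ℝ) < K := by exact_mod_cast hK
  have hK1 : (1 : ℝ) ≤ K := by exact_mod_cast hK
  set bb : ℕ → ℕ := fun i => if hi : i < k + 1 then b ⟨i, hi⟩ else 0 with hbb
  have hbbi : ∀ i (hi : i < k + 1), bb i = b ⟨i, hi⟩ := fun i hi => dif_pos hi
  -- The signs are those of t i - t' i, so the polynomial depends on the pair of tuples while the
  -- bounds for it do not.
  set s : ℕ → ℝ := fun i => if hi : i < k + 1 then (if t' ⟨i, hi⟩ ≤ t ⟨i, hi⟩ then 1 else -1) else 1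
    with hs
  obtain ⟨P, hP1, hP2, hP3, -, -⟩ := exists_polynomial_sign (σ := 1 / K)
    (lo := fun i => (bb i : ℝ) / K) (hi := fun i => ((bb i : ℝ) + 1) / K) (s := s) (by positivity)
    (by rw [div_le_one hKr]; exact hK1)
    (fun i => by simp only [hs]; split_ifs <;> simp) k (fun i _ => by positivity)
    (fun i hi => by
      rw [div_le_one hKr, hbbi i (by omega)]
      exact_mod_cast hbK _)
    (fun i _ => by gcongr; linarith)
    (fun i hi => by
      rw [hbbi i (by omega), hbbi (i + 1) (by omega), ← add_div]
      gcongr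
      have := hb ⟨i, by omega⟩ ⟨i + 1, by omega⟩ (by simp [Fin.lt_def])
      have h2 : ((b ⟨i, by omega⟩ + 2 : ℕ) : ℝ) ≤ b ⟨i + 1, by omega⟩ := by exact_mod_cast this
      push_cast at h2
      linarith)
  -- The polynomial has size at least 2ω on the intervals; half of this absorbs the error ω of the
  -- Taylor approximation.
  set ω : ℝ := (1 / (2 * K : ℝ)) ^ k / 2 with hω
  have hωe : (1 / (K : ℝ) / 2) ^ k = 2 * ω := by
    rw [hω]; rw [div_div, mul_comm (K : ℝ) 2]; ring
  -- The factorials undo the 1/j! of the coordinates, so that hΨ' is close to P((t-t₀)/h).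
  set a : Fin (k + 1) → ℝ := fun j => P.coeff j * (j.val.factorial : ℝ) with ha
  have hab : ∀ j, |a j| ≤ 2 ^ k * k.factorial := by
    intro j
    rw [ha, abs_mul, Nat.abs_cast]
    have : (j.val.factorial : ℝ) ≤ k.factorial := by
      exact_mod_cast Nat.factorial_le (by omega)
    exact mul_le_mul (hP2 _) this (by positivity) (by positivity)
  set Ψ : ℝ → ℝ := fun u => ∑ j : Fin (k + 1), a j * G u (Fin.castLE hk j) with hΨ
  set Ψ' : ℝ → ℝ := fun u => ∑ j : Fin (k + 1), a j * G' u (Fin.castLE hk j) with hΨ'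
  have hΨd : ∀ u ∈ Icc t₀ (t₀ + h), HasDerivWithinAt Ψ (Ψ' u) (Icc t₀ (t₀ + h)) u := fun u hu =>
    HasDerivWithinAt.fun_sum fun j _ => (hG' u hu _).const_mul (a j)
  have hΨa : ∀ u ∈ Icc t₀ (t₀ + h), |h * Ψ' u - P.eval ((u - t₀) / h)| ≤ ω := by
    intro u hu
    refine le_trans ?_ hsmall
    rw [Polynomial.eval_eq_sum_range' (Nat.lt_succ_of_le hP1), Finset.sum_range, hΨ',
      Finset.mul_sum, ← Finset.sum_sub_distrib]
    refine (Finset.abs_sum_le_sum_abs _ _).trans ?_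
    have : ∀ j : Fin (k + 1), |h * (a j * G' u (Fin.castLE hk j)) -
        P.coeff j * ((u - t₀) / h) ^ j.val| ≤ (2 ^ k * k.factorial) * (M ^ 2 * h) := by
      intro j
      have h1 := happ u hu (Fin.castLE hk j)
      have h2 : h * (a j * G' u (Fin.castLE hk j)) - P.coeff j * ((u - t₀) / h) ^ j.val =
          a j * (h * G' u (Fin.castLE hk j) - ((u - t₀) / h) ^ j.val / (j.val.factorial : ℝ)) := by
        have : (j.val.factorial : ℝ) ≠ 0 := by positivity
        simp only [ha]
        field_simp
      rw [h2, abs_mul]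
      exact mul_le_mul (hab j) h1 (abs_nonneg _) (by positivity)
    refine (Finset.sum_le_sum fun j _ => this j).trans (le_of_eq ?_)
    simp
    ring
  have hsubJ : ∀ i, Icc (t₀ + b i * (h / K)) (t₀ + (b i + 1) * (h / K)) ⊆ Icc t₀ (t₀ + h) := by
    intro i
    refine Icc_subset_Icc (by have : 0 ≤ b i * (h / K) := by positivity
                              linarith) ?_
    have h1 : ((b i : ℝ) + 1) ≤ K := by exact_mod_cast hbK i
    have : ((b i : ℝ) + 1) * (h / K) ≤ K * (h / K) := by gcongr
    rw [mul_div_cancel₀ _ hKr.ne'] at this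
    linarith
  have hpt : ∀ i : Fin (k + 1), ∀ u ∈ Icc (t₀ + b i * (h / K)) (t₀ + (b i + 1) * (h / K)),
      ω / h ≤ s i * Ψ' u := by
    intro i u hu
    have h1 := hΨa u (hsubJ i hu)
    have h2 := hP3 i (by omega) ((u - t₀) / h) (by
      rw [hbbi i i.2]
      constructor
      · rw [div_le_div_iff₀ hKr hh]
        have := hu.1
        have e : (b i : ℝ) * h = (b i * (h / K)) * K := by field_simp
        rw [Fin.eta, e]; gcongr; linarith
      · rw [div_le_div_iff₀ hh hKr]
        have := hu.2
        have e : ((b i : ℝ) + 1) * h = ((b i + 1) * (h / K)) * K := by field_simp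
        rw [Fin.eta, e]; gcongr; linarith)
    rw [hωe] at h2
    rw [div_le_iff₀ hh]
    have h3 : s i = 1 ∨ s i = -1 := by simp only [hs]; split_ifs <;> simp
    rw [abs_le] at h1
    rcases h3 with h3 | h3 <;> rw [h3] at h2 ⊢ <;> nlinarith [h1.1, h1.2]
  have hmv : ∀ i : Fin (k + 1), ω / h * |t i - t' i| ≤ Ψ (t i) - Ψ (t' i) := by
    intro i
    set J := Icc (t₀ + b i * (h / K)) (t₀ + (b i + 1) * (h / K)) with hJ
    have hdJ : ∀ u ∈ J, HasDerivWithinAt Ψ (Ψ' u) J u := fun u hu =>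
      (hΨd u (hsubJ i hu)).mono (hsubJ i)
    have hc : ContinuousOn (fun u => s i * Ψ u) J := fun u hu =>
      ((hdJ u hu).const_mul (s i)).continuousWithinAt
    have hda : ∀ u ∈ interior J, HasDerivAt (fun u => s i * Ψ u) (s i * Ψ' u) u := fun u hu =>
      ((hdJ u (interior_subset hu)).hasDerivAt (mem_interior_iff_mem_nhds.mp hu)).const_mul (s i)
    have hmain : ∀ x ∈ J, ∀ y ∈ J, x ≤ y → ω / h * (y - x) ≤ s i * Ψ y - s i * Ψ x :=
      Convex.mul_sub_le_image_sub_of_le_deriv (convex_Icc _ _) hc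
        (fun u hu => (hda u hu).differentiableAt.differentiableWithinAt)
        (fun u hu => by rw [(hda u hu).deriv]; exact hpt i u (interior_subset hu))
    have hsi : s i = if t' i ≤ t i then 1 else -1 := dif_pos i.2
    by_cases hti : t' i ≤ t i
    · rw [if_pos hti] at hsi
      have := hmain _ (ht' i) _ (ht i) hti
      rw [abs_of_nonneg (by linarith)]
      rw [hsi] at this
      linarith
    · rw [if_neg hti] at hsi
      push Not at hti
      have := hmain _ (ht i) _ (ht' i) hti.le
      rw [abs_of_nonpos (by linarith), neg_sub]
      rw [hsi] at this
      linarith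
  -- By the choice of signs all increments of Ψ are nonnegative and add up without cancellation;
  -- their sum is a linear combination of the coordinates of the sum map.
  calc ω / h * ∑ i, |t i - t' i| ≤ ∑ i, (Ψ (t i) - Ψ (t' i)) := by
        rw [Finset.mul_sum]; exact Finset.sum_le_sum fun i _ => hmv i
    _ = ∑ j : Fin (k + 1),
        a j * ∑ i, (G (t i) (Fin.castLE hk j) - G (t' i) (Fin.castLE hk j)) := by
        simp only [hΨ, ← Finset.sum_sub_distrib, ← mul_sub, Finset.mul_sum]
        rw [Finset.sum_comm]
    _ ≤ ∑ j : Fin (k + 1), 2 ^ k * k.factorial *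
        |∑ i, (G (t i) (Fin.castLE hk j) - G (t' i) (Fin.castLE hk j))| := by
        refine Finset.sum_le_sum fun j _ => ?_
        refine (le_abs_self _).trans ?_
        rw [abs_mul]
        gcongr
        exact hab j
    _ = _ := by rw [Finset.mul_sum]

/-! ### Consequences of the growth condition -/

section Growth

variable {d : ℕ} {α : ℝ} {μ : Measure (EuclideanSpace ℝ (Fin d))}

theorem measure_ball_le_growthNorm (x : EuclideanSpace ℝ (Fin d)) {r : ℝ} (hr : 0 < r) :
    μ (Metric.ball x r) ≤ growthNorm α μ * ENNReal.ofReal (r ^ α) := by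
  have h1 : ENNReal.ofReal (r ^ (-α)) * μ (Metric.ball x r) ≤ growthNorm α μ :=
    le_iSup_of_le x (le_iSup_of_le r (le_iSup_of_le hr le_rfl))
  calc μ (Metric.ball x r)
      = (ENNReal.ofReal (r ^ (-α)) * μ (Metric.ball x r)) * ENNReal.ofReal (r ^ α) := by
        rw [mul_right_comm, ← ENNReal.ofReal_mul (by positivity), ← Real.rpow_add hr]
        simp
    _ ≤ _ := by gcongr

theorem growthNorm_ne_top (h : HasGrowth α μ) : growthNorm α μ ≠ ⊤ := by
  obtain ⟨C, hC⟩ := h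
  refine ne_top_of_le_ne_top (b := ENNReal.ofReal C) ENNReal.ofReal_ne_top ?_
  refine iSup_le fun x => iSup_le fun r => iSup_le fun hr => ?_
  calc ENNReal.ofReal (r ^ (-α)) * μ (Metric.ball x r)
      ≤ ENNReal.ofReal (r ^ (-α)) * ENNReal.ofReal (C * r ^ α) := by gcongr; exact hC x r hr
    _ = ENNReal.ofReal C := by
        rw [← ENNReal.ofReal_mul (by positivity), mul_left_comm, ← Real.rpow_add hr]
        simp

theorem measure_univ_le_growthNorm (hs : μ (Metric.closedBall 0 1)ᶜ = 0) :
    μ univ ≤ growthNorm α μ * ENNReal.ofReal (2 ^ α) := by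
  refine le_trans ?_ (measure_ball_le_growthNorm 0 (by norm_num : (0 : ℝ) < 2))
  rw [← measure_add_measure_compl (μ := μ) (s := Metric.closedBall 0 1)
    Metric.isClosed_closedBall.measurableSet, hs, add_zero]
  exact measure_mono (Metric.closedBall_subset_ball (by norm_num))

theorem isFiniteMeasure_of_growth (hs : μ (Metric.closedBall 0 1)ᶜ = 0) (h : HasGrowth α μ) :
    IsFiniteMeasure μ :=
  ⟨(measure_univ_le_growthNorm (α := α) hs).trans_lt
    (ENNReal.mul_lt_top (growthNorm_ne_top h).lt_top ENNReal.ofReal_lt_top)⟩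

end Growth

/-! ### The multilinear L² estimate -/

/-- The extension operator of the curve, over a set `J` of parameters. -/
noncomputable def curveExt {d : ℕ} (γ : ℝ → EuclideanSpace ℝ (Fin d)) (lam : ℝ) (J : Set ℝ)
    (f : ℝ → ℂ) (x : EuclideanSpace ℝ (Fin d)) : ℂ :=
  ∫ t in J, Complex.exp (Complex.I * ((lam * inner ℝ x (γ t) : ℝ) : ℂ)) * f t

theorem lintegral_prod_enorm_sq {κ : Type*} [Fintype κ] {f : κ → ℝ → ℂ}
    (hf : ∀ i, MemLp (f i) 2) :
    ∫⁻ s : κ → ℝ, ‖∏ i, f i (s i)‖ₑ ^ 2 = ∏ i, ∫⁻ t, ‖f i t‖ₑ ^ 2 := by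
  have hi : ∀ i, Integrable (fun t => ‖f i t‖ ^ 2) := fun i => (hf i).integrable_norm_pow two_ne_zero
  have h1 : ∀ i, ∫⁻ t, ‖f i t‖ₑ ^ 2 = ENNReal.ofReal (∫ t, ‖f i t‖ ^ 2) := fun i => by
    rw [ofReal_integral_eq_lintegral_ofReal (hi i) (ae_of_all _ fun _ => by positivity)]
    refine lintegral_congr fun t => ?_
    rw [ENNReal.ofReal_pow (norm_nonneg _), ofReal_norm]
  have h2 : Integrable (fun s : κ → ℝ => ∏ i, ‖f i (s i)‖ ^ 2) :=
    Integrable.fintype_prod (f := fun i t => ‖f i t‖ ^ 2) hi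
  simp_rw [h1]
  rw [← ENNReal.ofReal_prod_of_nonneg fun i _ => integral_nonneg fun _ => by positivity,
    ← integral_fintype_prod_volume_eq_prod (fun i t => ‖f i t‖ ^ 2),
    ofReal_integral_eq_lintegral_ofReal h2
      (ae_of_all _ fun _ => Finset.prod_nonneg fun _ _ => by positivity)]
  refine lintegral_congr fun s => ?_
  rw [Finset.prod_pow, ENNReal.ofReal_pow (Finset.prod_nonneg fun _ _ => norm_nonneg _),
    ← norm_prod, ofReal_norm]

/-- Moving the base point of the curve to γ t₀ only multiplies by a unimodular constant. -/
theorem norm_curveExt_eq {d : ℕ} {γ : ℝ → EuclideanSpace ℝ (Fin d)} {lam t₀ : ℝ} {J : Set ℝ}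
    (hJ : MeasurableSet J) {f : ℝ → ℂ} {x : EuclideanSpace ℝ (Fin d)} {G : ℝ → Fin d → ℝ}
    {v : Fin d → ℝ} (hG : ∀ t ∈ J, lam * inner ℝ x (γ t - γ t₀) = ∑ j, v j * G t j) :
    ‖curveExt γ lam J f x‖ = ‖∫ t, expDot v (G t) * J.indicator f t‖ := by
  have h1 : ∀ t ∈ J, Complex.exp (Complex.I * ((lam * inner ℝ x (γ t) : ℝ) : ℂ)) * f t =
      Complex.exp (((lam * inner ℝ x (γ t₀) : ℝ) : ℂ) * Complex.I) * (expDot v (G t) * f t) := by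
    intro t ht
    rw [expDot, ← hG t ht, ← mul_assoc, ← Complex.exp_add, inner_sub_right]
    congr 2
    push_cast
    ring
  rw [curveExt, setIntegral_congr_fun hJ h1, integral_const_mul, norm_mul,
    Complex.norm_exp_ofReal_mul_I, one_mul, ← integral_indicator hJ]
  congr 2
  ext t
  by_cases ht : t ∈ J <;> simp [ht]

/-- By Fubini a product of extension operators of the curve is a single one, with tensor product
density and the sum map as phase. -/
theorem prod_norm_curveExt_eq {d : ℕ} {κ : Type*} [Fintype κ] {γ : ℝ → EuclideanSpace ℝ (Fin d)}
    {lam t₀ : ℝ} {J : κ → Set ℝ}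
    (hJ : ∀ i, MeasurableSet (J i)) {f : ℝ → ℂ} {x : EuclideanSpace ℝ (Fin d)} {G : ℝ → Fin d → ℝ}
    {v : Fin d → ℝ} (hG : ∀ i, ∀ t ∈ J i, lam * inner ℝ x (γ t - γ t₀) = ∑ j, v j * G t j) :
    ∏ i, ‖curveExt γ lam (J i) f x‖ =
      ‖∫ s : κ → ℝ, expDot v (fun j => ∑ i, G (s i) j) * ∏ i, (J i).indicator f (s i)‖ := by
  have h1 : ∀ s : κ → ℝ, expDot v (fun j => ∑ i, G (s i) j) * ∏ i, (J i).indicator f (s i) =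
      ∏ i, (expDot v (G (s i)) * (J i).indicator f (s i)) := by
    intro s
    rw [Finset.prod_mul_distrib]
    congr 1
    simp only [expDot, ← Complex.exp_sum, ← Finset.mul_sum, ← Complex.ofReal_sum]
    rw [Finset.sum_comm]
    simp_rw [Finset.mul_sum]
  simp_rw [h1]
  rw [integral_fintype_prod_volume_eq_prod (fun i t => expDot v (G t) * (J i).indicator f t),
    norm_prod]
  exact Finset.prod_congr rfl fun i _ => norm_curveExt_eq (hJ i) (hG i)

/-- Mass of the preimages of boxes under the anisotropic frame map. -/
theorem IsNondegBy.measure_box_le {d : ℕ} {γ : ℝ → EuclideanSpace ℝ (Fin d)}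
    {D : ℕ → ℝ → EuclideanSpace ℝ (Fin d)} {M : ℝ} (hD : IsNondegBy γ D M) {α : ℝ}
    (μ : Measure (EuclideanSpace ℝ (Fin d))) {t₀ h lam : ℝ} {n : ℕ} (ht₀ : t₀ ∈ Icc (0 : ℝ) 1)
    (hh : 0 < h) (hh1 : h ≤ 1) (hlam : 0 < lam) {δ : ℝ} (hδ1 : δ ≤ 1) (y : Fin d → ℝ) :
    μ {x | ∀ j : Fin d, |y j - lam * h ^ (j.val + 1) * inner ℝ x (D (j + 1) t₀)| ≤
      δ * h ^ (j.val + 1 - n)} ≤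
    growthNorm α μ * ENNReal.ofReal ((3 * M / (lam * h ^ n)) ^ α) := by
  have hM := hD.one_le
  rcases eq_empty_or_nonempty {x | ∀ j : Fin d,
      |y j - lam * h ^ (j.val + 1) * inner ℝ x (D (j + 1) t₀)| ≤ δ * h ^ (j.val + 1 - n)} with
    he | ⟨x₀, hx₀⟩
  · rw [he]; simp
  refine le_trans (measure_mono ?_) (measure_ball_le_growthNorm x₀ (by positivity))
  intro x hx
  have hρ : 0 < lam * h ^ n := by positivity
  have h1 : ‖x - x₀‖ ≤ M * (2 / (lam * h ^ n)) := by
    refine hD.lower t₀ ht₀ _ _ (by positivity) fun j => ?_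
    have h2 := hx j
    have h3 := hx₀ j
    -- Truncated subtraction: equality when n ≤ j + 1, while for n > j + 1 the condition h ≤ 1 is
    -- needed.
    have h4 : h ^ (j.val + 1 - n) * h ^ n ≤ h ^ (j.val + 1) := by
      rw [← pow_add]; exact pow_le_pow_of_le_one hh.le hh1 (by omega)
    have h5 : lam * h ^ (j.val + 1) * |inner ℝ (x - x₀) (D (j + 1) t₀)| ≤
        2 * h ^ (j.val + 1 - n) := by
      have h9 : 0 < lam * h ^ (j.val + 1) := by positivity
      nth_rewrite 1 [← abs_of_pos h9]
      rw [← abs_mul, inner_sub_left, mul_sub]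
      have h6 : δ * h ^ (j.val + 1 - n) ≤ h ^ (j.val + 1 - n) :=
        mul_le_of_le_one_left (by positivity) hδ1
      rw [abs_le] at h2 h3 ⊢
      constructor <;> linarith [h2.1, h2.2, h3.1, h3.2]
    rw [le_div_iff₀ hρ]
    have h7 : 0 < h ^ (j.val + 1 - n) := by positivity
    have h8 : |inner ℝ (x - x₀) (D (j + 1) t₀)| * (lam * h ^ n) * h ^ (j.val + 1 - n) ≤
        2 * h ^ (j.val + 1 - n) := by
      refine le_trans ?_ h5
      calc |inner ℝ (x - x₀) (D (j + 1) t₀)| * (lam * h ^ n) * h ^ (j.val + 1 - n)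
          = lam * (h ^ (j.val + 1 - n) * h ^ n) * |inner ℝ (x - x₀) (D (j + 1) t₀)| := by ring
        _ ≤ _ := by gcongr
    exact le_of_mul_le_mul_right h8 h7
  rw [Metric.mem_ball, dist_eq_norm]
  refine h1.trans_lt ?_
  rw [← mul_div_assoc]
  exact div_lt_div_of_pos_right (by linarith) hρ

/-- The exponents of `h` in the multilinear estimate. -/
def extentExp (d k : ℕ) : ℕ := ∑ j : Fin d, if j.val < k + 1 then 1 else j.val + 1

/-- The exponent of `h` in the volume of the boxes of local constancy. -/
def boxExp (d n : ℕ) : ℕ := ∑ j : Fin d, (j.val + 1 - n)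

/-- The interval number `b` in the subdivision of `[t₀, t₀ + h)` into `K` intervals. -/
def subIco (t₀ h : ℝ) (K b : ℕ) : Set ℝ := Ico (t₀ + b * (h / K)) (t₀ + (b + 1) * (h / K))

theorem measurableSet_subIco (t₀ h : ℝ) (K b : ℕ) : MeasurableSet (subIco t₀ h K b) :=
  measurableSet_Ico

theorem subIco_subset_Icc {t₀ h : ℝ} {K b : ℕ} (hh : 0 < h) (hb : b < K) :
    subIco t₀ h K b ⊆ Icc t₀ (t₀ + h) := by
  have hKr : (0 : ℝ) < K := by exact_mod_cast (Nat.zero_le b).trans_lt hb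
  refine Ico_subset_Icc_self.trans (Icc_subset_Icc ?_ ?_)
  · have : 0 ≤ b * (h / K) := by positivity
    linarith
  · have h1 : ((b : ℝ) + 1) ≤ K := by exact_mod_cast hb
    have : ((b : ℝ) + 1) * (h / K) ≤ K * (h / K) := by gcongr
    rw [mul_div_cancel₀ _ hKr.ne'] at this
    linarith

/-- Multilinear `L²` estimate over separated intervals of an interval of length `h`. -/
theorem IsNondegBy.multilinear {d : ℕ} {γ : ℝ → EuclideanSpace ℝ (Fin d)}
    {D : ℕ → ℝ → EuclideanSpace ℝ (Fin d)} {M : ℝ} (hD : IsNondegBy γ D M) {α : ℝ} {k n K : ℕ}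
    (hk : k + 1 ≤ d) (hK : 0 < K) :
    ∃ C : ℝ, 0 < C ∧ ∃ h₀ : ℝ, 0 < h₀ ∧ ∀ μ : Measure (EuclideanSpace ℝ (Fin d)),
      μ (Metric.closedBall 0 1)ᶜ = 0 → HasGrowth α μ → ∀ t₀ h lam : ℝ, 0 ≤ t₀ → 0 < h → h ≤ h₀ →
      t₀ + h ≤ 1 → 0 < lam → 1 ≤ lam * h ^ n → ∀ b : Fin (k + 1) → ℕ, (∀ i, b i < K) →
      (∀ i j, i < j → b i + 2 ≤ b j) → ∀ f : ℝ → ℂ, MemLp f 2 (volume.restrict (Icc 0 1)) →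
      ∫⁻ x, ∏ i, ‖curveExt γ lam (subIco t₀ h K (b i)) f x‖ₑ ^ 2 ∂μ ≤
        ENNReal.ofReal (C * (lam ^ d / lam ^ (k + 1)) * (h ^ extentExp d k / h ^ boxExp d n) *
          (lam * h ^ n) ^ (-α)) * growthNorm α μ *
          ∏ i, ∫⁻ t in subIco t₀ h K (b i), ‖f t‖ₑ ^ 2 := by
  classical
  have hM := hD.one_le
  have hKr : (0 : ℝ) < K := by exact_mod_cast hK
  have hdpos : 0 < d := by omega
  have hdr : (1 : ℝ) ≤ d := by exact_mod_cast hdpos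
  set ω : ℝ := (1 / (2 * K : ℝ)) ^ k / 2 with hω
  have hω0 : 0 < ω := by positivity
  set L : ℝ := 2 ^ k * k.factorial with hL
  have hL0 : 0 < L := by positivity
  -- Each of the d coordinates of the sum map has k + 1 terms of size at most 1 + M², so with this δ
  -- the phase stays at most 1 on the box of local constancy.
  set δ : ℝ := 1 / (d * ((k + 1) * (1 + M ^ 2))) with hδ
  have hden : 1 ≤ d * (((k : ℝ) + 1) * (1 + M ^ 2)) := by
    have h1 : 1 ≤ ((k : ℝ) + 1) * (1 + M ^ 2) := by
      have : (0 : ℝ) ≤ k := Nat.cast_nonneg k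
      nlinarith [sq_nonneg M, mul_nonneg this (sq_nonneg M)]
    nlinarith
  have hδ0 : 0 < δ := by positivity
  have hδ1 : δ ≤ 1 := by rw [hδ]; exact div_le_one_of_le₀ hden (by positivity)
  -- λB₀ = (Mλh)(ω/h)/(L(k+1)): extent of the measure times lower constant of the sum map, in which
  -- the powers of h cancel.
  set B₀ : ℝ := M * ω / (L * (k + 1)) with hB₀
  have hB₀0 : 0 < B₀ := by positivity
  refine ⟨extConst (Fin d) (Fin (k + 1)) * (M / δ) ^ d / B₀ ^ (k + 1) * (3 * M) ^ α, ?_,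
    -- The threshold h₀ makes the Taylor error M²h small against ω in `sum_curve_lower_bound`.
    ω / ((k + 1) * L * M ^ 2), by positivity, ?_⟩
  · have : 0 < extConst (Fin d) (Fin (k + 1)) := by
      unfold extConst
      have := Real.exp_pos (2 * (Fintype.card (Fin d) : ℝ))
      have := Real.pi_pos
      positivity
    positivity
  intro μ hs hgr t₀ h lam ht₀ hh hh₀ ht₁ hlam hlh b hbK hb f hf
  have hh1 : h ≤ 1 := by linarith
  have hfin := isFiniteMeasure_of_growth hs hgr
  obtain ⟨G, G', hGc, hGin, hGd, happ, hGb⟩ := hD.exists_coords ht₀ hh ht₁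
  have hsmall : (k + 1) * (2 ^ k * k.factorial) * (M ^ 2 * h) ≤ (1 / (2 * K : ℝ)) ^ k / 2 := by
    rw [le_div_iff₀ (by positivity)] at hh₀
    linarith
  have hJsub : ∀ i, subIco t₀ h K (b i) ⊆ Icc t₀ (t₀ + h) := fun i => subIco_subset_Icc hh (hbK i)
  have hIsub : Icc t₀ (t₀ + h) ⊆ Icc 0 1 := Icc_subset_Icc ht₀ ht₁
  have ht₀' : t₀ ∈ Icc (0 : ℝ) 1 := ⟨ht₀, by linarith⟩
  -- Normalised so that λ x·(γ(t) - γ(t₀)) = V x · G t.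
  set V : EuclideanSpace ℝ (Fin d) → Fin d → ℝ := fun x j =>
    lam * h ^ (j.val + 1) * inner ℝ x (D (j + 1) t₀) with hV
  have hVc : Continuous V := continuous_pi fun j =>
    continuous_const.mul (continuous_id.inner continuous_const)
  set ν := μ.map V with hν
  have hνfin : IsFiniteMeasure ν := Measure.isFiniteMeasure_map μ V
  -- The unit ball has image of extent about λh^(j+1) in direction j. The first k + 1 extents are
  -- enlarged to λh, to match the isotropic lower bound for the sum map in these directions.
  set r : Fin d → ℕ := fun j => if j.val < k + 1 then 1 else j.val + 1 with hr
  set R : Fin d → ℝ := fun j => M * lam * h ^ (r j) with hR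
  set δ' : Fin d → ℝ := fun j => δ * h ^ (j.val + 1 - n) with hδ'
  have hrle : ∀ j, h ^ (j.val + 1) ≤ h ^ (r j) := fun j =>
    pow_le_pow_of_le_one hh.le hh1 (by simp only [hr]; split_ifs <;> omega)
  set Φ : (Fin (k + 1) → ℝ) → Fin d → ℝ := fun s j => ∑ i, G (s i) j with hΦ
  set S : Set (Fin (k + 1) → ℝ) := {s | ∀ i, s i ∈ subIco t₀ h K (b i)} with hS
  -- The boxes of local constancy must not exceed the extents; this is where λh^n ≥ 1 enters.
  have hlam1 : ∀ j : Fin d, h ^ (j.val + 1 - n) ≤ lam * h ^ (j.val + 1) := by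
    intro j
    rcases le_total n (j.val + 1) with hj | hj
    · calc h ^ (j.val + 1 - n) ≤ (lam * h ^ n) * h ^ (j.val + 1 - n) :=
            le_mul_of_one_le_left (by positivity) hlh
        _ = lam * h ^ (j.val + 1) := by rw [mul_assoc, ← pow_add]; congr 2; omega
    · rw [Nat.sub_eq_zero_of_le hj, pow_zero]
      refine hlh.trans ?_
      gcongr 1
      exact pow_le_pow_of_le_one hh.le hh1 hj
  have hmain := lintegral_extension_sq_le ν (R := R) (δ := δ')
    (N := growthNorm α μ * ENNReal.ofReal ((3 * M / (lam * h ^ n)) ^ α)) (B := lam * B₀) (Φ := Φ)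
    (S := S) (f := fun s => ∏ i, (subIco t₀ h K (b i)).indicator f (s i))
    (fun j => by positivity) ?_ ?_ ?_ (by positivity) ?_ ?_ ?_ ?_ ?_
  · have hfL : ∀ i, MemLp ((subIco t₀ h K (b i)).indicator f) 2 := fun i => by
      rw [memLp_indicator_iff_restrict (measurableSet_subIco _ _ _ _)]
      exact hf.mono_measure (Measure.restrict_mono ((hJsub i).trans hIsub) le_rfl)
    rw [lintegral_prod_enorm_sq hfL] at hmain
    have hE : ∀ i, ∫⁻ t, ‖(subIco t₀ h K (b i)).indicator f t‖ₑ ^ 2 =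
        ∫⁻ t in subIco t₀ h K (b i), ‖f t‖ₑ ^ 2 := fun i => by
      rw [← lintegral_indicator (measurableSet_subIco _ _ _ _)]
      refine lintegral_congr fun t => ?_
      by_cases ht : t ∈ subIco t₀ h K (b i) <;> simp [ht]
    simp_rw [hE] at hmain
    have hleft : ∫⁻ x, ∏ i, ‖curveExt γ lam (subIco t₀ h K (b i)) f x‖ₑ ^ 2 ∂μ =
        ∫⁻ v, ‖∫ s, expDot v (Φ s) * ∏ i, (subIco t₀ h K (b i)).indicator f (s i)‖ₑ ^ 2 ∂ν := by
      rw [hν, lintegral_map ?_ hVc.measurable]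
      · refine lintegral_congr fun x => ?_
        rw [Finset.prod_pow]
        congr 1
        have := prod_norm_curveExt_eq (lam := lam) (t₀ := t₀)
          (fun i => measurableSet_subIco t₀ h K (b i)) (f := f) (x := x)
          (G := G) (v := V x) (fun i t ht => by
            rw [hGin t (hJsub i ht), Finset.mul_sum]
            exact Finset.sum_congr rfl fun j _ => by simp only [hV]; ring)
        rw [← ofReal_norm]
        simp only [hΦ]
        rw [← this, ENNReal.ofReal_prod_of_nonneg fun _ _ => norm_nonneg _]
        exact Finset.prod_congr rfl fun i _ => (ofReal_norm _).symm
      · refine (Continuous.measurable ?_).enorm.pow_const 2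
        refine continuous_extension ?_ ?_
        · exact measurable_pi_lambda _ fun j => Finset.measurable_sum _ fun i _ =>
            ((continuous_apply j).comp (hGc.comp (continuous_apply i))).measurable
        · exact Integrable.fintype_prod fun i => by
            rw [integrable_indicator_iff (measurableSet_subIco _ _ _ _)]
            have : IntegrableOn f (Icc 0 1) := hf.integrable (by norm_num)
            exact this.mono_set ((hJsub i).trans hIsub)
    rw [hleft]
    refine hmain.trans (le_of_eq ?_)
    congr 1
    have hBC : 0 ≤ extConst (Fin d) (Fin (k + 1)) := by
      unfold extConst
      positivity
    have hRp : ∏ j, R j / δ' j = (M / δ) ^ d * lam ^ d * (h ^ extentExp d k / h ^ boxExp d n) := by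
      simp only [hR, hδ', Finset.prod_div_distrib, Finset.prod_mul_distrib, Finset.prod_const,
        Finset.card_univ, Fintype.card_fin, Finset.prod_pow_eq_pow_sum, extentExp, boxExp, hr,
        div_pow]
      field_simp
    rw [mul_comm (growthNorm α μ), ← mul_assoc, hRp, ← ENNReal.ofReal_mul (by positivity)]
    congr 2
    rw [Real.div_rpow (by positivity) (by positivity), Real.rpow_neg (by positivity),
      Fintype.card_fin, mul_pow]
    field_simp
  · intro j
    simp only [hR, hδ']
    calc δ * h ^ (j.val + 1 - n) ≤ 1 * (lam * h ^ (j.val + 1)) := by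
          gcongr
          exact hlam1 j
      _ ≤ M * (lam * h ^ (r j)) := by
          refine mul_le_mul hM ?_ (by positivity) (by positivity)
          exact mul_le_mul_of_nonneg_left (hrle j) hlam.le
      _ = _ := by ring
  · rw [hν, ae_map_iff hVc.measurable.aemeasurable]
    · have : ∀ᵐ x ∂μ, x ∈ Metric.closedBall (0 : EuclideanSpace ℝ (Fin d)) 1 := by
        rw [ae_iff]; exact hs
      filter_upwards [this] with x hx j
      rw [mem_closedBall_zero_iff] at hx
      simp only [hV, hR]
      rw [abs_mul, abs_of_pos (by positivity : 0 < lam * h ^ (j.val + 1))]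
      have h1 : |inner ℝ x (D (j + 1) t₀)| ≤ M := by
        refine (abs_real_inner_le_norm _ _).trans ?_
        have := hD.bound (j + 1) (by omega) t₀ ht₀'
        calc ‖x‖ * ‖D (j + 1) t₀‖ ≤ 1 * M := by gcongr
          _ = M := one_mul _
      calc lam * h ^ (j.val + 1) * |inner ℝ x (D (j + 1) t₀)| ≤ lam * h ^ r j * M := by
            refine mul_le_mul ?_ h1 (abs_nonneg _) (by positivity)
            exact mul_le_mul_of_nonneg_left (hrle j) hlam.le
        _ = _ := by ring
    · simp only [ofPred_forall]
      exact MeasurableSet.iInter fun j => measurableSet_le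
        (continuous_abs.measurable.comp (measurable_pi_apply j)) measurable_const
  · intro y
    rw [hν, Measure.map_apply hVc.measurable]
    · exact hD.measure_box_le μ ht₀' hh hh1 hlam hδ1 y
    · simp only [ofPred_forall]
      exact MeasurableSet.iInter fun j => measurableSet_le (continuous_abs.measurable.comp
        (measurable_const.sub (measurable_pi_apply j))) measurable_const
  · exact measurable_pi_lambda _ fun j => Finset.measurable_sum _ fun i _ =>
      ((continuous_apply j).comp (hGc.comp (continuous_apply i))).measurable
  · intro s hs
    have h1 : ∀ j, δ' j * |Φ s j| ≤ δ * ((k + 1) * (1 + M ^ 2)) := by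
      intro j
      refine mul_le_mul ?_ ?_ (abs_nonneg _) hδ0.le
      · exact mul_le_of_le_one_right hδ0.le (pow_le_one₀ hh.le hh1)
      · refine (Finset.abs_sum_le_sum_abs _ _).trans ?_
        refine (Finset.sum_le_sum fun i _ => hGb _ (hJsub i (hs i)) j).trans (le_of_eq ?_)
        simp only [Finset.sum_const, Finset.card_univ, Fintype.card_fin, nsmul_eq_mul]
        push_cast
        ring
    refine (Finset.sum_le_sum fun j _ => h1 j).trans (le_of_eq ?_)
    rw [Finset.sum_const, Finset.card_univ, Fintype.card_fin, nsmul_eq_mul, hδ]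
    field_simp
  · intro s hs s' hs'
    have h1 := sum_curve_lower_bound hk hK hh hsmall hGd happ hbK hb
      (t := s) (t' := s') (fun i => Ico_subset_Icc_self (hs i))
      (fun i => Ico_subset_Icc_self (hs' i))
    rw [← hω, ← hL] at h1
    have hΦs : ∀ j, ∑ i, (G (s i) j - G (s' i) j) = Φ s j - Φ s' j := fun j => by
      simp only [hΦ, Finset.sum_sub_distrib]
    simp_rw [hΦs] at h1
    set Q := ∑ i, |s i - s' i| with hQ
    set W := ∑ j : Fin (k + 1), |Φ s (Fin.castLE hk j) - Φ s' (Fin.castLE hk j)| with hW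
    have hQ0 : 0 ≤ Q := by positivity
    have h2 : ∑ i, (s i - s' i) ^ 2 ≤ Q ^ 2 := by
      simp_rw [← sq_abs (s _ - s' _)]
      exact Finset.sum_sq_le_sq_sum_of_nonneg fun _ _ => abs_nonneg _
    have h3 : W ^ 2 ≤ (k + 1) * ∑ j : Fin (k + 1),
        (Φ s (Fin.castLE hk j) - Φ s' (Fin.castLE hk j)) ^ 2 := by
      have := sq_sum_le_card_mul_sum_sq (s := (Finset.univ : Finset (Fin (k + 1))))
        (f := fun j => |Φ s (Fin.castLE hk j) - Φ s' (Fin.castLE hk j)|)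
      simpa [sq_abs] using this
    have h4 : ∑ j : Fin (k + 1), (M * lam * h) ^ 2 *
        (Φ s (Fin.castLE hk j) - Φ s' (Fin.castLE hk j)) ^ 2 ≤
        ∑ j, R j ^ 2 * (Φ s j - Φ s' j) ^ 2 := by
      have h5 : ∀ j : Fin (k + 1), (M * lam * h) ^ 2 *
          (Φ s (Fin.castLE hk j) - Φ s' (Fin.castLE hk j)) ^ 2 =
          (fun j => R j ^ 2 * (Φ s j - Φ s' j) ^ 2) (Fin.castLE hk j) := by
        intro j
        have : r (Fin.castLE hk j) = 1 := if_pos j.2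
        simp only [hR, this, pow_one]
      rw [Finset.sum_congr rfl fun j _ => h5 j]
      refine (Finset.sum_map Finset.univ (Fin.castLEEmb hk)
        (fun j => R j ^ 2 * (Φ s j - Φ s' j) ^ 2)).symm.trans_le ?_
      exact Finset.sum_le_sum_of_subset_of_nonneg (Finset.subset_univ _)
        fun _ _ _ => by positivity
    refine le_trans ?_ h4
    rw [← Finset.mul_sum, ← Finset.mul_sum]
    have h6 : (ω / h * Q) ^ 2 ≤ (L * W) ^ 2 := by gcongr
    have h7 : lam * B₀ = (M * lam * h) * (ω / h) / (L * (k + 1)) := by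
      rw [hB₀]; field_simp
    calc (lam * B₀) ^ 2 * ∑ i, (s i - s' i) ^ 2 ≤ (lam * B₀) ^ 2 * Q ^ 2 := by gcongr
      _ = (M * lam * h) ^ 2 / (L * (k + 1)) ^ 2 * (ω / h * Q) ^ 2 := by
          rw [h7, div_pow, mul_pow, mul_pow (ω / h)]; ring
      _ ≤ (M * lam * h) ^ 2 / (L * (k + 1)) ^ 2 * (L * W) ^ 2 := by gcongr
      _ = (M * lam * h) ^ 2 * (W ^ 2 / (k + 1) ^ 2) := by field_simp
      _ ≤ _ := by
          refine mul_le_mul_of_nonneg_left ?_ (by positivity)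
          rw [div_le_iff₀ (by positivity)]
          refine h3.trans ?_
          have h8 : 0 ≤ ∑ j : Fin (k + 1),
            (Φ s (Fin.castLE hk j) - Φ s' (Fin.castLE hk j)) ^ 2 := by positivity
          have h9 : (0 : ℝ) ≤ k := Nat.cast_nonneg k
          nlinarith [mul_nonneg h8 h9, mul_nonneg (mul_nonneg h8 h9) h9]
  · exact Integrable.fintype_prod fun i => by
      rw [integrable_indicator_iff (measurableSet_subIco _ _ _ _)]
      have : IntegrableOn f (Icc 0 1) := hf.integrable (by norm_num)
      exact this.mono_set ((hJsub i).trans hIsub)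
  · intro s hs
    simp only [hS, mem_ofPred_eq, not_forall] at hs
    obtain ⟨i, hi⟩ := hs
    exact Finset.prod_eq_zero (Finset.mem_univ i) (indicator_of_notMem hi f)

/-! ### The broad-narrow dichotomy -/

/-- Tuples of pairwise non-adjacent indices. -/
def sepTuples (k K : ℕ) : Finset (Fin (k + 1) → Fin K) :=
  Finset.univ.filter fun b => ∀ i j, i < j → (b i).val + 2 ≤ (b j).val

/-- The pointwise dichotomy of Bourgain and Guth. -/
theorem norm_sum_rpow_le_broad_narrow {k K : ℕ} (hK : 0 < K) (z : Fin K → ℂ) {q : ℝ} (hq : 0 < q) :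
    ‖∑ b, z b‖ ^ q ≤ (2 * k + 3 : ℝ) ^ q * ∑ b, ‖z b‖ ^ q +
      ((K : ℝ) ^ 2) ^ q * ∑ b ∈ sepTuples k K, ∏ i, ‖z (b i)‖ ^ (q / (k + 1)) := by
  classical
  have hKr : (0 : ℝ) < K := by exact_mod_cast hK
  have : Nonempty (Fin K) := ⟨⟨0, hK⟩⟩
  obtain ⟨b₀, -, hb₀⟩ := Finset.exists_max_image Finset.univ (fun b => ‖z b‖) Finset.univ_nonempty
  set M := ‖z b₀‖ with hM
  have hM0 : 0 ≤ M := norm_nonneg _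
  have hle : ∀ b, ‖z b‖ ≤ M := fun b => hb₀ b (Finset.mem_univ b)
  set S : Finset (Fin K) := Finset.univ.filter fun b => M / K ≤ ‖z b‖ with hS
  have hsum1 : 0 ≤ ∑ b, ‖z b‖ ^ q := Finset.sum_nonneg fun _ _ => by positivity
  have hsum2 : 0 ≤ ∑ b ∈ sepTuples k K, ∏ i, ‖z (b i)‖ ^ (q / (k + 1)) :=
    Finset.sum_nonneg fun _ _ => Finset.prod_nonneg fun _ _ => by positivity
  -- Narrow case: few terms are at least M/K, and the at most K remaining ones contribute at most M
  -- in total.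
  by_cases hc : S.card < 2 * (k + 1)
  · have h1 : ‖∑ b, z b‖ ≤ (2 * k + 3) * M := by
      refine (norm_sum_le _ _).trans ?_
      rw [← Finset.sum_filter_add_sum_filter_not Finset.univ (fun b => M / K ≤ ‖z b‖)]
      have h2 : ∑ b ∈ S, ‖z b‖ ≤ (2 * k + 2) * M := by
        refine (Finset.sum_le_card_nsmul S _ M fun b _ => hle b).trans ?_
        rw [nsmul_eq_mul]
        gcongr
        exact_mod_cast (by omega : S.card ≤ 2 * k + 2)
      have h3 : ∑ b with ¬ M / K ≤ ‖z b‖, ‖z b‖ ≤ M := by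
        refine (Finset.sum_le_card_nsmul _ _ (M / K) fun b hb => ?_).trans ?_
        · rw [Finset.mem_filter] at hb
          exact (not_le.mp hb.2).le
        · rw [nsmul_eq_mul]
          calc _ ≤ (K : ℝ) * (M / K) := by
                gcongr
                exact_mod_cast (Finset.card_filter_le _ _).trans_eq (by simp)
            _ = M := by field_simp
      linarith
    calc ‖∑ b, z b‖ ^ q ≤ ((2 * k + 3) * M) ^ q := by gcongr
      _ = (2 * k + 3) ^ q * M ^ q := Real.mul_rpow (by positivity) hM0
      _ ≤ (2 * k + 3 : ℝ) ^ q * ∑ b, ‖z b‖ ^ q := by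
          gcongr
          exact Finset.single_le_sum (f := fun b => ‖z b‖ ^ q) (fun _ _ => by positivity)
            (Finset.mem_univ b₀)
      _ ≤ _ := le_add_of_nonneg_right (by positivity)
  · push Not at hc
    set e := S.orderEmbOfFin rfl with he
    -- Broad case: taking every second element of the increasing enumeration of S makes the chosen
    -- indices differ by at least 2.
    set b : Fin (k + 1) → Fin K := fun i => e ⟨2 * i.val, by omega⟩ with hb
    have hbS : ∀ i, M ≤ K * ‖z (b i)‖ := by
      intro i
      have : b i ∈ S := Finset.orderEmbOfFin_mem S rfl _
      rw [hS, Finset.mem_filter] at this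
      have h1 := this.2
      rw [div_le_iff₀ hKr] at h1
      linarith
    have hbT : b ∈ sepTuples k K := by
      rw [sepTuples, Finset.mem_filter]
      refine ⟨Finset.mem_univ _, fun i j hij => ?_⟩
      have hij' : i.val < j.val := hij
      have h1 : e ⟨2 * i.val, by omega⟩ < e ⟨2 * i.val + 1, by omega⟩ :=
        e.strictMono (by simp [Fin.lt_def])
      have h2 : e ⟨2 * i.val + 1, by omega⟩ < e ⟨2 * j.val, by omega⟩ :=
        e.strictMono (by simp only [Fin.lt_def]; omega)
      simp only [hb]
      rw [Fin.lt_def] at h1 h2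
      omega
    have h1 : ‖∑ b, z b‖ ≤ K * M := by
      refine (norm_sum_le _ _).trans ?_
      refine (Finset.sum_le_card_nsmul _ _ M fun b _ => hle b).trans (le_of_eq ?_)
      simp
    have hk : (0 : ℝ) < k + 1 := by positivity
    have h2 : ∀ i, ((K : ℝ) * M) ^ (q / (k + 1)) ≤
        ((K : ℝ) ^ 2) ^ (q / (k + 1)) * ‖z (b i)‖ ^ (q / (k + 1)) := by
      intro i
      rw [← Real.mul_rpow (by positivity) (norm_nonneg _)]
      refine Real.rpow_le_rpow (by positivity) ?_ (by positivity)
      calc K * M ≤ K * (K * ‖z (b i)‖) := by gcongr; exact hbS i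
        _ = _ := by ring
    have h3 : ∀ x : ℝ, 0 ≤ x → x ^ q = ∏ _i : Fin (k + 1), x ^ (q / (k + 1)) := by
      intro x hx
      rw [Finset.prod_const, Finset.card_univ, Fintype.card_fin, ← Real.rpow_natCast,
        ← Real.rpow_mul hx]
      congr 1
      push_cast
      field_simp
    calc ‖∑ b, z b‖ ^ q ≤ (K * M) ^ q := by gcongr
      _ = ∏ _i : Fin (k + 1), (K * M) ^ (q / (k + 1)) := h3 _ (by positivity)
      _ ≤ ∏ i : Fin (k + 1), (((K : ℝ) ^ 2) ^ (q / (k + 1)) * ‖z (b i)‖ ^ (q / (k + 1))) :=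
          Finset.prod_le_prod (fun _ _ => by positivity) fun i _ => h2 i
      _ = ((K : ℝ) ^ 2) ^ q * ∏ i : Fin (k + 1), ‖z (b i)‖ ^ (q / (k + 1)) := by
          rw [Finset.prod_mul_distrib, ← h3 _ (by positivity)]
      _ ≤ ((K : ℝ) ^ 2) ^ q * ∑ b ∈ sepTuples k K, ∏ i, ‖z (b i)‖ ^ (q / (k + 1)) := by
          gcongr
          exact Finset.single_le_sum (f := fun b => ∏ i, ‖z (b i)‖ ^ (q / (k + 1)))
            (fun _ _ => Finset.prod_nonneg fun _ _ => by positivity) hbT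
      _ ≤ _ := le_add_of_nonneg_left (by positivity)

theorem enorm_sum_rpow_le_broad_narrow {k K : ℕ} (hK : 0 < K) (z : Fin K → ℂ) {q : ℝ}
    (hq : 0 < q) :
    ‖∑ b, z b‖ₑ ^ q ≤ ENNReal.ofReal ((2 * k + 3 : ℝ) ^ q) * ∑ b, ‖z b‖ₑ ^ q +
      ENNReal.ofReal (((K : ℝ) ^ 2) ^ q) *
        ∑ b ∈ sepTuples k K, ∏ i, ‖z (b i)‖ₑ ^ (q / (k + 1)) := by
  have hc : ∀ (w : ℂ) (r : ℝ), 0 ≤ r → ‖w‖ₑ ^ r = ENNReal.ofReal (‖w‖ ^ r) := fun w r hr => by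
    rw [← ENNReal.ofReal_rpow_of_nonneg (norm_nonneg _) hr, ofReal_norm]
  have h := ENNReal.ofReal_le_ofReal (norm_sum_rpow_le_broad_narrow (k := k) hK z hq)
  rw [hc _ _ hq.le]
  refine h.trans (le_of_eq ?_)
  rw [ENNReal.ofReal_add (by positivity) (by positivity), ENNReal.ofReal_mul (by positivity),
    ENNReal.ofReal_mul (by positivity), ENNReal.ofReal_sum_of_nonneg fun _ _ => by positivity,
    ENNReal.ofReal_sum_of_nonneg fun _ _ => by positivity]
  congr 2
  · exact Finset.sum_congr rfl fun _ _ => (hc _ _ hq.le).symm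
  · refine Finset.sum_congr rfl fun _ _ => ?_
    rw [ENNReal.ofReal_prod_of_nonneg fun _ _ => by positivity]
    exact Finset.prod_congr rfl fun _ _ => (hc _ _ (by positivity)).symm

/-! ### Power sums, recursion and subdivision -/

/-- Used with p = q/2 for the masses ∫|f|² over disjoint intervals: they can be summed over a whole
level without counting the intervals. -/
theorem sum_rpow_le_rpow_sum {ι : Type*} (s : Finset ι) (x : ι → ℝ≥0∞) {p : ℝ} (hp : 1 ≤ p) :
    ∑ i ∈ s, x i ^ p ≤ (∑ i ∈ s, x i) ^ p := by
  have h : ∀ y : ℝ≥0∞, y ^ p = y * y ^ (p - 1) := fun y => by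
    nth_rewrite 2 [← ENNReal.rpow_one y]
    rw [← ENNReal.rpow_add_of_nonneg _ _ zero_le_one (by linarith)]
    congr 1; ring
  calc ∑ i ∈ s, x i ^ p ≤ ∑ i ∈ s, x i * (∑ i ∈ s, x i) ^ (p - 1) := by
        refine Finset.sum_le_sum fun i hi => ?_
        rw [h]
        refine mul_le_mul_right ?_ _
        exact ENNReal.rpow_le_rpow (Finset.single_le_sum (fun _ _ => zero_le) hi) (by linarith)
    _ = _ := by rw [← Finset.sum_mul, ← h]

theorem rpow_sum_le_card_mul {ι : Type*} (s : Finset ι) (x : ι → ℝ≥0∞) {q : ℝ} (hq : 0 < q) :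
    (∑ i ∈ s, x i) ^ q ≤ (s.card : ℝ≥0∞) ^ q * ∑ i ∈ s, x i ^ q := by
  rcases s.eq_empty_or_nonempty with rfl | hs
  · simp [hq]
  obtain ⟨i₀, hi₀, hmax⟩ := Finset.exists_max_image s x hs
  calc (∑ i ∈ s, x i) ^ q ≤ ((s.card : ℝ≥0∞) * x i₀) ^ q := by
        refine ENNReal.rpow_le_rpow ?_ hq.le
        refine (Finset.sum_le_card_nsmul s _ _ hmax).trans_eq ?_
        rw [nsmul_eq_mul]
    _ = (s.card : ℝ≥0∞) ^ q * x i₀ ^ q := ENNReal.mul_rpow_of_nonneg _ _ hq.le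
    _ ≤ _ := by
        gcongr
        exact Finset.single_le_sum (f := fun i => x i ^ q) (fun _ _ => zero_le) hi₀

/-- The inhomogeneous term is absorbed by iterating S + D instead of S: since A ≥ 2, S i + D ≤ A (S
(i+1) + D). -/
theorem geometric_recursion {S : ℕ → ℝ≥0∞} {A D : ℝ≥0∞} (hA : 2 ≤ A) {N : ℕ} (n : ℕ) :
    (∀ i, N ≤ i → i < N + n → S i ≤ A * S (i + 1) + D) → S N ≤ A ^ n * (S (N + n) + D) := by
  intro h
  suffices H : ∀ j ≤ n, S N + D ≤ A ^ j * (S (N + j) + D) from le_self_add.trans (H n le_rfl)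
  intro j
  induction j with
  | zero => simp
  | succ j ih =>
    intro hj
    refine (ih (by omega)).trans ?_
    rw [pow_succ, mul_assoc]
    gcongr
    calc S (N + j) + D ≤ A * S (N + j + 1) + D + D := by gcongr; exact h _ (by omega) (by omega)
      _ = A * S (N + j + 1) + 2 * D := by ring
      _ ≤ A * S (N + j + 1) + A * D := by gcongr
      _ = _ := by rw [← mul_add]; rfl

theorem sum_range_mul_eq {M : Type*} [AddCommMonoid M] (F : ℕ → M) (K m : ℕ) :
    ∑ a ∈ Finset.range m, ∑ b ∈ Finset.range K, F (a * K + b) = ∑ c ∈ Finset.range (m * K), F c := by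
  induction m with
  | zero => simp
  | succ m ih => rw [Finset.sum_range_succ, ih, Nat.succ_mul, Finset.sum_range_add]

theorem restrict_Ico_eq_sum {t₀ w : ℝ} (hw : 0 ≤ w) (m : ℕ) :
    (volume : Measure ℝ).restrict (Ico t₀ (t₀ + m * w)) =
      ∑ b ∈ Finset.range m, volume.restrict (Ico (t₀ + b * w) (t₀ + (b + 1) * w)) := by
  induction m with
  | zero => simp
  | succ m ih =>
    rw [Finset.sum_range_succ, ← ih, ← Measure.restrict_union _ measurableSet_Ico,
      Ico_union_Ico_eq_Ico]
    · push_cast; rfl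
    · have : 0 ≤ m * w := by positivity
      linarith
    · nlinarith
    · rw [Set.disjoint_left]
      intro x hx hx'
      exact absurd hx.2 (not_lt.mpr hx'.1)

theorem restrict_subIco_sum {t₀ h : ℝ} (hh : 0 ≤ h) {K : ℕ} (hK : 0 < K) :
    (volume : Measure ℝ).restrict (Ico t₀ (t₀ + h)) =
      ∑ b ∈ Finset.range K, volume.restrict (subIco t₀ h K b) := by
  have hKr : (0 : ℝ) < K := by exact_mod_cast hK
  have := restrict_Ico_eq_sum (t₀ := t₀) (w := h / K) (by positivity) K
  rw [mul_div_cancel₀ _ hKr.ne'] at this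
  exact this

section Curve

variable {d : ℕ} {γ : ℝ → EuclideanSpace ℝ (Fin d)} {lam : ℝ} {f : ℝ → ℂ}

theorem enorm_curveExt_le (J : Set ℝ) (x : EuclideanSpace ℝ (Fin d)) :
    ‖curveExt γ lam J f x‖ₑ ≤ ∫⁻ t in J, ‖f t‖ₑ := by
  refine (enorm_integral_le_lintegral_enorm _).trans (le_of_eq ?_)
  refine lintegral_congr fun t => ?_
  rw [enorm_mul, mul_comm Complex.I, ← ofReal_norm, Complex.norm_exp_ofReal_mul_I]
  simp

theorem enorm_curveExt_sq_le {J : Set ℝ} (hf : AEStronglyMeasurable f (volume.restrict J))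
    (x : EuclideanSpace ℝ (Fin d)) :
    ‖curveExt γ lam J f x‖ₑ ^ 2 ≤ volume J * ∫⁻ t in J, ‖f t‖ₑ ^ 2 := by
  calc ‖curveExt γ lam J f x‖ₑ ^ 2 ≤ (∫⁻ t in J, ‖f t‖ₑ) ^ 2 := by
        gcongr; exact enorm_curveExt_le J x
    _ ≤ _ := by
        refine (sq_lintegral_le _ hf.enorm).trans_eq ?_
        rw [Measure.restrict_apply_univ]

theorem integrable_phase_mul (hγ : ContinuousOn γ (Icc 0 1)) {J : Set ℝ} (hJ : MeasurableSet J)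
    (hJI : J ⊆ Icc 0 1) (hf : IntegrableOn f J) (x : EuclideanSpace ℝ (Fin d)) :
    IntegrableOn (fun t => Complex.exp (Complex.I * ((lam * inner ℝ x (γ t) : ℝ) : ℂ)) * f t) J := by
  refine Integrable.bdd_mul (c := 1) hf ?_ (ae_of_all _ fun t => ?_)
  · refine ContinuousOn.aestronglyMeasurable ?_ hJ
    have h1 : ContinuousOn γ J := hγ.mono hJI
    fun_prop
  · rw [mul_comm, Complex.norm_exp_ofReal_mul_I]

theorem curveExt_eq_sum (hγ : ContinuousOn γ (Icc 0 1)) {t₀ h : ℝ} (hh : 0 ≤ h)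
    (hI : Ico t₀ (t₀ + h) ⊆ Icc 0 1) {K : ℕ} (hK : 0 < K) (hf : IntegrableOn f (Icc 0 1))
    (x : EuclideanSpace ℝ (Fin d)) :
    curveExt γ lam (Ico t₀ (t₀ + h)) f x =
      ∑ b ∈ Finset.range K, curveExt γ lam (subIco t₀ h K b) f x := by
  have hi := integrable_phase_mul (lam := lam) hγ measurableSet_Ico hI (hf.mono_set hI) x
  have hs := restrict_subIco_sum (t₀ := t₀) hh hK
  unfold curveExt
  rw [hs]
  refine integral_finsetSum_measure fun b hb => ?_
  refine Integrable.mono_measure hi ?_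
  rw [hs]
  exact Finset.single_le_sum (f := fun b => volume.restrict (subIco t₀ h K b))
    (fun _ _ => Measure.zero_le _) hb

theorem measurable_curveExt (hγ : ContinuousOn γ (Icc 0 1)) {J : Set ℝ} (hJ : MeasurableSet J)
    (hJI : J ⊆ Icc 0 1) (hf : IntegrableOn f J) : Measurable (curveExt γ lam J f) := by
  refine Continuous.measurable ?_
  refine continuous_of_dominated (bound := fun s => ‖f s‖)
    (fun x => (integrable_phase_mul hγ hJ hJI hf x).aestronglyMeasurable)
    (fun x => ae_of_all _ fun s => ?_) hf.norm (ae_of_all _ fun s => ?_)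
  · rw [norm_mul, mul_comm Complex.I, Complex.norm_exp_ofReal_mul_I, one_mul]
  · fun_prop

end Curve

/-! ### One step of the induction on scales -/

section Step

variable {d : ℕ} {γ : ℝ → EuclideanSpace ℝ (Fin d)} {lam : ℝ} {f : ℝ → ℂ}

theorem volume_subIco_le {t₀ h : ℝ} (hh : 0 ≤ h) {K b : ℕ} (hK : 0 < K) :
    volume (subIco t₀ h K b) ≤ ENNReal.ofReal h := by
  have hK1 : (1 : ℝ) ≤ K := by exact_mod_cast hK
  rw [subIco, Real.volume_Ico]
  refine ENNReal.ofReal_le_ofReal ?_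
  calc _ = h / K := by ring
    _ ≤ h := div_le_self hh hK1

/-- The exponent q/(k+1) ≥ 2 of each factor is split as 2 + p. The squares go into the L²
hypothesis; the remaining powers are bounded pointwise by Cauchy–Schwarz, |Tf|² ≤ h∫|f|², which
gains h^(q/2-(k+1)). -/
theorem lintegral_prod_rpow_le {k K : ℕ} {t₀ h : ℝ} (hh : 0 < h) (hI : Icc t₀ (t₀ + h) ⊆ Icc 0 1)
    (hK : 0 < K) {q : ℝ} (hq : 2 * (k + 1) ≤ q) (μ : Measure (EuclideanSpace ℝ (Fin d)))
    (hf : MemLp f 2 (volume.restrict (Icc 0 1))) {b : Fin (k + 1) → ℕ} (hb : ∀ i, b i < K)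
    {Y : ℝ≥0∞}
    (hY : ∫⁻ x, ∏ i, ‖curveExt γ lam (subIco t₀ h K (b i)) f x‖ₑ ^ 2 ∂μ ≤
      Y * ∏ i, ∫⁻ t in subIco t₀ h K (b i), ‖f t‖ₑ ^ 2) :
    ∫⁻ x, ∏ i, ‖curveExt γ lam (subIco t₀ h K (b i)) f x‖ₑ ^ (q / (k + 1)) ∂μ ≤
      Y * ENNReal.ofReal (h ^ (q / 2 - (k + 1))) *
        (∫⁻ t in Ico t₀ (t₀ + h), ‖f t‖ₑ ^ 2) ^ (q / 2) := by
  set N := ∫⁻ t in Ico t₀ (t₀ + h), ‖f t‖ₑ ^ 2 with hN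
  have hk : (0 : ℝ) < k + 1 := by positivity
  have hNi : ∀ i, ∫⁻ t in subIco t₀ h K (b i), ‖f t‖ₑ ^ 2 ≤ N := fun i => by
    rw [hN, restrict_subIco_sum hh.le hK, lintegral_finsetSum_measure]
    exact Finset.single_le_sum (f := fun b => ∫⁻ t in subIco t₀ h K b, ‖f t‖ₑ ^ 2)
      (fun _ _ => zero_le) (Finset.mem_range.mpr (hb i))
  have hNtop : N ≠ ⊤ := by
    have h1 : MemLp f 2 (volume.restrict (Ico t₀ (t₀ + h))) :=
      hf.mono_measure (Measure.restrict_mono (Ico_subset_Icc_self.trans hI) le_rfl)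
    have h2 := h1.2
    rw [eLpNorm_lt_top_iff_lintegral_rpow_enorm_lt_top (by norm_num) (by norm_num)] at h2
    simpa using h2.ne
  set p := q / (k + 1) - 2 with hp
  have hp0 : 0 ≤ p := by rw [hp, sub_nonneg, le_div_iff₀ hk]; exact hq
  have hpt : ∀ x, ∏ i, ‖curveExt γ lam (subIco t₀ h K (b i)) f x‖ₑ ^ (q / (k + 1)) ≤
      (∏ i, ‖curveExt γ lam (subIco t₀ h K (b i)) f x‖ₑ ^ 2) *
        (ENNReal.ofReal h * N) ^ (q / 2 - (k + 1)) := by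
    intro x
    have h1 : (ENNReal.ofReal h * N) ^ (q / 2 - (k + 1)) =
        ∏ _i : Fin (k + 1), (ENNReal.ofReal h * N) ^ (p / 2) := by
      rw [Finset.prod_const, Finset.card_univ, Fintype.card_fin, ← ENNReal.rpow_natCast,
        ← ENNReal.rpow_mul]
      congr 1
      rw [hp]; push_cast; field_simp
    rw [h1, ← Finset.prod_mul_distrib]
    refine Finset.prod_le_prod' fun i _ => ?_
    have h2 : q / (k + 1) = 2 + p := by rw [hp]; ring
    rw [h2, ENNReal.rpow_add_of_nonneg _ _ zero_le_two hp0]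
    have h3 : ‖curveExt γ lam (subIco t₀ h K (b i)) f x‖ₑ ^ p =
        (‖curveExt γ lam (subIco t₀ h K (b i)) f x‖ₑ ^ 2) ^ (p / 2) := by
      rw [← ENNReal.rpow_natCast, ← ENNReal.rpow_mul]
      congr 1; push_cast; ring
    rw [h3]
    refine mul_le_mul' ?_ (ENNReal.rpow_le_rpow ?_ (by positivity))
    · exact le_of_eq (by rw [← ENNReal.rpow_natCast]; norm_num)
    · refine (enorm_curveExt_sq_le (hf.1.mono_measure (Measure.restrict_mono
        ((subIco_subset_Icc hh (hb i)).trans hI) le_rfl)) x).trans ?_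
      exact mul_le_mul' (volume_subIco_le hh.le hK) (hNi i)
  have he : 0 ≤ q / 2 - (k + 1) := by linarith
  calc _ ≤ ∫⁻ x, (∏ i, ‖curveExt γ lam (subIco t₀ h K (b i)) f x‖ₑ ^ 2) *
        (ENNReal.ofReal h * N) ^ (q / 2 - (k + 1)) ∂μ := lintegral_mono hpt
    _ = (∫⁻ x, (∏ i, ‖curveExt γ lam (subIco t₀ h K (b i)) f x‖ₑ ^ 2) ∂μ) *
        (ENNReal.ofReal h * N) ^ (q / 2 - (k + 1)) :=
        lintegral_mul_const' _ _ (ENNReal.rpow_ne_top_of_nonneg he (by finiteness))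
    _ ≤ (Y * N ^ (k + 1)) * (ENNReal.ofReal h * N) ^ (q / 2 - (k + 1)) := by
        gcongr
        refine hY.trans ?_
        gcongr
        refine (Finset.prod_le_prod' fun i _ => hNi i).trans_eq ?_
        simp
    _ = Y * ENNReal.ofReal (h ^ (q / 2 - (k + 1))) * (N ^ ((k : ℝ) + 1) * N ^ (q / 2 - (k + 1))) := by
        rw [ENNReal.mul_rpow_of_nonneg _ _ he, ENNReal.ofReal_rpow_of_nonneg hh.le he]
        have : N ^ ((k : ℝ) + 1) = N ^ (k + 1) := by
          rw [← ENNReal.rpow_natCast]; push_cast; rfl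
        rw [this]; ring
    _ = _ := by
        rw [← ENNReal.rpow_add_of_nonneg _ _ hk.le he]
        congr 2; ring

/-- The narrow part of the dichotomy reproduces the left side on K shorter intervals and is left for
the next scale; the broad part is estimated at once by the multilinear bound. -/
theorem lintegral_step_le (hγ : ContinuousOn γ (Icc 0 1)) {k K : ℕ} {t₀ h : ℝ} (hh : 0 < h)
    (hI : Icc t₀ (t₀ + h) ⊆ Icc 0 1)
    (hK : 0 < K) {q : ℝ} (hq : 2 * (k + 1) ≤ q) (μ : Measure (EuclideanSpace ℝ (Fin d)))
    (hf : MemLp f 2 (volume.restrict (Icc 0 1))) {Y : ℝ≥0∞}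
    (hY : ∀ b : Fin (k + 1) → ℕ, (∀ i, b i < K) → (∀ i j, i < j → b i + 2 ≤ b j) →
      ∫⁻ x, ∏ i, ‖curveExt γ lam (subIco t₀ h K (b i)) f x‖ₑ ^ 2 ∂μ ≤
      Y * ∏ i, ∫⁻ t in subIco t₀ h K (b i), ‖f t‖ₑ ^ 2) :
    ∫⁻ x, ‖curveExt γ lam (Ico t₀ (t₀ + h)) f x‖ₑ ^ q ∂μ ≤
      ENNReal.ofReal ((2 * k + 3 : ℝ) ^ q) *
        ∑ b ∈ Finset.range K, ∫⁻ x, ‖curveExt γ lam (subIco t₀ h K b) f x‖ₑ ^ q ∂μ +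
      ENNReal.ofReal (((K : ℝ) ^ 2) ^ q) * ((sepTuples k K).card *
        (Y * ENNReal.ofReal (h ^ (q / 2 - (k + 1))) *
        (∫⁻ t in Ico t₀ (t₀ + h), ‖f t‖ₑ ^ 2) ^ (q / 2))) := by
  have hk : (0 : ℝ) < k + 1 := by positivity
  have hq0 : 0 < q := by linarith
  have hfi : IntegrableOn f (Icc 0 1) := hf.integrable (by norm_num)
  have hm : ∀ b < K, Measurable (curveExt γ lam (subIco t₀ h K b) f) := fun b hb =>
    measurable_curveExt hγ (measurableSet_subIco _ _ _ _) ((subIco_subset_Icc hh hb).trans hI)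
      (hfi.mono_set ((subIco_subset_Icc hh hb).trans hI))
  calc ∫⁻ x, ‖curveExt γ lam (Ico t₀ (t₀ + h)) f x‖ₑ ^ q ∂μ
      ≤ ∫⁻ x, (ENNReal.ofReal ((2 * k + 3 : ℝ) ^ q) *
        ∑ b : Fin K, ‖curveExt γ lam (subIco t₀ h K b) f x‖ₑ ^ q +
        ENNReal.ofReal (((K : ℝ) ^ 2) ^ q) *
        ∑ b ∈ sepTuples k K, ∏ i, ‖curveExt γ lam (subIco t₀ h K (b i)) f x‖ₑ ^ (q / (k + 1))) ∂μ := by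
        refine lintegral_mono fun x => ?_
        rw [curveExt_eq_sum hγ hh.le (Ico_subset_Icc_self.trans hI) hK hfi, Finset.sum_range]
        exact enorm_sum_rpow_le_broad_narrow hK
          (fun b : Fin K => curveExt γ lam (subIco t₀ h K b) f x) hq0
    _ = ENNReal.ofReal ((2 * k + 3 : ℝ) ^ q) *
        ∑ b ∈ Finset.range K, ∫⁻ x, ‖curveExt γ lam (subIco t₀ h K b) f x‖ₑ ^ q ∂μ +
        ENNReal.ofReal (((K : ℝ) ^ 2) ^ q) * ∑ b ∈ sepTuples k K,
          ∫⁻ x, ∏ i, ‖curveExt γ lam (subIco t₀ h K (b i)) f x‖ₑ ^ (q / (k + 1)) ∂μ := by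
        rw [lintegral_add_left, lintegral_const_mul' _ _ ENNReal.ofReal_ne_top,
          lintegral_const_mul' _ _ ENNReal.ofReal_ne_top, lintegral_finsetSum,
          lintegral_finsetSum, Finset.sum_range]
        · exact fun b _ => Finset.measurable_prod _ fun i _ =>
            ((hm _ (b i).2).enorm).pow_const _
        · exact fun b _ => ((hm _ b.2).enorm).pow_const _
        · exact (Finset.measurable_sum _ fun b _ => ((hm _ b.2).enorm).pow_const _).const_mul _
    _ ≤ _ := by
        gcongr
        rw [← nsmul_eq_mul]
        refine Finset.sum_le_card_nsmul _ _ _ fun b hb => ?_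
        rw [sepTuples, Finset.mem_filter] at hb
        exact lintegral_prod_rpow_le hh hI hK hq μ hf (fun i => (b i).2)
          (hY (fun i => b i) (fun i => (b i).2) hb.2)

end Step

/-! ### The K-adic levels -/

theorem subIco_child (K n a b : ℕ) :
    subIco (a * (1 / ((K ^ n : ℕ) : ℝ))) (1 / ((K ^ n : ℕ) : ℝ)) K b =
      subIco 0 1 (K ^ (n + 1)) (a * K + b) := by
  rcases Nat.eq_zero_or_pos K with rfl | hK
  · simp [subIco]
  have hKr : (K : ℝ) ≠ 0 := by positivity
  simp only [subIco]
  push_cast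
  congr 1 <;> field_simp <;> ring

theorem Ico_eq_subIco (K n a : ℕ) :
    Ico (a * (1 / ((K ^ n : ℕ) : ℝ))) (a * (1 / ((K ^ n : ℕ) : ℝ)) + 1 / ((K ^ n : ℕ) : ℝ)) =
      subIco 0 1 (K ^ n) a := by
  simp only [subIco]
  congr 1 <;> ring

theorem curveExt_Icc_eq {d : ℕ} (γ : ℝ → EuclideanSpace ℝ (Fin d)) (lam : ℝ) (f : ℝ → ℂ) :
    curveExt γ lam (Icc 0 1) f = curveExt γ lam (Ico 0 (0 + 1)) f := by
  ext x
  rw [zero_add, curveExt, curveExt, Measure.restrict_congr_set Ico_ae_eq_Icc.symm]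

/-- All powers of h are collected into one with nonnegative exponent and dropped, which makes the
broad part uniform in the scale. -/
theorem scale_power_le {d k r e₁ e₂ : ℕ} {α q C lam h : ℝ} (hC : 0 ≤ C) (hlam : 0 < lam)
    (hh : 0 < h) (hh1 : h ≤ 1) (hexp : 0 ≤ q / 2 - (k + 1) + e₁ - e₂ - r * α) :
    C * (lam ^ d / lam ^ (k + 1)) * (h ^ e₁ / h ^ e₂) * (lam * h ^ r) ^ (-α) *
      h ^ (q / 2 - (k + 1)) ≤ C * lam ^ (-(α - d + (k + 1))) := by
  have e1 : lam ^ d / lam ^ (k + 1) * lam ^ (-α) = lam ^ (-(α - d + (k + 1))) := by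
    rw [← Real.rpow_natCast, ← Real.rpow_natCast, ← Real.rpow_sub hlam, ← Real.rpow_add hlam]
    congr 1; push_cast; ring
  have e2 : h ^ e₁ / h ^ e₂ * (h ^ r) ^ (-α) * h ^ (q / 2 - (k + 1)) =
      h ^ (q / 2 - (k + 1) + e₁ - e₂ - r * α) := by
    rw [← Real.rpow_natCast, ← Real.rpow_natCast, ← Real.rpow_natCast, ← Real.rpow_mul hh.le,
      ← Real.rpow_sub hh, ← Real.rpow_add hh, ← Real.rpow_add hh]
    congr 1; ring
  rw [Real.mul_rpow hlam.le (by positivity)]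
  calc _ = C * (lam ^ d / lam ^ (k + 1) * lam ^ (-α)) *
        (h ^ e₁ / h ^ e₂ * (h ^ r) ^ (-α) * h ^ (q / 2 - (k + 1))) := by ring
    _ ≤ C * (lam ^ d / lam ^ (k + 1) * lam ^ (-α)) * 1 := by
        gcongr
        rw [e2]
        exact Real.rpow_le_one hh.le hh1 hexp
    _ = _ := by rw [e1, mul_one]

/-- The sum of the `L^q` integrals of the pieces of the extension operator at scale `K^(-n)`. -/
noncomputable def levelSum {d : ℕ} (γ : ℝ → EuclideanSpace ℝ (Fin d)) (lam : ℝ) (f : ℝ → ℂ)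
    (μ : Measure (EuclideanSpace ℝ (Fin d))) (q : ℝ) (K n : ℕ) : ℝ≥0∞ :=
  ∑ a ∈ Finset.range (K ^ n), ∫⁻ x, ‖curveExt γ lam (subIco 0 1 (K ^ n) a) f x‖ₑ ^ q ∂μ

section Level

variable {d : ℕ} {γ : ℝ → EuclideanSpace ℝ (Fin d)} {lam : ℝ} {f : ℝ → ℂ}
  {μ : Measure (EuclideanSpace ℝ (Fin d))}

theorem sum_lintegral_subIco (K : ℕ) (hK : 0 < K) (g : ℝ → ℝ≥0∞) :
    ∑ a ∈ Finset.range K, ∫⁻ t in subIco 0 1 K a, g t = ∫⁻ t in Icc 0 1, g t := by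
  have h1 := restrict_subIco_sum (t₀ := 0) (h := 1) zero_le_one hK
  rw [← lintegral_finsetSum_measure, ← h1, zero_add]
  exact setLIntegral_congr Ico_ae_eq_Icc

/-- Summation of the one-interval step over a level. The broad part is a constant times the local L²
mass to the power q/2 ≥ 1, so the sum is controlled by the total mass. -/
theorem levelSum_le_step (hγ : ContinuousOn γ (Icc 0 1)) {k K r : ℕ} (hK : 0 < K) {q α C : ℝ}
    (hq : 2 * (k + 1) ≤ q) (hC : 0 ≤ C) (hlam : 0 < lam)
    (hexp : 0 ≤ q / 2 - (k + 1) + extentExp d k - boxExp d r - r * α)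
    (hf : MemLp f 2 (volume.restrict (Icc 0 1))) {G : ℝ≥0∞} {n : ℕ} {h : ℝ}
    (hh : h = 1 / ((K ^ n : ℕ) : ℝ))
    (hY : ∀ t₀ : ℝ, 0 ≤ t₀ → t₀ + h ≤ 1 → ∀ b : Fin (k + 1) → ℕ, (∀ i, b i < K) →
      (∀ i j, i < j → b i + 2 ≤ b j) →
      ∫⁻ x, ∏ i, ‖curveExt γ lam (subIco t₀ h K (b i)) f x‖ₑ ^ 2 ∂μ ≤
        ENNReal.ofReal (C * (lam ^ d / lam ^ (k + 1)) * (h ^ extentExp d k / h ^ boxExp d r) *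
          (lam * h ^ r) ^ (-α)) * G * ∏ i, ∫⁻ t in subIco t₀ h K (b i), ‖f t‖ₑ ^ 2) :
    levelSum γ lam f μ q K n ≤ ENNReal.ofReal ((2 * k + 3 : ℝ) ^ q) *
        levelSum γ lam f μ q K (n + 1) +
      ENNReal.ofReal (((K : ℝ) ^ 2) ^ q) * ((sepTuples k K).card *
        (ENNReal.ofReal (C * lam ^ (-(α - d + (k + 1)))) * G *
        (∫⁻ t in Icc 0 1, ‖f t‖ₑ ^ 2) ^ (q / 2))) := by
  have hKn : 0 < K ^ n := pow_pos hK n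
  have hKr : (1 : ℝ) ≤ ((K ^ n : ℕ) : ℝ) := by exact_mod_cast hKn
  have hh0 : 0 < h := by rw [hh]; positivity
  have hh1 : h ≤ 1 := by rw [hh]; exact (div_le_one (by positivity)).mpr hKr
  set B : ℝ≥0∞ := ENNReal.ofReal (((K : ℝ) ^ 2) ^ q) * (sepTuples k K).card *
        (ENNReal.ofReal (C * lam ^ (-(α - d + (k + 1)))) * G) with hB
  have hpiece : ∀ a ∈ Finset.range (K ^ n),
      ∫⁻ x, ‖curveExt γ lam (subIco 0 1 (K ^ n) a) f x‖ₑ ^ q ∂μ ≤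
      ENNReal.ofReal ((2 * k + 3 : ℝ) ^ q) * (∑ b ∈ Finset.range K,
        ∫⁻ x, ‖curveExt γ lam (subIco 0 1 (K ^ (n + 1)) (a * K + b)) f x‖ₑ ^ q ∂μ) +
      B * (∫⁻ t in subIco 0 1 (K ^ n) a, ‖f t‖ₑ ^ 2) ^ (q / 2) := by
    intro a ha
    have ha1 : ((a : ℝ) + 1) ≤ ((K ^ n : ℕ) : ℝ) := by
      exact_mod_cast Finset.mem_range.mp ha
    have ht0 : 0 ≤ a * h := by positivity
    have ht1 : a * h + h ≤ 1 := by
      rw [hh, mul_one_div, ← add_div]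
      exact (div_le_one (by positivity)).mpr ha1
    have h1 := lintegral_step_le (lam := lam) hγ hh0 (Icc_subset_Icc ht0 ht1) hK hq μ hf
      (hY _ ht0 ht1)
    have e1 : Ico (a * h) (a * h + h) = subIco 0 1 (K ^ n) a := by rw [hh, Ico_eq_subIco]
    have e2 : ∀ b, subIco (a * h) h K b = subIco 0 1 (K ^ (n + 1)) (a * K + b) := fun b => by
      rw [hh, subIco_child]
    simp only [e1, e2] at h1
    refine h1.trans (add_le_add le_rfl ?_)
    rw [hB]
    calc _ = ENNReal.ofReal (((K : ℝ) ^ 2) ^ q) * (sepTuples k K).card *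
        ((ENNReal.ofReal (C * (lam ^ d / lam ^ (k + 1)) * (h ^ extentExp d k / h ^ boxExp d r) *
          (lam * h ^ r) ^ (-α)) * ENNReal.ofReal (h ^ (q / 2 - (k + 1)))) * G) *
          (∫⁻ t in subIco 0 1 (K ^ n) a, ‖f t‖ₑ ^ 2) ^ (q / 2) := by ring
      _ ≤ _ := by
        refine mul_le_mul' (mul_le_mul' le_rfl (mul_le_mul' ?_ le_rfl)) le_rfl
        rw [← ENNReal.ofReal_mul (by positivity)]
        exact ENNReal.ofReal_le_ofReal (scale_power_le hC hlam hh0 hh1 hexp)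
  refine (Finset.sum_le_sum hpiece).trans ?_
  rw [Finset.sum_add_distrib, ← Finset.mul_sum, ← Finset.mul_sum,
    sum_range_mul_eq (fun c => ∫⁻ x, ‖curveExt γ lam (subIco 0 1 (K ^ (n + 1)) c) f x‖ₑ ^ q ∂μ),
    ← pow_succ]
  refine add_le_add le_rfl ?_
  have hk : (1 : ℝ) ≤ k + 1 := by linarith [Nat.cast_nonneg (α := ℝ) k]
  calc _ ≤ B * (∫⁻ t in Icc 0 1, ‖f t‖ₑ ^ 2) ^ (q / 2) := by
        gcongr
        rw [← sum_lintegral_subIco (K ^ n) hKn]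
        exact sum_rpow_le_rpow_sum _ _ (by linarith)
    _ = _ := by rw [hB]; ring

/-- At the terminal scale each piece is bounded by Cauchy–Schwarz; the shortness of the intervals
supplies the decay. -/
theorem levelSum_le_small {K N : ℕ} (hK : 0 < K) {q : ℝ} (hq : 2 ≤ q)
    (hf : MemLp f 2 (volume.restrict (Icc 0 1))) :
    levelSum γ lam f μ q K N ≤ ENNReal.ofReal ((1 / ((K ^ N : ℕ) : ℝ)) ^ (q / 2)) *
      (∫⁻ t in Icc 0 1, ‖f t‖ₑ ^ 2) ^ (q / 2) * μ univ := by
  have hKn : 0 < K ^ N := pow_pos hK N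
  have hKr : (1 : ℝ) ≤ ((K ^ N : ℕ) : ℝ) := by exact_mod_cast hKn
  set h : ℝ := 1 / ((K ^ N : ℕ) : ℝ) with hh
  have hh0 : 0 ≤ h := by rw [hh]; positivity
  have hpiece : ∀ a ∈ Finset.range (K ^ N),
      ∫⁻ x, ‖curveExt γ lam (subIco 0 1 (K ^ N) a) f x‖ₑ ^ q ∂μ ≤
      ENNReal.ofReal (h ^ (q / 2)) * μ univ *
        (∫⁻ t in subIco 0 1 (K ^ N) a, ‖f t‖ₑ ^ 2) ^ (q / 2) := by
    intro a ha
    have hsub : subIco 0 1 (K ^ N) a ⊆ Icc 0 1 := by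
      simpa using subIco_subset_Icc (t₀ := 0) (h := 1) zero_lt_one (Finset.mem_range.mp ha)
    have hpt : ∀ x, ‖curveExt γ lam (subIco 0 1 (K ^ N) a) f x‖ₑ ^ q ≤
        ENNReal.ofReal (h ^ (q / 2)) * (∫⁻ t in subIco 0 1 (K ^ N) a, ‖f t‖ₑ ^ 2) ^ (q / 2) := by
      intro x
      have h1 := enorm_curveExt_sq_le (γ := γ) (lam := lam) (hf.1.mono_measure
        (Measure.restrict_mono hsub le_rfl)) x
      have h2 : volume (subIco 0 1 (K ^ N) a) = ENNReal.ofReal h := by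
        rw [subIco, Real.volume_Ico]; congr 1; rw [hh]; ring
      rw [h2] at h1
      have h3 : ‖curveExt γ lam (subIco 0 1 (K ^ N) a) f x‖ₑ ^ q =
          (‖curveExt γ lam (subIco 0 1 (K ^ N) a) f x‖ₑ ^ 2) ^ (q / 2) := by
        rw [← ENNReal.rpow_natCast, ← ENNReal.rpow_mul]
        congr 1; push_cast; ring
      rw [h3]
      refine (ENNReal.rpow_le_rpow h1 (by linarith)).trans_eq ?_
      rw [ENNReal.mul_rpow_of_nonneg _ _ (by linarith),
        ENNReal.ofReal_rpow_of_nonneg hh0 (by linarith)]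
    refine (lintegral_mono hpt).trans_eq ?_
    rw [lintegral_const]; ring
  refine (Finset.sum_le_sum hpiece).trans ?_
  rw [← Finset.mul_sum, mul_right_comm]
  gcongr
  rw [← sum_lintegral_subIco (K ^ N) hKn]
  exact sum_rpow_le_rpow_sum _ _ (by linarith)

/-- The triangle inequality, with loss K^(nq). It serves only to reach a fixed starting level, where
the loss does not depend on λ. -/
theorem lintegral_curveExt_le_levelSum (hγ : ContinuousOn γ (Icc 0 1)) {K n : ℕ} (hK : 0 < K)
    {q : ℝ} (hq : 0 < q) (hf : MemLp f 2 (volume.restrict (Icc 0 1))) :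
    ∫⁻ x, ‖curveExt γ lam (Icc 0 1) f x‖ₑ ^ q ∂μ ≤
      ((K ^ n : ℕ) : ℝ≥0∞) ^ q * levelSum γ lam f μ q K n := by
  have hKn : 0 < K ^ n := pow_pos hK n
  have hfi : IntegrableOn f (Icc 0 1) := hf.integrable (by norm_num)
  have hsub : ∀ a < K ^ n, subIco 0 1 (K ^ n) a ⊆ Icc 0 1 := fun a ha => by
    simpa using subIco_subset_Icc (t₀ := 0) (h := 1) zero_lt_one ha
  have hm : ∀ a < K ^ n, Measurable (curveExt γ lam (subIco 0 1 (K ^ n) a) f) := fun a ha =>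
    measurable_curveExt hγ (measurableSet_subIco _ _ _ _) (hsub a ha) (hfi.mono_set (hsub a ha))
  rw [levelSum, ← lintegral_finsetSum', ← lintegral_const_mul']
  · refine lintegral_mono fun x => ?_
    rw [curveExt_Icc_eq, curveExt_eq_sum hγ zero_le_one (by simp [Ico_subset_Icc_self]) hKn hfi]
    refine (ENNReal.rpow_le_rpow (enorm_sum_le _ _) hq.le).trans ?_
    refine (rpow_sum_le_card_mul _ _ hq).trans_eq ?_
    rw [Finset.card_range]
  · exact ENNReal.rpow_ne_top_of_nonneg hq.le (ENNReal.natCast_ne_top _)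
  · intro a ha
    exact ((hm a (Finset.mem_range.mp ha)).enorm.pow_const _).aemeasurable

theorem lintegral_curveExt_le_trivial {q : ℝ} (hq : 0 ≤ q)
    (hf : MemLp f 2 (volume.restrict (Icc 0 1))) :
    ∫⁻ x, ‖curveExt γ lam (Icc 0 1) f x‖ₑ ^ q ∂μ ≤
      (∫⁻ t in Icc 0 1, ‖f t‖ₑ ^ 2) ^ (q / 2) * μ univ := by
  rw [← lintegral_const]
  refine lintegral_mono fun x => ?_
  have h1 := enorm_curveExt_sq_le (γ := γ) (lam := lam) hf.1 x
  rw [Real.volume_Icc, sub_zero, ENNReal.ofReal_one, one_mul] at h1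
  have h3 : ‖curveExt γ lam (Icc 0 1) f x‖ₑ ^ q =
      (‖curveExt γ lam (Icc 0 1) f x‖ₑ ^ 2) ^ (q / 2) := by
    rw [← ENNReal.rpow_natCast, ← ENNReal.rpow_mul]
    congr 1; push_cast; ring
  rw [h3]
  exact ENNReal.rpow_le_rpow h1 (by linarith)

end Level

/-! ### The linear estimate at p = 2 -/

theorem exists_subdivision {A ε : ℝ} (hA : 0 ≤ A) (hε : 0 < ε) :
    ∃ K : ℕ, 2 ≤ K ∧ A ≤ (K : ℝ) ^ ε := by
  obtain ⟨K, hK⟩ := exists_nat_ge (A ^ (1 / ε) + 2)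
  have h0 : 0 ≤ A ^ (1 / ε) := by positivity
  refine ⟨K, ?_, ?_⟩
  · have : (2 : ℝ) ≤ K := by linarith
    exact_mod_cast this
  · calc A = (A ^ (1 / ε)) ^ ε := by
          rw [← Real.rpow_mul hA, one_div_mul_cancel hε.ne', Real.rpow_one]
      _ ≤ _ := Real.rpow_le_rpow h0 (by linarith) hε.le

/-- The recursion runs from a fixed level n₀, where intervals are short enough for the multilinear
estimate, to the last level with λh^r ≥ 1. The condition `hexp` makes the broad parts uniform in the
scale, and `hs` makes the terminal level small enough. -/
theorem IsNondegBy.linear_estimate {d : ℕ} {γ : ℝ → EuclideanSpace ℝ (Fin d)}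
    {D : ℕ → ℝ → EuclideanSpace ℝ (Fin d)} {M : ℝ} (hD : IsNondegBy γ D M)
    (hγ : ContinuousOn γ (Icc 0 1)) {α q ε : ℝ}
    {k r : ℕ} (hk : k + 1 ≤ d) (hr : 1 ≤ r) (hq : 2 * (k + 1) ≤ q)
    (hexp : 0 ≤ q / 2 - (k + 1) + extentExp d k - boxExp d r - r * α)
    (hs : r * (α - d + (k + 1)) ≤ q / 2) (hε : 0 < ε) :
    ∃ C : ℝ, 0 < C ∧ ∀ μ : Measure (EuclideanSpace ℝ (Fin d)),
      μ (Metric.closedBall 0 1)ᶜ = 0 → HasGrowth α μ → ∀ lam : ℝ, 1 ≤ lam →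
      ∀ f : ℝ → ℂ, MemLp f 2 (volume.restrict (Icc 0 1)) →
      ∫⁻ x, ‖curveExt γ lam (Icc 0 1) f x‖ₑ ^ q ∂μ ≤
        ENNReal.ofReal (C * lam ^ (-(α - d + (k + 1)) + ε)) * growthNorm α μ *
          (∫⁻ t in Icc 0 1, ‖f t‖ₑ ^ 2) ^ (q / 2) := by
  set s : ℝ := α - d + (k + 1) with hsdef
  have hk0 : (0 : ℝ) ≤ k := Nat.cast_nonneg k
  have hr0 : (1 : ℝ) ≤ r := by exact_mod_cast hr
  have hq0 : 0 < q := by linarith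
  set A : ℝ := (2 * k + 3 : ℝ) ^ q with hA
  have hA2 : 2 ≤ A := by
    calc (2 : ℝ) ≤ (2 * k + 3) ^ (1 : ℝ) := by rw [Real.rpow_one]; linarith
      _ ≤ A := Real.rpow_le_rpow_of_exponent_le (by linarith) (by linarith)
  -- K is so large that the constant A of the dichotomy is at most K^ε; over N steps with K^N ≤ λ
  -- this accumulates to at most λ^ε.
  obtain ⟨K, hK2, hKA⟩ := exists_subdivision (A := A) (by linarith) hε
  have hK0 : 0 < K := by omega
  have hKr : (2 : ℝ) ≤ K := by exact_mod_cast hK2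
  have hKpos : (0 : ℝ) < K := by linarith
  obtain ⟨C, hC, h₀, hh₀, hml⟩ := hD.multilinear (α := α) (n := r) hk hK0
  obtain ⟨n₀, hn₀⟩ := pow_unbounded_of_one_lt (1 / h₀) (by linarith : (1 : ℝ) < K)
  set Λ : ℝ := ((K : ℝ) ^ r) ^ n₀ with hΛ
  have hΛ0 : 0 < Λ := by positivity
  set Z : ℝ := ((K : ℝ) ^ 2) ^ q * (sepTuples k K).card with hZ
  have hZ0 : 0 ≤ Z := by positivity
  refine ⟨2 ^ α * Λ ^ |s| + ((K : ℝ) ^ n₀) ^ q * ((K : ℝ) ^ (q / 2) * 2 ^ α + Z * C),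
    by positivity, ?_⟩
  intro μ hμ hg lam hlam f hf
  have hlam0 : 0 < lam := by linarith
  set G := growthNorm α μ with hG
  set F := (∫⁻ t in Icc 0 1, ‖f t‖ₑ ^ 2) ^ (q / 2) with hF
  have huniv : μ univ ≤ G * ENNReal.ofReal (2 ^ α) := measure_univ_le_growthNorm hμ
  have hKr1 : (1 : ℝ) < (K : ℝ) ^ r := one_lt_pow₀ (by linarith) (by omega)
  obtain ⟨N, hN1, hN2⟩ := exists_nat_pow_near hlam hKr1
  -- If N < n₀, then λ ≤ Λ and the trivial estimate suffices, powers of λ being bounded.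
  rcases lt_or_ge N n₀ with hNn | hNn
  · have hlamΛ : lam ≤ Λ := hN2.le.trans (pow_le_pow_right₀ hKr1.le hNn)
    have h1 : 1 ≤ Λ ^ |s| * lam ^ (-s + ε) := by
      calc (1 : ℝ) ≤ lam ^ ε := Real.one_le_rpow hlam hε.le
        _ = lam ^ s * lam ^ (-s + ε) := by rw [← Real.rpow_add hlam0]; congr 1; ring
        _ ≤ _ := by
          gcongr
          calc lam ^ s ≤ lam ^ |s| := Real.rpow_le_rpow_of_exponent_le hlam (le_abs_self s)
            _ ≤ _ := Real.rpow_le_rpow hlam0.le hlamΛ (abs_nonneg s)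
    calc _ ≤ F * μ univ := lintegral_curveExt_le_trivial hq0.le hf
      _ ≤ F * (G * ENNReal.ofReal (2 ^ α)) := by gcongr
      _ = ENNReal.ofReal (2 ^ α) * G * F := by ring
      _ ≤ _ := by
        refine mul_le_mul' (mul_le_mul' (ENNReal.ofReal_le_ofReal ?_) le_rfl) le_rfl
        calc (2 : ℝ) ^ α ≤ 2 ^ α * (Λ ^ |s| * lam ^ (-s + ε)) :=
              le_mul_of_one_le_right (by positivity) h1
          _ = (2 ^ α * Λ ^ |s|) * lam ^ (-s + ε) := by ring
          _ ≤ _ := by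
            gcongr
            exact le_add_of_nonneg_right (by positivity)
  · set Dv : ℝ≥0∞ := ENNReal.ofReal (((K : ℝ) ^ 2) ^ q) * ((sepTuples k K).card *
        (ENNReal.ofReal (C * lam ^ (-s)) * G * F)) with hDv
    have hDv' : Dv = ENNReal.ofReal (Z * C * lam ^ (-s)) * (G * F) := by
      have hZ' : ENNReal.ofReal Z = ENNReal.ofReal (((K : ℝ) ^ 2) ^ q) * (sepTuples k K).card := by
        rw [hZ, ENNReal.ofReal_mul (by positivity), ENNReal.ofReal_natCast]
      rw [hDv, mul_assoc Z, ENNReal.ofReal_mul hZ0, hZ']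
      ring
    have hstep : ∀ i, n₀ ≤ i → i < n₀ + (N - n₀) →
        levelSum γ lam f μ q K i ≤ ENNReal.ofReal A * levelSum γ lam f μ q K (i + 1) + Dv := by
      intro i hi1 hi2
      have hiN : i ≤ N := by omega
      set h : ℝ := 1 / ((K ^ i : ℕ) : ℝ) with hh
      have hhpos : 0 < h := by rw [hh]; positivity
      have hh1 : h ≤ h₀ := by
        rw [hh, one_div_le (by positivity) hh₀]
        push_cast
        exact hn₀.le.trans (pow_le_pow_right₀ (by linarith) hi1)
      have hh2 : 1 ≤ lam * h ^ r := by
        rw [hh]; push_cast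
        rw [one_div, inv_pow, ← div_eq_mul_inv, one_le_div (by positivity), ← pow_mul, mul_comm i,
          pow_mul]
        exact (pow_le_pow_right₀ hKr1.le hiN).trans hN1
      exact levelSum_le_step hγ hK0 hq hC.le hlam0 hexp hf hh
        fun t₀ ht0 ht1 b hb1 hb2 => hml μ hμ hg t₀ h lam ht0 hhpos hh1 ht1 hlam0 hh2 b hb1 hb2 f hf
    have hrec := geometric_recursion (A := ENNReal.ofReal A) (by
      rw [show (2 : ℝ≥0∞) = ENNReal.ofReal 2 by simp]
      exact ENNReal.ofReal_le_ofReal hA2) (N - n₀) hstep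
    rw [Nat.add_sub_cancel' hNn] at hrec
    have hAN : ENNReal.ofReal A ^ (N - n₀) ≤ ENNReal.ofReal (lam ^ ε) := by
      rw [← ENNReal.ofReal_pow (by linarith)]
      refine ENNReal.ofReal_le_ofReal ?_
      calc A ^ (N - n₀) ≤ A ^ N := pow_le_pow_right₀ (by linarith) (Nat.sub_le _ _)
        _ ≤ ((K : ℝ) ^ ε) ^ N := by gcongr
        _ = ((K : ℝ) ^ N) ^ ε := by
          rw [← Real.rpow_natCast, ← Real.rpow_natCast, ← Real.rpow_mul hKpos.le,
            ← Real.rpow_mul hKpos.le, mul_comm]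
        _ ≤ lam ^ ε := by
          refine Real.rpow_le_rpow (by positivity) (le_trans ?_ hN1) hε.le
          exact pow_le_pow_left₀ hKpos.le (le_self_pow₀ (by linarith) (by omega)) N
    -- By the choice of N, K^(-N) ≤ K λ^(-1/r); as rs ≤ q/2, the factor K^(-Nq/2) is at most a
    -- constant times λ^(-s).
    have hsmall : (1 / ((K ^ N : ℕ) : ℝ)) ^ (q / 2) ≤ (K : ℝ) ^ (q / 2) * lam ^ (-s) := by
      have h1 : lam ^ s ≤ (K : ℝ) ^ (q / 2) * ((K : ℝ) ^ N) ^ (q / 2) := by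
        calc lam ^ s ≤ lam ^ (q / 2 / r) := by
              refine Real.rpow_le_rpow_of_exponent_le hlam ?_
              rw [le_div_iff₀ (by linarith)]; linarith
          _ ≤ (((K : ℝ) ^ r) ^ (N + 1)) ^ (q / 2 / r) :=
              Real.rpow_le_rpow hlam0.le hN2.le (by positivity)
          _ = ((K : ℝ) ^ (N + 1)) ^ (q / 2) := by
              rw [← pow_mul, mul_comm r, pow_mul, ← Real.rpow_natCast _ r,
                ← Real.rpow_mul (by positivity)]
              congr 1; field_simp
          _ = _ := by rw [pow_succ, Real.mul_rpow (by positivity) hKpos.le, mul_comm]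
      have h2 : 0 < ((K : ℝ) ^ N) ^ (q / 2) := by positivity
      rw [Real.rpow_neg hlam0.le, Real.div_rpow zero_le_one (by positivity), Real.one_rpow,
        ← div_eq_mul_inv]
      push_cast
      rw [div_le_div_iff₀ h2 (by positivity), one_mul]
      exact h1
    have hSN : levelSum γ lam f μ q K N ≤
        ENNReal.ofReal ((K : ℝ) ^ (q / 2) * 2 ^ α * lam ^ (-s)) * (G * F) := by
      refine (levelSum_le_small hK0 (by linarith) hf).trans ?_
      calc _ ≤ ENNReal.ofReal ((K : ℝ) ^ (q / 2) * lam ^ (-s)) * F *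
            (G * ENNReal.ofReal (2 ^ α)) :=
            mul_le_mul' (mul_le_mul' (ENNReal.ofReal_le_ofReal hsmall) le_rfl) huniv
        _ = _ := by
          rw [mul_right_comm _ ((2 : ℝ) ^ α),
            ENNReal.ofReal_mul (p := (K : ℝ) ^ (q / 2) * lam ^ (-s)) (by positivity)]
          ring
    calc _ ≤ ((K ^ n₀ : ℕ) : ℝ≥0∞) ^ q * levelSum γ lam f μ q K n₀ :=
          lintegral_curveExt_le_levelSum hγ hK0 hq0 hf
      _ ≤ ENNReal.ofReal (((K : ℝ) ^ n₀) ^ q) * (ENNReal.ofReal (lam ^ ε) *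
          (ENNReal.ofReal ((K : ℝ) ^ (q / 2) * 2 ^ α * lam ^ (-s)) * (G * F) +
            ENNReal.ofReal (Z * C * lam ^ (-s)) * (G * F))) := by
          refine mul_le_mul' (le_of_eq ?_) (hrec.trans (mul_le_mul' hAN
            (add_le_add hSN hDv'.le)))
          rw [← ENNReal.ofReal_rpow_of_nonneg (by positivity) hq0.le, ← Nat.cast_pow,
            ENNReal.ofReal_natCast]
      _ = ENNReal.ofReal (((K : ℝ) ^ n₀) ^ q * ((K : ℝ) ^ (q / 2) * 2 ^ α + Z * C) *
            lam ^ (-s + ε)) * G * F := by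
          rw [← add_mul, ← ENNReal.ofReal_add (by positivity) (by positivity), ← add_mul,
            Real.rpow_add hlam0, ← mul_assoc, ← mul_assoc, ← mul_assoc,
            ← ENNReal.ofReal_mul (by positivity), ← ENNReal.ofReal_mul (by positivity)]
          congr 3; ring
      _ ≤ _ := by
          refine mul_le_mul' (mul_le_mul' (ENNReal.ofReal_le_ofReal ?_) le_rfl) le_rfl
          gcongr
          exact le_add_of_nonneg_left (by positivity)

/-- The exponent of `h` in the multilinear estimate, in closed form. -/
theorem extentExp_sub_boxExp {d k r : ℕ} (hk : k + 1 ≤ d) (hr : r ≤ k + 1) :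
    ((extentExp d k : ℝ) - boxExp d r) =
      (k + 1) + (r * (d - (k + 1)) : ℝ) - ((k + 1 - r) * (k + 1 - r + 1) : ℝ) / 2 := by
  obtain ⟨e, rfl⟩ := Nat.exists_eq_add_of_le hk
  obtain ⟨w, hw⟩ := Nat.exists_eq_add_of_le hr
  have h1 : extentExp (k + 1 + e) k = (k + 1) + ∑ j ∈ Finset.range e, (k + 1 + j + 1) := by
    rw [extentExp, Fin.sum_univ_eq_sum_range (fun j => if j < k + 1 then 1 else j + 1),
      Finset.sum_range_add]
    congr 1
    · rw [Finset.sum_congr rfl fun j hj => if_pos (Finset.mem_range.mp hj)]; simp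
    · exact Finset.sum_congr rfl fun j _ => if_neg (by omega)
  have h2 : ∀ e, (boxExp (r + w + e) r : ℝ) = (w + e) * (w + e + 1) / 2 := by
    intro e
    rw [boxExp, Fin.sum_univ_eq_sum_range (fun j => j + 1 - r), add_assoc, Finset.sum_range_add]
    have h3 : ∑ j ∈ Finset.range r, (j + 1 - r) = 0 :=
      Finset.sum_eq_zero fun j hj => by have := Finset.mem_range.mp hj; omega
    have h4 : ∑ j ∈ Finset.range (w + e), (r + j + 1 - r) =
        ∑ j ∈ Finset.range (w + e), (j + 1) := Finset.sum_congr rfl fun j _ => by omega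
    rw [h3, h4, zero_add]
    have : ∀ n : ℕ, ((∑ j ∈ Finset.range n, (j + 1) : ℕ) : ℝ) = n * (n + 1) / 2 := by
      intro n
      induction n with
      | zero => simp
      | succ n ih => rw [Finset.sum_range_succ]; push_cast at ih ⊢; rw [ih]; ring
    rw [this]; push_cast; ring
  have h5 : ∀ n : ℕ, ((∑ j ∈ Finset.range n, (k + 1 + j + 1) : ℕ) : ℝ) =
      n * (k + 1) + n * (n + 1) / 2 := by
    intro n
    induction n with
    | zero => simp
    | succ n ih => rw [Finset.sum_range_succ]; push_cast at ih ⊢; rw [ih]; ring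
  have hkr : (k : ℝ) + 1 = r + w := by exact_mod_cast hw
  have h6 : (extentExp (k + 1 + e) k : ℝ) = (k + 1) + (e * (k + 1) + e * (e + 1) / 2) := by
    rw [h1, Nat.cast_add, h5]; push_cast; ring
  have h7 : (boxExp (k + 1 + e) r : ℝ) = (w + e) * (w + e + 1) / 2 := by
    have := h2 e; rwa [← hw] at this
  have h8 : (w : ℝ) = k + 1 - r := by linarith
  rw [h6, h7, h8]; push_cast; ring

/-! ### Estimates in normalised form and interpolation in q -/

/-- The estimate `‖T f‖_q ≤ C ⟨μ⟩^y λ^(-e+ε) ‖f‖_p` for the extension operator over `[0,1]`, where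
`x = 1/p` and `y = 1/q`. -/
def ExtBound {d : ℕ} (γ : ℝ → EuclideanSpace ℝ (Fin d)) (α x y e : ℝ) : Prop :=
  ∀ ε : ℝ, 0 < ε → ∃ C : ℝ, 0 < C ∧ ∀ μ : Measure (EuclideanSpace ℝ (Fin d)),
    μ (Metric.closedBall 0 1)ᶜ = 0 → HasGrowth α μ → ∀ lam : ℝ, 1 ≤ lam →
    ∀ f : ℝ → ℂ, MemLp f (ENNReal.ofReal x)⁻¹ (volume.restrict (Icc 0 1)) →
    eLpNorm (curveExt γ lam (Icc 0 1) f) (ENNReal.ofReal y)⁻¹ μ ≤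
      ENNReal.ofReal C * growthNorm α μ ^ y * ENNReal.ofReal (lam ^ (-e + ε)) *
        eLpNorm f (ENNReal.ofReal x)⁻¹ (volume.restrict (Icc 0 1))

/-- Hölder's inequality for ‖g‖ = ‖g‖^(1-t) ‖g‖^t. The value 0 of a reciprocal exponent is allowed
and means L^∞. -/
theorem eLpNorm_interpolate {E : Type*} [MeasurableSpace E] {μ : Measure E} {g : E → ℂ}
    (hg : AEStronglyMeasurable g μ) {y₀ y₁ t : ℝ} (h₀ : 0 ≤ y₀) (h₁ : 0 ≤ y₁) (ht0 : 0 < t)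
    (ht1 : t < 1) :
    eLpNorm g (ENNReal.ofReal ((1 - t) * y₀ + t * y₁))⁻¹ μ ≤
      eLpNorm g (ENNReal.ofReal y₀)⁻¹ μ ^ (1 - t) * eLpNorm g (ENNReal.ofReal y₁)⁻¹ μ ^ t := by
  have ht2 : 0 < 1 - t := by linarith
  have key : ∀ {s y : ℝ}, 0 < s → eLpNorm (fun x => ‖g x‖ ^ s) (ENNReal.ofReal (s * y))⁻¹ μ =
      eLpNorm g (ENNReal.ofReal y)⁻¹ μ ^ s := by
    intro s y hs
    rw [eLpNorm_norm_rpow g hs, ENNReal.ofReal_mul hs.le]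
    have hs' : ENNReal.ofReal s ≠ 0 := by simpa using hs
    rw [ENNReal.mul_inv (Or.inl hs') (Or.inl ENNReal.ofReal_ne_top), mul_right_comm,
      ENNReal.inv_mul_cancel hs' ENNReal.ofReal_ne_top, one_mul]
  have hT : ENNReal.HolderTriple (ENNReal.ofReal ((1 - t) * y₀))⁻¹ (ENNReal.ofReal (t * y₁))⁻¹
      (ENNReal.ofReal ((1 - t) * y₀ + t * y₁))⁻¹ := by
    constructor
    rw [inv_inv, inv_inv, inv_inv, ENNReal.ofReal_add (by positivity) (by positivity)]
  have hm : ∀ {s : ℝ}, 0 ≤ s → AEStronglyMeasurable (fun x => ‖g x‖ ^ s) μ := fun hs =>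
    (Real.continuous_rpow_const hs).comp_aestronglyMeasurable hg.norm
  have h := eLpNorm_smul_le_mul_eLpNorm (p := (ENNReal.ofReal ((1 - t) * y₀))⁻¹)
    (q := (ENNReal.ofReal (t * y₁))⁻¹) (r := (ENNReal.ofReal ((1 - t) * y₀ + t * y₁))⁻¹)
    (hm ht0.le) (hm ht2.le)
  rw [key ht2, key ht0] at h
  refine le_trans (le_of_eq ?_) h
  rw [← eLpNorm_norm g]
  congr 1
  funext x
  rw [Pi.smul_apply', smul_eq_mul, ← Real.rpow_add_of_nonneg (norm_nonneg _) ht2.le ht0.le]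
  simp

section

variable {d : ℕ} {γ : ℝ → EuclideanSpace ℝ (Fin d)} {α x y e : ℝ}

theorem measurable_curveExt_Icc {lam : ℝ} {f : ℝ → ℂ} (hγ : ContinuousOn γ (Icc 0 1))
    (hf : IntegrableOn f (Icc 0 1)) : Measurable (curveExt γ lam (Icc 0 1) f) :=
  measurable_curveExt hγ measurableSet_Icc subset_rfl hf

theorem memLp_integrableOn {f : ℝ → ℂ} (hx : x ≤ 1)
    (hf : MemLp f (ENNReal.ofReal x)⁻¹ (volume.restrict (Icc 0 1))) : IntegrableOn f (Icc 0 1) := by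
  refine hf.integrable ?_
  rw [ENNReal.one_le_inv]
  exact ENNReal.ofReal_le_one.mpr hx

theorem eLpNorm_curveExt_le_trivial {lam : ℝ} {f : ℝ → ℂ} (hy : 0 ≤ y)
    {μ : Measure (EuclideanSpace ℝ (Fin d))} (hμ : μ (Metric.closedBall 0 1)ᶜ = 0)
    {B : ℝ≥0∞} (hB : ∀ x, ‖curveExt γ lam (Icc 0 1) f x‖ₑ ≤ B) :
    eLpNorm (curveExt γ lam (Icc 0 1) f) (ENNReal.ofReal y)⁻¹ μ ≤
      ENNReal.ofReal ((2 ^ α) ^ y) * growthNorm α μ ^ y * B := by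
  refine (eLpNorm_le_of_ae_enorm_bound (Filter.Eventually.of_forall hB)).trans ?_
  rw [ENNReal.toReal_inv, inv_inv, ENNReal.toReal_ofReal hy, smul_eq_mul, mul_comm]
  refine mul_le_mul' ?_ le_rfl
  rw [← ENNReal.ofReal_rpow_of_nonneg (by positivity) hy, mul_comm,
    ← ENNReal.mul_rpow_of_nonneg _ _ hy]
  exact ENNReal.rpow_le_rpow (measure_univ_le_growthNorm hμ) hy

theorem enorm_curveExt_le_eLpNorm {lam : ℝ} {f : ℝ → ℂ} (hx : x ≤ 1)
    (hf : AEStronglyMeasurable f (volume.restrict (Icc 0 1))) (z : EuclideanSpace ℝ (Fin d)) :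
    ‖curveExt γ lam (Icc 0 1) f z‖ₑ ≤
      eLpNorm f (ENNReal.ofReal x)⁻¹ (volume.restrict (Icc 0 1)) := by
  have hpr : IsProbabilityMeasure ((volume : Measure ℝ).restrict (Icc 0 1)) := ⟨by simp⟩
  refine (enorm_curveExt_le _ _).trans ?_
  rw [← eLpNorm_one_eq_lintegral_enorm]
  refine eLpNorm_le_eLpNorm_of_exponent_le ?_ hf
  rw [ENNReal.one_le_inv]
  exact ENNReal.ofReal_le_one.mpr hx

theorem extBound_trivial (hx : x ≤ 1) (hy : 0 ≤ y) : ExtBound γ α x y 0 := by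
  intro ε hε
  refine ⟨(2 ^ α) ^ y, by positivity, fun μ hμ hg lam hlam f hf => ?_⟩
  refine (eLpNorm_curveExt_le_trivial (α := α) hy hμ (enorm_curveExt_le_eLpNorm hx hf.1)).trans ?_
  refine mul_le_mul' (le_mul_of_one_le_right' ?_) le_rfl
  rw [ENNReal.one_le_ofReal]
  exact Real.one_le_rpow hlam (by linarith)

/-- With p fixed, only norms of the single function Tf are interpolated, so Hölder's inequality is
enough. -/
theorem ExtBound.interpolate (hγ : ContinuousOn γ (Icc 0 1)) {y₀ y₁ e₀ e₁ t : ℝ} (hx : x ≤ 1)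
    (hy₀ : 0 ≤ y₀) (hy₁ : 0 ≤ y₁) (h₀ : ExtBound γ α x y₀ e₀) (h₁ : ExtBound γ α x y₁ e₁)
    (ht0 : 0 ≤ t) (ht1 : t ≤ 1) :
    ExtBound γ α x ((1 - t) * y₀ + t * y₁) ((1 - t) * e₀ + t * e₁) := by
  rcases ht0.eq_or_lt with rfl | ht0
  · simpa using h₀
  rcases ht1.eq_or_lt with rfl | ht1
  · simpa using h₁
  have ht2 : 0 < 1 - t := by linarith
  intro ε hε
  obtain ⟨C₀, hC₀, H₀⟩ := h₀ ε hε
  obtain ⟨C₁, hC₁, H₁⟩ := h₁ ε hε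
  refine ⟨C₀ ^ (1 - t) * C₁ ^ t, by positivity, fun μ hμ hg lam hlam f hf => ?_⟩
  have hlam0 : 0 < lam := by linarith
  set G := growthNorm α μ
  set F := eLpNorm f (ENNReal.ofReal x)⁻¹ (volume.restrict (Icc 0 1))
  refine (eLpNorm_interpolate (measurable_curveExt_Icc hγ (memLp_integrableOn hx hf)).aestronglyMeasurable
    hy₀ hy₁ ht0 ht1).trans ?_
  calc _ ≤ (ENNReal.ofReal C₀ * G ^ y₀ * ENNReal.ofReal (lam ^ (-e₀ + ε)) * F) ^ (1 - t) *
        (ENNReal.ofReal C₁ * G ^ y₁ * ENNReal.ofReal (lam ^ (-e₁ + ε)) * F) ^ t :=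
        mul_le_mul' (ENNReal.rpow_le_rpow (H₀ μ hμ hg lam hlam f hf) ht2.le)
          (ENNReal.rpow_le_rpow (H₁ μ hμ hg lam hlam f hf) ht0.le)
    _ = (ENNReal.ofReal (C₀ ^ (1 - t)) * ENNReal.ofReal (C₁ ^ t)) *
        (G ^ (y₀ * (1 - t)) * G ^ (y₁ * t)) *
        (ENNReal.ofReal (lam ^ ((-e₀ + ε) * (1 - t))) * ENNReal.ofReal (lam ^ ((-e₁ + ε) * t))) *
        (F ^ (1 - t) * F ^ t) := by
        simp only [ENNReal.mul_rpow_of_nonneg _ _ ht2.le, ENNReal.mul_rpow_of_nonneg _ _ ht0.le,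
          ← ENNReal.rpow_mul, Real.rpow_mul hlam0.le,
          ← ENNReal.ofReal_rpow_of_nonneg hC₀.le ht2.le,
          ← ENNReal.ofReal_rpow_of_nonneg hC₁.le ht0.le]
        rw [← ENNReal.ofReal_rpow_of_nonneg (x := lam ^ (-e₀ + ε)) (by positivity) ht2.le,
          ← ENNReal.ofReal_rpow_of_nonneg (x := lam ^ (-e₁ + ε)) (by positivity) ht0.le]
        ring
    _ = _ := by
        rw [← ENNReal.ofReal_mul (by positivity), ← ENNReal.ofReal_mul (by positivity),
          ← ENNReal.rpow_add_of_nonneg _ _ (by positivity) (by positivity),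
          ← ENNReal.rpow_add_of_nonneg _ _ ht2.le ht0.le, ← Real.rpow_add hlam0]
        have e1 : y₀ * (1 - t) + y₁ * t = (1 - t) * y₀ + t * y₁ := by ring
        have e2 : (-e₀ + ε) * (1 - t) + (-e₁ + ε) * t = -((1 - t) * e₀ + t * e₁) + ε := by ring
        rw [e1, e2, sub_add_cancel, ENNReal.rpow_one]

/-- The interpolated exponent stays on the affine function of y through the two given ones; this
form spares computing the interpolation parameter. -/
theorem ExtBound.interpolate_between (hγ : ContinuousOn γ (Icc 0 1)) {y₀ y₁ e₀ e₁ a b : ℝ}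
    (hx : x ≤ 1) (hy₀ : 0 ≤ y₀) (hy₁ : y₀ < y₁) (h₀ : ExtBound γ α x y₀ e₀)
    (h₁ : ExtBound γ α x y₁ e₁) (he₀ : e₀ = a * y₀ + b) (he₁ : e₁ = a * y₁ + b) (hy : y₀ ≤ y)
    (hy' : y ≤ y₁) : ExtBound γ α x y (a * y + b) := by
  have hpos : 0 < y₁ - y₀ := by linarith
  have h := ExtBound.interpolate hγ (t := (y - y₀) / (y₁ - y₀)) hx hy₀ (by linarith) h₀ h₁
    (div_nonneg (by linarith) hpos.le) ((div_le_one hpos).mpr (by linarith))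
  have e1 : (1 - (y - y₀) / (y₁ - y₀)) * y₀ + (y - y₀) / (y₁ - y₀) * y₁ = y := by
    field_simp; ring
  have e2 : (1 - (y - y₀) / (y₁ - y₀)) * e₀ + (y - y₀) / (y₁ - y₀) * e₁ = a * y + b := by
    rw [he₀, he₁]; field_simp; ring
  rwa [e1, e2] at h

theorem inv_ofReal_one_div {q : ℝ} (hq : 0 < q) : (ENNReal.ofReal (1 / q))⁻¹ = ENNReal.ofReal q := by
  rw [← ENNReal.ofReal_inv_of_pos (by positivity), one_div, inv_inv]

theorem eLpNorm_inv_ofReal {E : Type*} [MeasurableSpace E] {μ : Measure E} (g : E → ℂ) {q : ℝ}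
    (hq : 0 < q) :
    eLpNorm g (ENNReal.ofReal (1 / q))⁻¹ μ = (∫⁻ x, ‖g x‖ₑ ^ q ∂μ) ^ (1 / q) := by
  rw [inv_ofReal_one_div hq, eLpNorm_eq_lintegral_rpow_enorm_toReal (by simpa using hq)
    ENNReal.ofReal_ne_top, ENNReal.toReal_ofReal hq.le]

/-- Here k is the number of intervals, one more than the index in `linear_estimate`. With the closed
form of the exponents of h, `hexp` is the scale condition; it implies the terminal one because
(k-r)(k-r+1) ≥ 0. -/
theorem IsNondegBy.extBound {D : ℕ → ℝ → EuclideanSpace ℝ (Fin d)} {M : ℝ}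
    (hD : IsNondegBy γ D M) (hγ : ContinuousOn γ (Icc 0 1)) {q : ℝ} {k r : ℕ} (hk0 : 1 ≤ k)
    (hk : k ≤ d) (hr : 1 ≤ r) (hrk : r ≤ k) (hq : 2 * k ≤ q)
    (hexp : r * (α - d + k) + (k - r : ℝ) * (k - r + 1) / 2 ≤ q / 2) :
    ExtBound γ α (1 / 2) (1 / q) ((α - d + k) / q) := by
  intro ε hε
  obtain ⟨k, rfl⟩ : ∃ j, k = j + 1 := ⟨k - 1, by omega⟩
  push_cast at hq hexp ⊢
  have hk1 : (1 : ℝ) ≤ k + 1 := by linarith [Nat.cast_nonneg (α := ℝ) k]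
  have hq0 : 0 < q := by linarith
  have hrk' : (r : ℝ) ≤ k + 1 := by exact_mod_cast hrk
  have hE := extentExp_sub_boxExp hk hrk
  have hnn : 0 ≤ (k + 1 - r : ℝ) * (k + 1 - r + 1) / 2 := by
    have : (0 : ℝ) ≤ k + 1 - r := by linarith
    positivity
  obtain ⟨C, hC, H⟩ := hD.linear_estimate hγ (α := α) (q := q) (ε := ε * q) hk hr hq
    (by linarith) (by linarith) (by positivity)
  refine ⟨C ^ (1 / q), by positivity, fun μ hμ hg lam hlam f hf => ?_⟩
  have hlam0 : 0 < lam := by linarith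
  rw [eLpNorm_inv_ofReal _ hq0, eLpNorm_inv_ofReal _ two_pos]
  have hf2 : MemLp f 2 (volume.restrict (Icc 0 1)) := by
    rw [inv_ofReal_one_div two_pos] at hf; simpa using hf
  refine (ENNReal.rpow_le_rpow (H μ hμ hg lam hlam f hf2) (by positivity)).trans_eq ?_
  have hq1 : (0 : ℝ) ≤ 1 / q := by positivity
  rw [ENNReal.mul_rpow_of_nonneg _ _ hq1, ENNReal.mul_rpow_of_nonneg _ _ hq1,
    ENNReal.ofReal_rpow_of_nonneg (by positivity) hq1, Real.mul_rpow hC.le (by positivity),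
    ENNReal.ofReal_mul (by positivity), ← ENNReal.rpow_mul, ← Real.rpow_mul hlam0.le]
  have e1 : (-(α - d + (k + 1)) + ε * q) * (1 / q) = -((α - d + (k + 1)) / q) + ε := by
    field_simp
  have e2 : q / 2 * (1 / q) = 1 / 2 := by field_simp
  have e3 : ∀ t, ‖f t‖ₑ ^ (2 : ℝ) = ‖f t‖ₑ ^ 2 := fun t => by
    rw [← ENNReal.rpow_natCast]; norm_num
  rw [e1, e2]
  simp only [e3]
  ring

end

/-! ### Van der Corput's lemma -/

section VanDerCorput

theorem norm_integral_exp_neg (φ : ℝ → ℝ) (a b : ℝ) :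
    ‖∫ t in a..b, Complex.exp (Complex.I * ((-φ t : ℝ) : ℂ))‖ =
      ‖∫ t in a..b, Complex.exp (Complex.I * (φ t : ℂ))‖ := by
  have h : ∀ t, Complex.exp (Complex.I * ((-φ t : ℝ) : ℂ)) =
      (starRingEnd ℂ) (Complex.exp (Complex.I * (φ t : ℂ))) := fun t => by
    rw [← Complex.exp_conj]; simp
  simp_rw [h]
  rw [intervalIntegral.intervalIntegral_eq_integral_uIoc,
    intervalIntegral.intervalIntegral_eq_integral_uIoc, integral_conj]
  simp only [norm_smul, RCLike.norm_conj]

theorem norm_integral_exp_le_length (φ : ℝ → ℝ) {a b : ℝ} (hab : a ≤ b) :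
    ‖∫ t in a..b, Complex.exp (Complex.I * (φ t : ℂ))‖ ≤ b - a := by
  have h := intervalIntegral.norm_integral_le_of_norm_le_const (a := a) (b := b) (C := 1)
    (f := fun t => Complex.exp (Complex.I * (φ t : ℂ)))
    (fun t _ => by rw [mul_comm, Complex.norm_exp_ofReal_mul_I])
  rwa [one_mul, abs_of_nonneg (by linarith)] at h

/-- Integration by parts against e^{iφ}/(iψ). The error is kept as an integral because ψ is not
assumed monotone. -/
theorem norm_integral_exp_le_of_le_deriv {φ ψ ψ' : ℝ → ℝ} {a b ρ : ℝ} (hab : a ≤ b) (hρ : 0 < ρ)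
    (hφ : ∀ t ∈ Icc a b, HasDerivWithinAt φ (ψ t) (Icc a b) t)
    (hψ : ∀ t ∈ Icc a b, HasDerivWithinAt ψ (ψ' t) (Icc a b) t) (hc : ContinuousOn ψ' (Icc a b))
    (hl : (∀ t ∈ Icc a b, ρ ≤ ψ t) ∨ ∀ t ∈ Icc a b, ψ t ≤ -ρ) :
    ‖∫ t in a..b, Complex.exp (Complex.I * (φ t : ℂ))‖ ≤
      2 / ρ + ∫ t in a..b, |ψ' t| / ψ t ^ 2 := by
  have habs : ∀ t ∈ Icc a b, ρ ≤ |ψ t| := by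
    rcases hl with hl | hl
    · exact fun t ht => (hl t ht).trans (le_abs_self _)
    · exact fun t ht => by have := hl t ht; rw [abs_of_nonpos (by linarith)]; linarith
  have hne : ∀ t ∈ Icc a b, ψ t ≠ 0 := fun t ht => by
    have := habs t ht; exact abs_pos.mp (by linarith)
  have hφc : ContinuousOn φ (Icc a b) := fun t ht => (hφ t ht).continuousWithinAt
  have hψc : ContinuousOn ψ (Icc a b) := fun t ht => (hψ t ht).continuousWithinAt
  set E : ℝ → ℂ := fun t => Complex.exp (Complex.I * (φ t : ℂ)) with hE
  have hEn : ∀ t, ‖E t‖ = 1 := fun t => by rw [hE]; simp only; rw [mul_comm, Complex.norm_exp_ofReal_mul_I]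
  have hEc : ContinuousOn E (Icc a b) :=
    Complex.continuous_exp.comp_continuousOn
      (continuousOn_const.mul (Complex.continuous_ofReal.comp_continuousOn hφc))
  have hψC : ContinuousOn (fun t => (ψ t : ℂ)) (Icc a b) :=
    Complex.continuous_ofReal.comp_continuousOn hψc
  have hψC' : ContinuousOn (fun t => (ψ' t : ℂ)) (Icc a b) :=
    Complex.continuous_ofReal.comp_continuousOn hc
  have hneC : ∀ t ∈ Icc a b, Complex.I * (ψ t : ℂ) ≠ 0 := fun t ht =>
    mul_ne_zero Complex.I_ne_zero (by exact_mod_cast hne t ht)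
  set R : ℝ → ℂ := fun t => E t * (Complex.I * (ψ' t : ℂ)) / (Complex.I * (ψ t : ℂ)) ^ 2 with hR
  have hRc : ContinuousOn R (Icc a b) :=
    (hEc.mul (continuousOn_const.mul hψC')).div ((continuousOn_const.mul hψC).pow 2)
      (fun t ht => pow_ne_zero 2 (hneC t ht))
  have hder : ∀ t ∈ Ioo a b, HasDerivAt (fun t => E t / (Complex.I * (ψ t : ℂ))) (E t - R t) t := by
    intro t ht
    have ht' := Ioo_subset_Icc_self ht
    have hn : Icc a b ∈ nhds t := Icc_mem_nhds ht.1 ht.2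
    have h1 : HasDerivAt E (E t * (Complex.I * (ψ t : ℂ))) t :=
      (((hφ t ht').hasDerivAt hn).ofReal_comp.const_mul Complex.I).cexp
    have h2 := ((hψ t ht').hasDerivAt hn).ofReal_comp.const_mul Complex.I
    convert! h1.div h2 (hneC t ht') using 1
    rw [hR]; simp only
    have : (ψ t : ℂ) ≠ 0 := by exact_mod_cast hne t ht'
    field_simp
  have hint : IntervalIntegrable (fun t => E t - R t) volume a b :=
    (hEc.sub hRc).intervalIntegrable_of_Icc hab
  have hEi : IntervalIntegrable E volume a b := hEc.intervalIntegrable_of_Icc hab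
  have hRi : IntervalIntegrable R volume a b := hRc.intervalIntegrable_of_Icc hab
  have hFTC := intervalIntegral.integral_eq_sub_of_hasDerivAt_of_le hab
    (hEc.div (continuousOn_const.mul hψC) hneC) hder hint
  rw [intervalIntegral.integral_sub hEi hRi, sub_eq_iff_eq_add] at hFTC
  have hend : ∀ t ∈ Icc a b, ‖E t / (Complex.I * (ψ t : ℂ))‖ ≤ 1 / ρ := by
    intro t ht
    rw [norm_div, hEn, norm_mul, Complex.norm_I, one_mul, Complex.norm_real, Real.norm_eq_abs]
    exact one_div_le_one_div_of_le hρ (habs t ht)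
  have hRn : ∀ t, ‖R t‖ = |ψ' t| / ψ t ^ 2 := by
    intro t
    rw [hR]; simp only
    rw [norm_div, norm_mul, hEn, norm_pow, norm_mul, norm_mul, Complex.norm_I, Complex.norm_real,
      Complex.norm_real, one_mul, one_mul, one_mul, Real.norm_eq_abs, Real.norm_eq_abs, sq_abs]
  rw [hFTC]
  refine (norm_add_le _ _).trans (add_le_add ?_ ?_)
  · refine (norm_sub_le _ _).trans ?_
    have h1 := hend b (right_mem_Icc.mpr hab)
    have h2 := hend a (left_mem_Icc.mpr hab)
    calc _ ≤ 1 / ρ + 1 / ρ := add_le_add h1 h2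
      _ = 2 / ρ := by ring
  · refine (intervalIntegral.norm_integral_le_integral_norm hab).trans_eq ?_
    simp_rw [hRn]

/-- For increasing ψ the integrand is the derivative of -1/ψ. -/
theorem integral_deriv_div_sq_le {ψ ψ' : ℝ → ℝ} {a b ρ : ℝ} (hab : a ≤ b) (hρ : 0 < ρ)
    (hψ : ∀ t ∈ Icc a b, HasDerivWithinAt ψ (ψ' t) (Icc a b) t) (hc : ContinuousOn ψ' (Icc a b))
    (hpos : ∀ t ∈ Icc a b, 0 ≤ ψ' t)
    (hl : (∀ t ∈ Icc a b, ρ ≤ ψ t) ∨ ∀ t ∈ Icc a b, ψ t ≤ -ρ) :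
    ∫ t in a..b, |ψ' t| / ψ t ^ 2 ≤ 2 / ρ := by
  have habs : ∀ t ∈ Icc a b, ρ ≤ |ψ t| := by
    rcases hl with hl | hl
    · exact fun t ht => (hl t ht).trans (le_abs_self _)
    · exact fun t ht => by have := hl t ht; rw [abs_of_nonpos (by linarith)]; linarith
  have hne : ∀ t ∈ Icc a b, ψ t ≠ 0 := fun t ht => by
    have := habs t ht; exact abs_pos.mp (by linarith)
  have hψc : ContinuousOn ψ (Icc a b) := fun t ht => (hψ t ht).continuousWithinAt
  have hder : ∀ t ∈ Ioo a b, HasDerivAt (fun t => -(ψ t)⁻¹) (|ψ' t| / ψ t ^ 2) t := by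
    intro t ht
    have ht' := Ioo_subset_Icc_self ht
    have h1 := (((hψ t ht').hasDerivAt (Icc_mem_nhds ht.1 ht.2)).inv (hne t ht')).neg
    rw [abs_of_nonneg (hpos t ht')]
    convert! h1 using 1
    ring
  have hi : IntervalIntegrable (fun t => |ψ' t| / ψ t ^ 2) volume a b :=
    ((continuous_abs.comp_continuousOn hc).div (hψc.pow 2)
      (fun t ht => pow_ne_zero 2 (hne t ht))).intervalIntegrable_of_Icc hab
  rw [intervalIntegral.integral_eq_sub_of_hasDerivAt_of_le hab (hψc.inv₀ hne).neg hder hi]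
  have hb : ∀ t ∈ Icc a b, |(ψ t)⁻¹| ≤ 1 / ρ := fun t ht => by
    rw [abs_inv, ← one_div]; exact one_div_le_one_div_of_le hρ (habs t ht)
  have h1 := abs_le.mp (hb b (right_mem_Icc.mpr hab))
  have h2 := abs_le.mp (hb a (left_mem_Icc.mpr hab))
  have h3 : 2 / ρ = 1 / ρ + 1 / ρ := by ring
  simp only [Pi.neg_apply, Pi.inv_apply]
  linarith [h1.1, h2.2]

/-- Away from an interval of length `2δ`, a function of derivative at least `c` is large. -/
theorem norm_integral_le_of_split {φ ψ ψ' : ℝ → ℝ} {a b c δ B : ℝ} (hab : a ≤ b) (hc : 0 < c)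
    (hδ : 0 < δ) (hB : 0 ≤ B) (hφ : ContinuousOn φ (Icc a b))
    (hψ : ∀ t ∈ Icc a b, HasDerivWithinAt ψ (ψ' t) (Icc a b) t)
    (hl : ∀ t ∈ Icc a b, c ≤ ψ' t)
    (H : ∀ a' b', a ≤ a' → a' ≤ b' → b' ≤ b →
      ((∀ t ∈ Icc a' b', c * δ ≤ ψ t) ∨ ∀ t ∈ Icc a' b', ψ t ≤ -(c * δ)) →
      ‖∫ t in a'..b', Complex.exp (Complex.I * (φ t : ℂ))‖ ≤ B) :
    ‖∫ t in a..b, Complex.exp (Complex.I * (φ t : ℂ))‖ ≤ 2 * δ + 2 * B := by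
  have hψc : ContinuousOn ψ (Icc a b) := fun t ht => (hψ t ht).continuousWithinAt
  have hmono : ∀ s ∈ Icc a b, ∀ t ∈ Icc a b, s ≤ t → c * (t - s) ≤ ψ t - ψ s := by
    refine Convex.mul_sub_le_image_sub_of_le_deriv (convex_Icc a b) hψc ?_ ?_
    · intro t ht
      rw [interior_Icc] at ht
      exact ((hψ t (Ioo_subset_Icc_self ht)).hasDerivAt
        (Icc_mem_nhds ht.1 ht.2)).differentiableAt.differentiableWithinAt
    · intro t ht
      rw [interior_Icc] at ht
      rw [((hψ t (Ioo_subset_Icc_self ht)).hasDerivAt (Icc_mem_nhds ht.1 ht.2)).deriv]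
      exact hl t (Ioo_subset_Icc_self ht)
  have haI := left_mem_Icc.mpr hab
  have hbI := right_mem_Icc.mpr hab
  -- z is a zero of ψ if there is one, otherwise the endpoint where |ψ| is smallest; away from z,
  -- |ψ| grows at least linearly.
  obtain ⟨z, hz, hz1, hz2⟩ : ∃ z ∈ Icc a b, (∀ t ∈ Icc a b, z < t → c * (t - z) ≤ ψ t) ∧
      ∀ t ∈ Icc a b, t < z → ψ t ≤ -(c * (z - t)) := by
    rcases le_total 0 (ψ a) with h1 | h1
    · exact ⟨a, haI, fun t ht h => by linarith [hmono a haI t ht h.le],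
        fun t ht h => absurd ht.1 (not_le.mpr h)⟩
    rcases le_total (ψ b) 0 with h2 | h2
    · exact ⟨b, hbI, fun t ht h => absurd ht.2 (not_le.mpr h),
        fun t ht h => by linarith [hmono t ht b hbI h.le]⟩
    obtain ⟨z, hz, hz0⟩ := intermediate_value_Icc hab hψc ⟨h1, h2⟩
    exact ⟨z, hz, fun t ht h => by linarith [hmono z hz t ht h.le],
      fun t ht h => by linarith [hmono t ht z hz h.le]⟩
  set E : ℝ → ℂ := fun t => Complex.exp (Complex.I * (φ t : ℂ)) with hE
  have hEc : ContinuousOn E (Icc a b) :=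
    Complex.continuous_exp.comp_continuousOn
      (continuousOn_const.mul (Complex.continuous_ofReal.comp_continuousOn hφ))
  set u := max a (z - δ) with hu
  set v := min b (z + δ) with hv
  have hau : a ≤ u := le_max_left _ _
  have huz : u ≤ z := max_le hz.1 (by linarith)
  have hzv : z ≤ v := le_min hz.2 (by linarith)
  have hvb : v ≤ b := min_le_left _ _
  have hi : ∀ {s t}, a ≤ s → s ≤ t → t ≤ b → IntervalIntegrable E volume s t := fun h1 h2 h3 =>
    (hEc.mono (Icc_subset_Icc h1 h3)).intervalIntegrable_of_Icc h2
  have h1 : ‖∫ t in a..u, E t‖ ≤ B := by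
    rcases le_total (z - δ) a with h | h
    · rw [hu, max_eq_left h, intervalIntegral.integral_same, norm_zero]; exact hB
    · have hu' : u = z - δ := max_eq_right h
      refine H a u le_rfl hau (by linarith) (Or.inr fun t ht => ?_)
      have := hz2 t ⟨ht.1, by linarith [ht.2]⟩ (by linarith [ht.2])
      nlinarith [ht.2]
  have h2 : ‖∫ t in v..b, E t‖ ≤ B := by
    rcases le_total b (z + δ) with h | h
    · rw [hv, min_eq_left h, intervalIntegral.integral_same, norm_zero]; exact hB
    · have hv' : v = z + δ := min_eq_right h
      refine H v b (by linarith) hvb le_rfl (Or.inl fun t ht => ?_)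
      have := hz1 t ⟨by linarith [ht.1], ht.2⟩ (by linarith [ht.1])
      nlinarith [ht.1]
  have h3 : ‖∫ t in u..v, E t‖ ≤ 2 * δ := by
    refine (norm_integral_exp_le_length φ (by linarith)).trans ?_
    have e1 : z - δ ≤ u := le_max_right _ _
    have e2 : v ≤ z + δ := min_le_right _ _
    linarith
  have hsum : ∫ t in a..b, E t = (∫ t in a..u, E t) + (∫ t in u..v, E t) + ∫ t in v..b, E t := by
    rw [intervalIntegral.integral_add_adjacent_intervals (hi le_rfl hau (by linarith))
      (hi hau (by linarith) hvb), intervalIntegral.integral_add_adjacent_intervals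
      (hi le_rfl (by linarith) hvb) (hi (by linarith) hvb le_rfl)]
  rw [hsum]
  refine (norm_add₃_le).trans ?_
  linarith

theorem norm_integral_exp_le_of_second_deriv {φ ψ ψ' : ℝ → ℝ} {a b c : ℝ} (hab : a ≤ b)
    (hc : 0 < c) (hφ : ∀ t ∈ Icc a b, HasDerivWithinAt φ (ψ t) (Icc a b) t)
    (hψ : ∀ t ∈ Icc a b, HasDerivWithinAt ψ (ψ' t) (Icc a b) t) (hψ' : ContinuousOn ψ' (Icc a b))
    (hl : ∀ t ∈ Icc a b, c ≤ ψ' t) :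
    ‖∫ t in a..b, Complex.exp (Complex.I * (φ t : ℂ))‖ ≤ 10 * c ^ (-(1 / 2 : ℝ)) := by
  -- Balances the excised length δ with the bound 1/(cδ) outside it.
  set δ := c ^ (-(1 / 2 : ℝ)) with hδ
  have hδ0 : 0 < δ := by positivity
  have hcδ : c * δ = δ⁻¹ := by
    rw [hδ, ← Real.rpow_neg hc.le]
    nth_rewrite 1 [← Real.rpow_one c]
    rw [← Real.rpow_add hc]; norm_num
  have h := norm_integral_le_of_split (φ := φ) (B := 4 * δ) hab hc hδ0 (by positivity)
    (fun t ht => (hφ t ht).continuousWithinAt) hψ hl ?_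
  · linarith
  intro a' b' h1 h2 h3 h4
  have hsub : Icc a' b' ⊆ Icc a b := Icc_subset_Icc h1 h3
  have hρ : 0 < c * δ := by positivity
  have hψs := fun t ht => (hψ t (hsub ht)).mono hsub
  refine (norm_integral_exp_le_of_le_deriv h2 hρ (fun t ht => (hφ t (hsub ht)).mono hsub) hψs
    (hψ'.mono hsub) h4).trans ?_
  have h5 := integral_deriv_div_sq_le h2 hρ hψs (hψ'.mono hsub)
    (fun t ht => hc.le.trans (hl t (hsub ht))) h4
  have h6 : 2 / (c * δ) = 2 * δ := by rw [hcδ]; field_simp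
  linarith

/-- Van der Corput's lemma for derivatives of order at least two. -/
theorem exists_van_der_corput (n : ℕ) : ∃ C : ℝ, 0 < C ∧ ∀ (g : ℕ → ℝ → ℝ) (a b c : ℝ), a ≤ b →
    0 < c → (∀ i ≤ n + 2, ∀ t ∈ Icc a b, HasDerivWithinAt (g i) (g (i + 1) t) (Icc a b) t) →
    ((∀ t ∈ Icc a b, c ≤ g (n + 2) t) ∨ ∀ t ∈ Icc a b, g (n + 2) t ≤ -c) →
    ‖∫ t in a..b, Complex.exp (Complex.I * (g 0 t : ℂ))‖ ≤ C * c ^ (-(1 / (n + 2) : ℝ)) := by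
  have hsymm : ∀ (n : ℕ) (C : ℝ), (∀ (g : ℕ → ℝ → ℝ) (a b c : ℝ), a ≤ b →
      0 < c → (∀ i ≤ n + 2, ∀ t ∈ Icc a b, HasDerivWithinAt (g i) (g (i + 1) t) (Icc a b) t) →
      (∀ t ∈ Icc a b, c ≤ g (n + 2) t) →
      ‖∫ t in a..b, Complex.exp (Complex.I * (g 0 t : ℂ))‖ ≤ C * c ^ (-(1 / (n + 2) : ℝ))) →
      ∀ (g : ℕ → ℝ → ℝ) (a b c : ℝ), a ≤ b →
      0 < c → (∀ i ≤ n + 2, ∀ t ∈ Icc a b, HasDerivWithinAt (g i) (g (i + 1) t) (Icc a b) t) →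
      ((∀ t ∈ Icc a b, c ≤ g (n + 2) t) ∨ ∀ t ∈ Icc a b, g (n + 2) t ≤ -c) →
      ‖∫ t in a..b, Complex.exp (Complex.I * (g 0 t : ℂ))‖ ≤ C * c ^ (-(1 / (n + 2) : ℝ)) := by
    intro n C H g a b c hab hc hg hl
    rcases hl with hl | hl
    · exact H g a b c hab hc hg hl
    · rw [← norm_integral_exp_neg]
      exact H (fun i t => -g i t) a b c hab hc (fun i hi t ht => (hg i hi t ht).neg)
        fun t ht => by linarith [hl t ht]
  induction n with
  | zero =>
    refine ⟨10, by norm_num, hsymm 0 10 fun g a b c hab hc hg hl => ?_⟩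
    have := norm_integral_exp_le_of_second_deriv hab hc (hg 0 (by norm_num)) (hg 1 (by norm_num))
      (fun t ht => (hg 2 le_rfl t ht).continuousWithinAt) hl
    simpa using this
  | succ n ih =>
    obtain ⟨C, hC, H⟩ := ih
    refine ⟨2 + 2 * C, by positivity, hsymm (n + 1) _ fun g a b c hab hc hg hl => ?_⟩
    -- Balances the excised length δ with the bound of the lower order, where the derivative is at
    -- least cδ: (cδ)^(-1/(n+2)) = δ.
    set δ := c ^ (-(1 / ((n + 1 : ℕ) + 2) : ℝ)) with hδ
    have hδ0 : 0 < δ := by positivity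
    have hcδ : (c * δ) ^ (-(1 / (n + 2) : ℝ)) = δ := by
      have h1 : c * δ = c ^ (1 + -(1 / ((n + 1 : ℕ) + 2) : ℝ)) := by
        rw [Real.rpow_add hc, Real.rpow_one]
      rw [h1, ← Real.rpow_mul hc.le, hδ]
      congr 1
      push_cast
      field_simp
      ring
    have h := norm_integral_le_of_split (φ := g 0) (B := C * δ) hab hc hδ0 (by positivity)
      (fun t ht => (hg 0 (by omega) t ht).continuousWithinAt) (hg (n + 2) (by omega)) hl ?_
    · linarith
    intro a' b' h1 h2 h3 h4
    have hsub : Icc a' b' ⊆ Icc a b := Icc_subset_Icc h1 h3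
    have h5 := H g a' b' (c * δ) h2 (by positivity)
      (fun i hi t ht => (hg i (by omega) t (hsub ht)).mono hsub) h4
    rwa [hcδ] at h5

end VanDerCorput

/-! ### Decay of the Fourier transform of the curve -/

section Kernel

variable {d : ℕ} {γ : ℝ → EuclideanSpace ℝ (Fin d)} {D : ℕ → ℝ → EuclideanSpace ℝ (Fin d)} {M : ℝ}

theorem norm_integral_inner_le_one (z : EuclideanSpace ℝ (Fin d)) :
    ‖∫ t in Icc (0 : ℝ) 1, Complex.exp (Complex.I * ((inner ℝ z (γ t) : ℝ) : ℂ))‖ ≤ 1 := by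
  rw [integral_Icc_eq_integral_Ioc, ← intervalIntegral.integral_of_le zero_le_one]
  simpa using norm_integral_exp_le_length (fun t => inner ℝ z (γ t)) zero_le_one

theorem IsNondegBy.norm_sub_le (hD : IsNondegBy γ D M) {j : ℕ} (hj : j ≤ d) {s t : ℝ}
    (hs : s ∈ Icc (0 : ℝ) 1) (ht : t ∈ Icc (0 : ℝ) 1) : ‖D j t - D j s‖ ≤ M * |t - s| :=
  (convex_Icc (0 : ℝ) 1).norm_image_sub_le_of_norm_hasDerivWithin_le
    (fun u hu => hD.deriv j hj u hu) (fun u hu => hD.bound (j + 1) (by omega) u hu) hs ht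

/-- By nondegeneracy some derivative of the phase, of order between 1 and d, exceeds ‖z‖/(2M) at the
left endpoint, and on so short an interval it keeps half that size. Van der Corput's lemma of that
order applies; order 1 is treated separately, and order d gives the slowest decay. -/
theorem IsNondegBy.kernel_piece_le (hD : IsNondegBy γ D M) (hd : 2 ≤ d) :
    ∃ C : ℝ, 0 < C ∧ ∀ z : EuclideanSpace ℝ (Fin d), 1 ≤ ‖z‖ → ∀ a b : ℝ, 0 ≤ a → a ≤ b → b ≤ 1 →
      b - a ≤ 1 / (4 * M ^ 2) →
      ‖∫ t in a..b, Complex.exp (Complex.I * ((inner ℝ z (γ t) : ℝ) : ℂ))‖ ≤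
        C * ‖z‖ ^ (-(1 / d) : ℝ) := by
  have hM := hD.one_le
  have hM0 : 0 < M := by linarith
  choose Cv hCv Hv using exists_van_der_corput
  have hsum0 : 0 ≤ ∑ n ∈ Finset.range d, Cv n := Finset.sum_nonneg fun n _ => (hCv n).le
  have hd0 : (0 : ℝ) < d := by exact_mod_cast (by omega : 0 < d)
  refine ⟨8 * M + 16 * M ^ 3 + (∑ n ∈ Finset.range d, Cv n) * (4 * M), by positivity, ?_⟩
  intro z hz a b ha hab hb hlen
  set θ := ‖z‖ with hθ
  have hθ0 : 0 < θ := by linarith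
  have haI : a ∈ Icc (0 : ℝ) 1 := ⟨ha, hab.trans hb⟩
  have hsub : Icc a b ⊆ Icc 0 1 := Icc_subset_Icc ha hb
  obtain ⟨j, hj⟩ : ∃ j : Fin d, θ / (2 * M) < |inner ℝ z (D (j + 1) a)| := by
    by_contra hcon
    push Not at hcon
    have := hD.lower a haI z (θ / (2 * M)) (by positivity) hcon
    rw [← hθ] at this
    have e : M * (θ / (2 * M)) = θ / 2 := by field_simp
    linarith
  have hjd : j.val + 1 ≤ d := j.2
  set g : ℕ → ℝ → ℝ := fun i t => inner ℝ z (D i t) with hg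
  have hgd : ∀ i ≤ d, ∀ t ∈ Icc a b, HasDerivWithinAt (g i) (g (i + 1) t) (Icc a b) t := by
    intro i hi t ht
    have h1 := ((hD.deriv i hi t (hsub ht)).mono hsub)
    exact (innerSL ℝ z).hasFDerivAt.comp_hasDerivWithinAt t h1
  set c := θ / (4 * M) with hc
  have hc0 : 0 < c := by positivity
  have hgc : ∀ t ∈ Icc a b, |g (j + 1) t - g (j + 1) a| ≤ c := by
    intro t ht
    have h1 : g (j + 1) t - g (j + 1) a = inner ℝ z (D (j + 1) t - D (j + 1) a) := by
      rw [hg]; simp only; rw [inner_sub_right]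
    rw [h1]
    refine (abs_real_inner_le_norm _ _).trans ?_
    have h2 := hD.norm_sub_le hjd haI (hsub ht)
    have h3 : |t - a| ≤ 1 / (4 * M ^ 2) := by
      rw [abs_of_nonneg (by linarith [ht.1])]; linarith [ht.2]
    calc θ * ‖D (j + 1) t - D (j + 1) a‖ ≤ θ * (M * (1 / (4 * M ^ 2))) := by
          refine mul_le_mul_of_nonneg_left (h2.trans ?_) hθ0.le
          exact mul_le_mul_of_nonneg_left h3 hM0.le
      _ = c := by rw [hc]; field_simp
  have h2c : θ / (2 * M) = 2 * c := by rw [hc]; field_simp; norm_num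
  rw [h2c] at hj
  have hl : (∀ t ∈ Icc a b, c ≤ g (j + 1) t) ∨ ∀ t ∈ Icc a b, g (j + 1) t ≤ -c := by
    rcases lt_abs.mp hj with h | h
    · left; intro t ht
      have := (abs_le.mp (hgc t ht)).1
      change 2 * c < g (j + 1) a at h
      linarith
    · right; intro t ht
      have := (abs_le.mp (hgc t ht)).2
      change 2 * c < -g (j + 1) a at h
      linarith
  have hg0 : ∀ t, inner ℝ z (γ t) = g 0 t := fun t => by rw [hg]; simp only; rw [hD.zero]
  simp_rw [hg0]
  have hθd : ∀ i : ℝ, 1 ≤ i → i ≤ d → θ ^ (-(1 / i)) ≤ θ ^ (-(1 / d) : ℝ) := by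
    intro i hi1 hi2
    refine Real.rpow_le_rpow_of_exponent_le hz (neg_le_neg ?_)
    exact one_div_le_one_div_of_le (by linarith) hi2
  have hP : 0 < θ ^ (-(1 / d) : ℝ) := by positivity
  rcases Nat.eq_zero_or_pos j.val with hj0 | hj0
  · rw [hj0] at hl
    have hg2c : ContinuousOn (g 2) (Icc a b) := fun t ht => (hgd 2 hd t ht).continuousWithinAt
    have h1 := norm_integral_exp_le_of_le_deriv hab hc0 (hgd 0 (by omega)) (hgd 1 (by omega))
      hg2c hl
    -- Order one without monotonicity: |g 2| ≤ Mθ and |g 1| ≥ c, with c comparable to θ, make the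
    -- error integral O(1/θ).
    have h2 : ∫ t in a..b, |g 2 t| / g 1 t ^ 2 ≤ θ * M / c ^ 2 := by
      have h3 : ‖∫ t in a..b, |g 2 t| / g 1 t ^ 2‖ ≤ θ * M / c ^ 2 * |b - a| := by
        refine intervalIntegral.norm_integral_le_of_norm_le_const fun t ht => ?_
        rw [uIoc_of_le hab] at ht
        have ht' := Ioc_subset_Icc_self ht
        have h4 : |g 2 t| ≤ θ * M := (abs_real_inner_le_norm _ _).trans
          (mul_le_mul_of_nonneg_left (hD.bound 2 (by omega) t (hsub ht')) hθ0.le)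
        have h5 : c ^ 2 ≤ g 1 t ^ 2 := by
          rcases hl with hl | hl
          · have := hl t ht'; simp only [zero_add] at this; nlinarith
          · have := hl t ht'; simp only [zero_add] at this; nlinarith
        rw [Real.norm_of_nonneg (by positivity)]
        exact div_le_div₀ (by positivity) h4 (by positivity) h5
      refine (le_abs_self _).trans (h3.trans ?_)
      refine mul_le_of_le_one_right (by positivity) ?_
      rw [abs_of_nonneg (by linarith)]; linarith
    refine h1.trans ?_
    calc _ ≤ 2 / c + θ * M / c ^ 2 := by linarith
      _ = (8 * M + 16 * M ^ 3) * θ ^ (-(1 / 1) : ℝ) := by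
        rw [hc, div_one, Real.rpow_neg_one]; field_simp; ring
      _ ≤ (8 * M + 16 * M ^ 3) * θ ^ (-(1 / d) : ℝ) := by
        refine mul_le_mul_of_nonneg_left (hθd 1 le_rfl ?_) (by positivity)
        exact_mod_cast (by omega : 1 ≤ d)
      _ ≤ _ := mul_le_mul_of_nonneg_right (le_add_of_nonneg_right (by positivity)) hP.le
  · obtain ⟨n, hn⟩ : ∃ n, j.val = n + 1 := ⟨j.val - 1, by omega⟩
    rw [hn] at hl hjd
    have h1 := Hv n g a b c hab hc0 (fun i hi => hgd i (by omega)) hl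
    have hn2 : (1 : ℝ) ≤ n + 2 := by linarith [Nat.cast_nonneg (α := ℝ) n]
    refine h1.trans ?_
    have h2 : c ^ (-(1 / (n + 2)) : ℝ) ≤ (4 * M) * θ ^ (-(1 / d) : ℝ) := by
      rw [hc, Real.div_rpow hθ0.le (by positivity), Real.rpow_neg (by positivity : 0 ≤ 4 * M),
        div_inv_eq_mul, mul_comm]
      refine mul_le_mul ?_ (hθd _ hn2 (by exact_mod_cast hjd)) (by positivity) (by positivity)
      calc (4 * M) ^ (1 / (n + 2) : ℝ) ≤ (4 * M) ^ (1 : ℝ) :=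
            Real.rpow_le_rpow_of_exponent_le (by linarith) ((div_le_one (by linarith)).mpr hn2)
        _ = 4 * M := Real.rpow_one _
    have h3 : Cv n ≤ ∑ n ∈ Finset.range d, Cv n :=
      Finset.single_le_sum (fun n _ => (hCv n).le) (Finset.mem_range.mpr (by omega))
    calc _ ≤ (∑ n ∈ Finset.range d, Cv n) * ((4 * M) * θ ^ (-(1 / d) : ℝ)) :=
          mul_le_mul h3 h2 (by positivity) hsum0
      _ = (∑ n ∈ Finset.range d, Cv n) * (4 * M) * θ ^ (-(1 / d) : ℝ) := by ring
      _ ≤ _ := mul_le_mul_of_nonneg_right (le_add_of_nonneg_left (by positivity)) hP.le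

/-- A fixed number of short pieces. Having 1 ≤ C lets the same constant serve for ‖z‖ ≤ 1, where the
integral is at most 1. -/
theorem IsNondegBy.kernel_decay (hD : IsNondegBy γ D M) (hd : 2 ≤ d)
    (hγ : ContinuousOn γ (Icc 0 1)) :
    ∃ C : ℝ, 1 ≤ C ∧ ∀ z : EuclideanSpace ℝ (Fin d), 1 ≤ ‖z‖ →
      ‖∫ t in Icc (0 : ℝ) 1, Complex.exp (Complex.I * ((inner ℝ z (γ t) : ℝ) : ℂ))‖ ≤
        C * ‖z‖ ^ (-(1 / d) : ℝ) := by
  have hM0 : 0 < M := by linarith [hD.one_le]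
  obtain ⟨C, hC, H⟩ := hD.kernel_piece_le hd
  obtain ⟨n, hn⟩ := exists_nat_ge (4 * M ^ 2)
  have hn0 : (0 : ℝ) < n := lt_of_lt_of_le (by positivity) hn
  refine ⟨n * C + 1, by linarith [mul_pos hn0 hC], fun z hz => ?_⟩
  set E : ℝ → ℂ := fun t => Complex.exp (Complex.I * ((inner ℝ z (γ t) : ℝ) : ℂ)) with hE
  have hEc : ContinuousOn E (Icc 0 1) :=
    Complex.continuous_exp.comp_continuousOn
      (continuousOn_const.mul (Complex.continuous_ofReal.comp_continuousOn
        ((innerSL ℝ z).continuous.comp_continuousOn hγ)))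
  have hk : ∀ k < n, (0 : ℝ) ≤ (k : ℝ) / n ∧ (k : ℝ) / n ≤ ((k + 1 : ℕ) : ℝ) / n ∧
      ((k + 1 : ℕ) : ℝ) / n ≤ 1 := fun k hk => by
    refine ⟨by positivity, by gcongr; simp, (div_le_one hn0).mpr (by exact_mod_cast hk)⟩
  have hadj := intervalIntegral.sum_integral_adjacent_intervals (f := E) (μ := volume)
    (a := fun k : ℕ => (k : ℝ) / n) (n := n) fun k hkn =>
      (hEc.mono (Icc_subset_Icc (hk k hkn).1 (hk k hkn).2.2)).intervalIntegrable_of_Icc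
        (hk k hkn).2.1
  simp only [Nat.cast_zero, zero_div, div_self hn0.ne'] at hadj
  rw [integral_Icc_eq_integral_Ioc, ← intervalIntegral.integral_of_le zero_le_one, ← hadj]
  have hP : 0 < ‖z‖ ^ (-(1 / d) : ℝ) := Real.rpow_pos_of_pos (by linarith) _
  calc _ ≤ ∑ k ∈ Finset.range n, C * ‖z‖ ^ (-(1 / d) : ℝ) := by
        refine norm_sum_le_of_le _ fun k hkn => ?_
        have h := hk k (Finset.mem_range.mp hkn)
        refine H z hz _ _ h.1 h.2.1 h.2.2 ?_
        push_cast
        rw [← sub_div, add_sub_cancel_left]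
        exact one_div_le_one_div_of_le (by positivity) hn
    _ = n * C * ‖z‖ ^ (-(1 / d) : ℝ) := by
        rw [Finset.sum_const, Finset.card_range, nsmul_eq_mul, mul_assoc]
    _ ≤ _ := by
        refine mul_le_mul_of_nonneg_right (by linarith) hP.le

end Kernel

/-! ### The T T* method in L^q and the kernel estimate -/

/-- Young's inequality for a bilinear form with a kernel. -/
theorem lintegral_bilinear_le_of_kernel {B : Type*} [MeasurableSpace B] (τ : Measure B)
    [IsFiniteMeasure τ] {b : B → ℝ≥0∞} (hb : Measurable b) {k : B → B → ℝ≥0∞}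
    (hk : Measurable (Function.uncurry k)) {q : ℝ} (hq : 2 ≤ q) {W : ℝ≥0∞}
    (hW : ∀ x, ∫⁻ x', k x x' ^ (q / 2) ∂τ ≤ W) (hW' : ∀ x', ∫⁻ x, k x x' ^ (q / 2) ∂τ ≤ W) :
    ∫⁻ x, ∫⁻ x', b x * b x' * k x x' ∂τ ∂τ ≤
      (∫⁻ x, b x ^ (q / (q - 1)) ∂τ) ^ (2 * (1 - 1 / q)) * W ^ (2 / q) := by
  have hq0 : 0 < q := by linarith
  have hq1 : 0 < q - 1 := by linarith
  set p := q / (q - 1) with hp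
  have hp0 : 0 < p := by positivity
  have hkm : Measurable fun z : B × B => k z.1 z.2 := hk
  set S := ∫⁻ x, b x ^ p ∂τ with hS
  -- Hölder with three factors of weights 1 - 2/q, 1/q, 1/q: for p = q/(q-1) each of b x, b x', k x
  -- x' receives total exponent 1.
  set F : Fin 3 → B × B → ℝ≥0∞ := ![fun z => b z.1 ^ p * b z.2 ^ p,
    fun z => b z.1 ^ p * k z.1 z.2 ^ (q / 2), fun z => b z.2 ^ p * k z.1 z.2 ^ (q / 2)] with hF
  set w : Fin 3 → ℝ := ![1 - 2 / q, 1 / q, 1 / q] with hw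
  have hw0 : 0 ≤ 1 - 2 / q := by rw [sub_nonneg, div_le_one hq0]; exact hq
  have hw1 : 0 ≤ 1 / q := by positivity
  have hb1 : Measurable fun z : B × B => b z.1 := hb.comp measurable_fst
  have hb2 : Measurable fun z : B × B => b z.2 := hb.comp measurable_snd
  have hFm : ∀ i, Measurable (F i) := by
    intro i
    fin_cases i
    · exact (hb1.pow_const _).mul (hb2.pow_const _)
    · exact (hb1.pow_const _).mul (hkm.pow_const _)
    · exact (hb2.pow_const _).mul (hkm.pow_const _)
  have hH := ENNReal.lintegral_prod_norm_pow_le (μ := τ.prod τ) Finset.univ (f := F) (p := w)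
    (fun i _ => (hFm i).aemeasurable)
    (by simp only [Fin.sum_univ_three, hw]; simp; ring)
    (fun i _ => by fin_cases i; exacts [hw0, hw1, hw1])
  simp only [Fin.prod_univ_three] at hH
  simp only [hF, hw, Matrix.cons_val_zero, Matrix.cons_val_one, Matrix.cons_val] at hH
  have hpw : p * (1 - 2 / q) + p * (1 / q) = 1 := by rw [hp]; field_simp; ring
  have hpt : ∀ z : B × B, b z.1 * b z.2 * k z.1 z.2 =
      (b z.1 ^ p * b z.2 ^ p) ^ (1 - 2 / q) * (b z.1 ^ p * k z.1 z.2 ^ (q / 2)) ^ (1 / q) *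
        (b z.2 ^ p * k z.1 z.2 ^ (q / 2)) ^ (1 / q) := by
    intro z
    have e1 : ∀ y : ℝ≥0∞, y ^ (p * (1 - 2 / q)) * y ^ (p * (1 / q)) = y := fun y => by
      rw [← ENNReal.rpow_add_of_nonneg _ _ (by positivity) (by positivity), hpw, ENNReal.rpow_one]
    have e2 : ∀ y : ℝ≥0∞, y ^ (q / 2 * (1 / q)) * y ^ (q / 2 * (1 / q)) = y := fun y => by
      rw [← ENNReal.rpow_add_of_nonneg _ _ (by positivity) (by positivity)]
      have : q / 2 * (1 / q) + q / 2 * (1 / q) = 1 := by field_simp; norm_num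
      rw [this, ENNReal.rpow_one]
    simp only [ENNReal.mul_rpow_of_nonneg _ _ hw0, ENNReal.mul_rpow_of_nonneg _ _ hw1,
      ← ENNReal.rpow_mul]
    conv_lhs => rw [← e1 (b z.1), ← e1 (b z.2), ← e2 (k z.1 z.2)]
    ring
  have hI0 : ∫⁻ z, b z.1 ^ p * b z.2 ^ p ∂(τ.prod τ) = S * S := by
    rw [lintegral_prod_mul (f := fun x => b x ^ p) (g := fun x => b x ^ p)
      (hb.pow_const _).aemeasurable (hb.pow_const _).aemeasurable]
  have hI1 : ∫⁻ z, b z.1 ^ p * k z.1 z.2 ^ (q / 2) ∂(τ.prod τ) ≤ S * W := by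
    rw [lintegral_prod (fun z : B × B => b z.1 ^ p * k z.1 z.2 ^ (q / 2)) (hFm 1).aemeasurable, hS, ← lintegral_mul_const _ (hb.pow_const _)]
    refine lintegral_mono fun x => ?_
    simp only
    have hm : Measurable fun y => k x y := hkm.comp measurable_prodMk_left
    rw [lintegral_const_mul _ (hm.pow_const _)]
    exact mul_le_mul' le_rfl (hW x)
  have hI2 : ∫⁻ z, b z.2 ^ p * k z.1 z.2 ^ (q / 2) ∂(τ.prod τ) ≤ S * W := by
    rw [lintegral_prod_symm (fun z : B × B => b z.2 ^ p * k z.1 z.2 ^ (q / 2))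
      (hFm 2).aemeasurable, hS, ← lintegral_mul_const _ (hb.pow_const _)]
    refine lintegral_mono fun x => ?_
    simp only
    have hm : Measurable fun y => k y x := hkm.comp measurable_prodMk_right
    rw [lintegral_const_mul _ (hm.pow_const _)]
    exact mul_le_mul' le_rfl (hW' x)
  calc _ = ∫⁻ z, b z.1 * b z.2 * k z.1 z.2 ∂(τ.prod τ) := by
        rw [lintegral_prod (fun z : B × B => b z.1 * b z.2 * k z.1 z.2)
          ((hb1.mul hb2).mul hkm).aemeasurable]
    _ ≤ (S * S) ^ (1 - 2 / q) * (S * W) ^ (1 / q) * (S * W) ^ (1 / q) := by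
        simp_rw [hpt]
        refine hH.trans ?_
        rw [hI0]
        exact mul_le_mul' (mul_le_mul' le_rfl (ENNReal.rpow_le_rpow hI1 hw1))
          (ENNReal.rpow_le_rpow hI2 hw1)
    _ = (S ^ (1 - 2 / q) * S ^ (1 - 2 / q) * S ^ (1 / q) * S ^ (1 / q)) *
          (W ^ (1 / q) * W ^ (1 / q)) := by
        simp only [ENNReal.mul_rpow_of_nonneg _ _ hw0, ENNReal.mul_rpow_of_nonneg _ _ hw1]
        ring
    _ = _ := by
        rw [← ENNReal.rpow_add_of_nonneg _ _ hw0 hw0,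
          ← ENNReal.rpow_add_of_nonneg _ _ (by positivity) hw1,
          ← ENNReal.rpow_add_of_nonneg _ _ (by positivity) hw1,
          ← ENNReal.rpow_add_of_nonneg _ _ hw1 hw1]
        congr 2 <;> ring

/-- The `T T*` method: an `L² → L^q` estimate from an `L^(q/2)` bound for the composed kernel. -/
theorem lintegral_rpow_le_of_kernel {A B : Type*} [MeasurableSpace A] [MeasurableSpace B]
    (σ : Measure A) [IsFiniteMeasure σ] (τ : Measure B) [IsFiniteMeasure τ] (e : A → B → ℂ)
    (he : Measurable (Function.uncurry e)) (he1 : ∀ t x, ‖e t x‖ ≤ 1) {f : A → ℂ}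
    (hf : Integrable f σ) (hgm : Measurable fun x => ∫ t, e t x * f t ∂σ)
    {k : B → B → ℝ≥0∞} (hk : Measurable (Function.uncurry k))
    (hek : ∀ x x', ‖∫ t, e t x * (starRingEnd ℂ) (e t x') ∂σ‖ₑ ≤ k x x') {q : ℝ} (hq : 2 ≤ q)
    {W : ℝ≥0∞} (hW : ∀ x, ∫⁻ x', k x x' ^ (q / 2) ∂τ ≤ W)
    (hW' : ∀ x', ∫⁻ x, k x x' ^ (q / 2) ∂τ ≤ W) :
    ∫⁻ x, ‖∫ t, e t x * f t ∂σ‖ₑ ^ q ∂τ ≤ W * (∫⁻ t, ‖f t‖ₑ ^ 2 ∂σ) ^ (q / 2) := by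
  have hq0 : 0 < q := by linarith
  have hq1 : 0 < q - 1 := by linarith
  set g : B → ℂ := fun x => ∫ t, e t x * f t ∂σ with hg
  set S := ∫⁻ x, ‖g x‖ₑ ^ q ∂τ with hS
  set F := ∫⁻ t, ‖f t‖ₑ ^ 2 ∂σ with hF
  have hgm' : Measurable g := hgm
  set A₀ := ∫ t, ‖f t‖ ∂σ with hA₀
  have hgb : ∀ x, ‖g x‖ ≤ A₀ := fun x => by
    refine norm_integral_le_of_norm_le hf.norm (ae_of_all _ fun t => ?_)
    rw [norm_mul]
    exact mul_le_of_le_one_left (norm_nonneg _) (he1 t x)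
  -- The function dual to g: g b = |g|^q and |b|^(q/(q-1)) = |g|^q.
  set b : B → ℂ := fun x => (starRingEnd ℂ) (g x) * ((‖g x‖ ^ (q - 2) : ℝ) : ℂ) with hb
  have hbm : Measurable b := by
    refine (Complex.continuous_conj.measurable.comp hgm').mul ?_
    exact Complex.measurable_ofReal.comp (hgm'.norm.pow_const _)
  have hbn : ∀ x, ‖b x‖ = ‖g x‖ ^ (q - 1) := fun x => by
    rw [hb]; simp only
    rw [norm_mul, RCLike.norm_conj, Complex.norm_real, Real.norm_of_nonneg (by positivity)]
    nth_rewrite 1 [← Real.rpow_one ‖g x‖]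
    rw [← Real.rpow_add_of_nonneg (norm_nonneg _) zero_le_one (by linarith)]
    congr 1; ring
  have hbe : ∀ x, ‖b x‖ₑ = ‖g x‖ₑ ^ (q - 1) := fun x => by
    rw [← ofReal_norm, hbn, ← ENNReal.ofReal_rpow_of_nonneg (norm_nonneg _) hq1.le, ofReal_norm]
  have hbi : Integrable b τ := by
    refine Integrable.of_bound hbm.aestronglyMeasurable (A₀ ^ (q - 1)) (ae_of_all _ fun x => ?_)
    rw [hbn]
    exact Real.rpow_le_rpow (norm_nonneg _) (hgb x) hq1.le
  have hgbq : ∀ x, g x * b x = ((‖g x‖ ^ q : ℝ) : ℂ) := fun x => by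
    rw [hb]; simp only
    rw [← mul_assoc, Complex.mul_conj, Complex.normSq_eq_norm_sq, ← Complex.ofReal_mul,
      ← Real.rpow_natCast, ← Real.rpow_add_of_nonneg (norm_nonneg _) (by positivity) (by linarith)]
    congr 2; push_cast; ring
  have hgi : Integrable (fun x => ‖g x‖ ^ q) τ := by
    refine Integrable.of_bound (hgm'.norm.pow_const _).aestronglyMeasurable (A₀ ^ q)
      (ae_of_all _ fun x => ?_)
    rw [Real.norm_of_nonneg (by positivity)]
    exact Real.rpow_le_rpow (norm_nonneg _) (hgb x) hq0.le
  have hS1 : S = ‖∫ x, g x * b x ∂τ‖ₑ := by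
    simp_rw [hgbq]
    rw [integral_complex_ofReal, ← ofReal_norm, Complex.norm_real, Real.norm_of_nonneg
      (integral_nonneg fun t => by positivity),
      ofReal_integral_eq_lintegral_ofReal hgi (ae_of_all _ fun t => by positivity)]
    refine lintegral_congr fun x => ?_
    rw [← ENNReal.ofReal_rpow_of_nonneg (norm_nonneg _) hq0.le, ofReal_norm]
  have hStop : S ≠ ⊤ := by rw [hS1]; exact enorm_ne_top
  have hfub : ∫ x, g x * b x ∂τ = ∫ t, f t * ∫ x, e t x * b x ∂τ ∂σ := by
    have h0 : Integrable (fun p : B × A => b p.1 * f p.2) (τ.prod σ) := hbi.mul_prod hf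
    have h1 : Integrable (fun p : B × A => e p.2 p.1 * (b p.1 * f p.2)) (τ.prod σ) :=
      h0.bdd_mul (c := 1) (he.comp measurable_swap).aestronglyMeasurable
        (ae_of_all _ fun p => he1 p.2 p.1)
    have h2 := integral_integral_swap (f := fun x t => e t x * (b x * f t)) h1
    calc _ = ∫ x, ∫ t, e t x * (b x * f t) ∂σ ∂τ := by
          refine integral_congr_ae (ae_of_all _ fun x => ?_)
          simp only [hg]
          rw [← integral_mul_const]
          refine integral_congr_ae (ae_of_all _ fun t => ?_)
          simp only; ring
      _ = _ := by
          rw [h2]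
          refine integral_congr_ae (ae_of_all _ fun t => ?_)
          simp only
          rw [← integral_const_mul]
          refine integral_congr_ae (ae_of_all _ fun x => ?_)
          simp only; ring
  have hTm : AEStronglyMeasurable (fun t => ∫ x, e t x * b x ∂τ) σ := by
    have h1 : AEStronglyMeasurable (fun p : A × B => e p.1 p.2 * b p.2) (σ.prod τ) :=
      he.aestronglyMeasurable.mul hbm.aestronglyMeasurable.comp_snd
    exact h1.integral_prod_right'
  have hN : ∫⁻ t, ‖∫ x, e t x * b x ∂τ‖ₑ ^ 2 ∂σ ≤ S ^ (2 * (1 - 1 / q)) * W ^ (2 / q) := by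
    refine (lintegral_enorm_sq_le_kernel σ τ e he he1 b hbi).trans ?_
    calc _ ≤ ∫⁻ x, ∫⁻ x', ‖b x‖ₑ * ‖b x'‖ₑ * k x x' ∂τ ∂τ :=
          lintegral_mono fun x => lintegral_mono fun x' => mul_le_mul' le_rfl (hek x x')
      _ ≤ _ := lintegral_bilinear_le_of_kernel τ hbm.enorm hk hq hW hW'
      _ = _ := by
          congr 2
          refine lintegral_congr fun x => ?_
          rw [hbe, ← ENNReal.rpow_mul]
          congr 1; field_simp
  have hS2 : S ^ 2 ≤ F * (S ^ (2 * (1 - 1 / q)) * W ^ (2 / q)) := by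
    calc S ^ 2 ≤ (∫⁻ t, ‖f t‖ₑ * ‖∫ x, e t x * b x ∂τ‖ₑ ∂σ) ^ 2 := by
          refine pow_le_pow_left' ?_ 2
          rw [hS1, hfub]
          refine (enorm_integral_le_lintegral_enorm _).trans_eq ?_
          simp_rw [enorm_mul]
      _ ≤ F * ∫⁻ t, ‖∫ x, e t x * b x ∂τ‖ₑ ^ 2 ∂σ :=
          sq_lintegral_mul_le _ hf.aestronglyMeasurable.enorm hTm.enorm
      _ ≤ _ := mul_le_mul' le_rfl hN
  rcases eq_or_ne S 0 with hS0 | hS0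
  · rw [hS0]; exact zero_le
  -- S is nonzero and, g being bounded and τ finite, also finite; hence S^(2-2/q) cancels from both
  -- sides of hS2.
  have hz : S ^ (2 * (1 - 1 / q)) ≠ 0 := by simp [hS0, hStop]
  have hz' : S ^ (2 * (1 - 1 / q)) ≠ ⊤ := by simp [hS0, hStop]
  have h3 : S ^ 2 = S ^ (2 * (1 - 1 / q)) * S ^ (2 / q) := by
    rw [← ENNReal.rpow_natCast, ← ENNReal.rpow_add _ _ hS0 hStop]
    congr 1; push_cast; ring
  rw [h3, mul_left_comm, ENNReal.mul_le_mul_iff_right hz hz'] at hS2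
  have h4 : ∀ y : ℝ≥0∞, (y ^ (2 / q)) ^ (q / 2) = y := fun y => by
    rw [← ENNReal.rpow_mul]
    have : 2 / q * (q / 2) = 1 := by field_simp
    rw [this, ENNReal.rpow_one]
  calc S = (S ^ (2 / q)) ^ (q / 2) := (h4 S).symm
    _ ≤ (F * W ^ (2 / q)) ^ (q / 2) := ENNReal.rpow_le_rpow hS2 (by positivity)
    _ = _ := by rw [ENNReal.mul_rpow_of_nonneg _ _ (by positivity), h4, mul_comm]

/-- Integrals of a decaying kernel against a measure of dimension `α`. -/
theorem exists_lintegral_decay_le {d : ℕ} {α κ : ℝ} (hακ : α < κ) (hκ : 0 ≤ κ) :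
    ∃ C : ℝ, 0 < C ∧ ∀ μ : Measure (EuclideanSpace ℝ (Fin d)), ∀ lam : ℝ, 0 < lam → ∀ x,
      ∫⁻ z, ENNReal.ofReal (max 1 (lam * ‖x - z‖) ^ (-κ)) ∂μ ≤
        ENNReal.ofReal (C * lam ^ (-α)) * growthNorm α μ := by
  set r : ℝ := 2 ^ (-(κ - α)) with hr
  have hr0 : 0 < r := by positivity
  have hr1 : r < 1 := Real.rpow_lt_one_of_one_lt_of_neg one_lt_two (by linarith)
  refine ⟨2 ^ α * (1 - r)⁻¹, by have : 0 < 1 - r := by linarith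
                                positivity, fun μ lam hlam x => ?_⟩
  set G := growthNorm α μ
  have hball : ∀ i : ℕ, MeasurableSet (Metric.ball x (2 ^ (i + 1) / lam)) := fun i =>
    Metric.isOpen_ball.measurableSet
  -- Dyadic decomposition: the i-th ball carries the value 2^(-κi), and its mass is at most a
  -- constant times 2^(iα) λ^(-α); the series converges because α < κ.
  have hpt : ∀ z, ENNReal.ofReal (max 1 (lam * ‖x - z‖) ^ (-κ)) ≤
      ∑' i : ℕ, (Metric.ball x (2 ^ (i + 1) / lam)).indicator
        (fun _ => ENNReal.ofReal ((2 : ℝ) ^ (-κ * i))) z := by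
    intro z
    set ρ := lam * ‖x - z‖ with hρ
    have hmem : ∀ i : ℕ, ρ < 2 ^ (i + 1) → z ∈ Metric.ball x (2 ^ (i + 1) / lam) := by
      intro i hi
      rw [Metric.mem_ball, dist_eq_norm, norm_sub_rev, lt_div_iff₀ hlam, mul_comm]
      exact hi
    obtain ⟨i, hi1, hi2⟩ := exists_nat_pow_near (le_max_left 1 ρ) one_lt_two
    refine le_trans ?_ (ENNReal.le_tsum i)
    rw [indicator_of_mem (hmem i ((le_max_right 1 ρ).trans_lt hi2))]
    refine ENNReal.ofReal_le_ofReal ?_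
    calc max 1 ρ ^ (-κ) ≤ ((2 : ℝ) ^ i) ^ (-κ) :=
          Real.rpow_le_rpow_of_nonpos (by positivity) hi1 (by linarith)
      _ = 2 ^ (-κ * i) := by
          rw [← Real.rpow_natCast, ← Real.rpow_mul zero_le_two, mul_comm]
  calc _ ≤ ∫⁻ z, ∑' i : ℕ, (Metric.ball x (2 ^ (i + 1) / lam)).indicator
        (fun _ => ENNReal.ofReal ((2 : ℝ) ^ (-κ * i))) z ∂μ := lintegral_mono hpt
    _ = ∑' i : ℕ, ENNReal.ofReal ((2 : ℝ) ^ (-κ * i)) * μ (Metric.ball x (2 ^ (i + 1) / lam)) := by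
        rw [lintegral_tsum fun i => (measurable_const.indicator (hball i)).aemeasurable]
        refine tsum_congr fun i => ?_
        rw [lintegral_indicator_const (hball i)]
    _ ≤ ∑' i : ℕ, (ENNReal.ofReal (2 ^ α * lam ^ (-α)) * G) * ENNReal.ofReal r ^ i := by
        refine ENNReal.tsum_le_tsum fun i => ?_
        refine (mul_le_mul' le_rfl (measure_ball_le_growthNorm (α := α) x (by positivity))).trans_eq ?_
        rw [mul_comm (growthNorm α μ), ← mul_assoc, ← ENNReal.ofReal_mul (by positivity),
          mul_right_comm, ← ENNReal.ofReal_pow hr0.le, ← ENNReal.ofReal_mul (by positivity)]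
        congr 2
        rw [Real.div_rpow (by positivity) hlam.le, Real.rpow_neg hlam.le, div_eq_mul_inv,
          ← mul_assoc, hr, ← Real.rpow_natCast, ← Real.rpow_natCast, ← Real.rpow_mul zero_le_two,
          ← Real.rpow_mul zero_le_two, ← Real.rpow_add two_pos, mul_right_comm,
          ← Real.rpow_add two_pos]
        congr 2; push_cast; ring
    _ = _ := by
        rw [ENNReal.tsum_mul_left, ENNReal.tsum_geometric, ← ENNReal.ofReal_one,
          ← ENNReal.ofReal_sub _ hr0.le, ← ENNReal.ofReal_inv_of_pos (by linarith),
          mul_right_comm, ← ENNReal.ofReal_mul (by positivity)]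
        congr 2; ring

section

variable {d : ℕ} {γ : ℝ → EuclideanSpace ℝ (Fin d)} {D : ℕ → ℝ → EuclideanSpace ℝ (Fin d)}
  {M α : ℝ}

/-- The T T* kernel is the Fourier transform of the curve at λ(x-x'), of decay |z|^(-1/d). Its power
q/2 has decay exponent q/(2d) > α, so it integrates to O(λ^(-α)) against an α-dimensional measure.
-/
theorem IsNondegBy.extBound_of_decay (hD : IsNondegBy γ D M) (hd : 2 ≤ d)
    (hγ : ContinuousOn γ (Icc 0 1)) {q : ℝ} (hq : 2 ≤ q) (hqα : 2 * d * α < q) :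
    ExtBound γ α (1 / 2) (1 / q) (α / q) := by
  have hq0 : 0 < q := by linarith
  have hd0 : (0 : ℝ) < d := by exact_mod_cast (by omega : 0 < d)
  obtain ⟨C, hC, HK⟩ := hD.kernel_decay hd hγ
  have hκ : α < q / (2 * d) := by rw [lt_div_iff₀ (by positivity)]; linarith
  obtain ⟨C', hC', HW⟩ := exists_lintegral_decay_le (d := d) hκ (by positivity)
  intro ε hε
  refine ⟨(C ^ (q / 2) * C') ^ (1 / q), by positivity, fun μ hμ hg lam hlam f hf => ?_⟩
  have hlam0 : 0 < lam := by linarith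
  have hfin : IsFiniteMeasure μ := isFiniteMeasure_of_growth hμ hg
  have hf2 : MemLp f 2 (volume.restrict (Icc 0 1)) := by
    rw [inv_ofReal_one_div two_pos] at hf; simpa using hf
  have hfi : Integrable f (volume.restrict (Icc 0 1)) := hf2.integrable (by norm_num)
  -- Extension of γ by its endpoint values, so that the kernel is continuous, hence jointly
  -- measurable, on the whole product.
  set γ' : ℝ → EuclideanSpace ℝ (Fin d) := fun t => γ (projIcc 0 1 zero_le_one t) with hγ'
  have hγ'c : Continuous γ' := (continuousOn_iff_continuous_domRestrict.mp hγ).comp continuous_projIcc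
  have hγ'e : ∀ t ∈ Icc (0 : ℝ) 1, γ' t = γ t := fun t ht => by
    rw [hγ']; simp only; rw [projIcc_of_mem _ ht]
  set e : ℝ → EuclideanSpace ℝ (Fin d) → ℂ := fun t x =>
    Complex.exp (Complex.I * ((lam * inner ℝ x (γ' t) : ℝ) : ℂ)) with he
  have hem : Measurable (Function.uncurry e) := by
    refine Continuous.measurable ?_
    rw [he]; simp only [Function.uncurry_def]
    fun_prop
  have he1 : ∀ t x, ‖e t x‖ ≤ 1 := fun t x => by
    rw [he]; simp only; rw [mul_comm, Complex.norm_exp_ofReal_mul_I]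
  have hT : ∀ x, ∫ t in Icc 0 1, e t x * f t = curveExt γ lam (Icc 0 1) f x := fun x => by
    refine setIntegral_congr_fun measurableSet_Icc fun t ht => ?_
    rw [he]; simp only; rw [hγ'e t ht]
  set k : EuclideanSpace ℝ (Fin d) → EuclideanSpace ℝ (Fin d) → ℝ≥0∞ := fun x x' =>
    ENNReal.ofReal (C * max 1 (lam * ‖x - x'‖) ^ (-(1 / d) : ℝ)) with hk
  have hkm : Measurable (Function.uncurry k) := by
    rw [hk]; simp only [Function.uncurry_def]
    fun_prop
  have hek : ∀ x x', ‖∫ t in Icc 0 1, e t x * (starRingEnd ℂ) (e t x')‖ₑ ≤ k x x' := by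
    intro x x'
    have h1 : ∫ t in Icc 0 1, e t x * (starRingEnd ℂ) (e t x') =
        ∫ t in Icc (0 : ℝ) 1, Complex.exp (Complex.I *
          ((inner ℝ (lam • (x - x')) (γ t) : ℝ) : ℂ)) := by
      refine setIntegral_congr_fun measurableSet_Icc fun t ht => ?_
      rw [he]; simp only
      rw [hγ'e t ht, ← Complex.exp_conj, ← Complex.exp_add, real_inner_smul_left, inner_sub_left]
      congr 1
      simp only [map_mul, Complex.conj_I, Complex.conj_ofReal]
      push_cast; ring
    rw [h1, hk, ← ofReal_norm]
    refine ENNReal.ofReal_le_ofReal ?_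
    have hn : ‖lam • (x - x')‖ = lam * ‖x - x'‖ := by
      rw [norm_smul, Real.norm_of_nonneg hlam0.le]
    rcases le_total 1 (lam * ‖x - x'‖) with h | h
    · rw [max_eq_right h, ← hn]
      exact HK _ (by rw [hn]; exact h)
    · rw [max_eq_left h, Real.one_rpow, mul_one]
      exact (norm_integral_inner_le_one _).trans hC
  set W : ℝ≥0∞ := ENNReal.ofReal (C ^ (q / 2) * C' * lam ^ (-α)) * growthNorm α μ with hW
  have hkW : ∀ x, ∫⁻ x', k x x' ^ (q / 2) ∂μ ≤ W := by
    intro x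
    have h1 : ∀ x', k x x' ^ (q / 2) = ENNReal.ofReal (C ^ (q / 2)) *
        ENNReal.ofReal (max 1 (lam * ‖x - x'‖) ^ (-(q / (2 * d)))) := by
      intro x'
      have hm0 : 0 < max 1 (lam * ‖x - x'‖) := lt_max_of_lt_left one_pos
      rw [hk]; simp only
      rw [ENNReal.ofReal_rpow_of_nonneg (by positivity) (by positivity),
        ← ENNReal.ofReal_mul (by positivity), Real.mul_rpow (by positivity) (by positivity),
        ← Real.rpow_mul hm0.le]
      congr 3
      field_simp
    simp_rw [h1]
    rw [lintegral_const_mul' _ _ ENNReal.ofReal_ne_top, hW, mul_assoc (C ^ (q / 2)),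
      ENNReal.ofReal_mul (by positivity), mul_assoc]
    exact mul_le_mul' le_rfl (HW μ lam hlam0 x)
  have hsymm : ∀ x x', k x x' = k x' x := fun x x' => by
    rw [hk]; simp only; rw [norm_sub_rev]
  have hmain := lintegral_rpow_le_of_kernel (volume.restrict (Icc 0 1)) μ e hem he1 hfi
    (by simp_rw [hT]; exact measurable_curveExt_Icc hγ hfi) hkm hek hq hkW
    (fun x' => by simp_rw [hsymm _ x']; exact hkW x')
  simp_rw [hT] at hmain
  rw [eLpNorm_inv_ofReal _ hq0, eLpNorm_inv_ofReal _ two_pos]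
  have hq1 : (0 : ℝ) ≤ 1 / q := by positivity
  have e2 : q / 2 * (1 / q) = 1 / 2 := by field_simp
  have e3 : ∀ t, ‖f t‖ₑ ^ (2 : ℝ) = ‖f t‖ₑ ^ 2 := fun t => by
    rw [← ENNReal.rpow_natCast]; norm_num
  refine (ENNReal.rpow_le_rpow hmain hq1).trans ?_
  rw [ENNReal.mul_rpow_of_nonneg _ _ hq1, hW, ENNReal.mul_rpow_of_nonneg _ _ hq1,
    ENNReal.ofReal_rpow_of_nonneg (by positivity) hq1, Real.mul_rpow (by positivity)
    (by positivity), ← ENNReal.rpow_mul, e2, ENNReal.ofReal_mul (by positivity),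
    ← Real.rpow_mul hlam0.le]
  simp only [e3]
  rw [mul_right_comm (ENNReal.ofReal _) (ENNReal.ofReal _)]
  refine mul_le_mul' (mul_le_mul' le_rfl (ENNReal.ofReal_le_ofReal ?_)) le_rfl
  refine Real.rpow_le_rpow_of_exponent_le hlam ?_
  have : -α * (1 / q) = -(α / q) := by ring
  linarith

end

/-! ### From p = 2 to p < 2 by level sets -/

section LevelSets

variable {d : ℕ} {γ : ℝ → EuclideanSpace ℝ (Fin d)} {lam : ℝ} {f : ℝ → ℂ}
  {μ : Measure (EuclideanSpace ℝ (Fin d))}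

/-- The part of `f` of size in `(a, b]`. -/
noncomputable def levelPart (f : ℝ → ℂ) (a b : ℝ) : ℝ → ℂ :=
  indicator {t | a < ‖f t‖ ∧ ‖f t‖ ≤ b} f

/-- The part of `f` of size larger than `a`. -/
noncomputable def upperPart (f : ℝ → ℂ) (a : ℝ) : ℝ → ℂ := indicator {t | a < ‖f t‖} f

theorem upperPart_eq_add {a b : ℝ} (hab : a ≤ b) :
    upperPart f a = levelPart f a b + upperPart f b := by
  ext1 t
  simp only [upperPart, levelPart, Pi.add_apply, indicator_apply, mem_ofPred_eq]
  rcases le_or_gt ‖f t‖ b with h | h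
  · simp [h, not_lt.mpr h]
  · simp [h, not_le.mpr h, hab.trans_lt h]

theorem measurableSet_level (hf : StronglyMeasurable f) (a b : ℝ) :
    MeasurableSet {t | a < ‖f t‖ ∧ ‖f t‖ ≤ b} :=
  (measurableSet_lt measurable_const hf.norm.measurable).inter
    (measurableSet_le hf.norm.measurable measurable_const)

theorem measurableSet_upper (hf : StronglyMeasurable f) (a : ℝ) :
    MeasurableSet {t | a < ‖f t‖} := measurableSet_lt measurable_const hf.norm.measurable

theorem eLpNorm_curveExt_add_le (hγ : ContinuousOn γ (Icc 0 1)) {f g : ℝ → ℂ}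
    (hf : IntegrableOn f (Icc 0 1)) (hg : IntegrableOn g (Icc 0 1)) {q : ℝ≥0∞} (hq : 1 ≤ q) :
    eLpNorm (curveExt γ lam (Icc 0 1) (f + g)) q μ ≤
      eLpNorm (curveExt γ lam (Icc 0 1) f) q μ + eLpNorm (curveExt γ lam (Icc 0 1) g) q μ := by
  have h : curveExt γ lam (Icc 0 1) (f + g) =
      curveExt γ lam (Icc 0 1) f + curveExt γ lam (Icc 0 1) g := by
    ext1 x
    simp only [curveExt, Pi.add_apply, mul_add]
    exact integral_add (integrable_phase_mul hγ measurableSet_Icc subset_rfl hf x)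
      (integrable_phase_mul hγ measurableSet_Icc subset_rfl hg x)
  rw [h]
  exact eLpNorm_add_le (measurable_curveExt_Icc hγ hf).aestronglyMeasurable
    (measurable_curveExt_Icc hγ hg).aestronglyMeasurable hq

theorem eLpNorm_curveExt_upperPart_le (hγ : ContinuousOn γ (Icc 0 1)) (hf : StronglyMeasurable f)
    (hfi : IntegrableOn f (Icc 0 1)) {q : ℝ≥0∞} (hq : 1 ≤ q) {τ : ℕ → ℝ} (hτ : Monotone τ) (n : ℕ) :
    eLpNorm (curveExt γ lam (Icc 0 1) (upperPart f (τ 0))) q μ ≤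
      ∑ i ∈ Finset.range n,
        eLpNorm (curveExt γ lam (Icc 0 1) (levelPart f (τ i) (τ (i + 1)))) q μ +
      eLpNorm (curveExt γ lam (Icc 0 1) (upperPart f (τ n))) q μ := by
  induction n with
  | zero => simp
  | succ n ih =>
    refine ih.trans ?_
    rw [Finset.sum_range_succ, add_assoc]
    refine add_le_add le_rfl ?_
    rw [upperPart_eq_add (hτ n.le_succ)]
    exact eLpNorm_curveExt_add_le hγ (hfi.indicator (measurableSet_level hf _ _))
      (hfi.indicator (measurableSet_upper hf _)) hq

theorem volume_level_le (hf : StronglyMeasurable f) {p a b F : ℝ} (hp : 0 < p) (ha : 0 < a)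
    (hF0 : 0 ≤ F) (hF : ∫⁻ t in Icc 0 1, ‖f t‖ₑ ^ p = ENNReal.ofReal (F ^ p)) :
    volume.restrict (Icc (0 : ℝ) 1) {t | a < ‖f t‖ ∧ ‖f t‖ ≤ b} ≤ ENNReal.ofReal ((F / a) ^ p) := by
  have h1 := mul_meas_ge_le_lintegral₀ (μ := volume.restrict (Icc (0 : ℝ) 1))
    (hf.enorm.pow_const p).aemeasurable (ENNReal.ofReal (a ^ p))
  rw [hF] at h1
  have hap : 0 < a ^ p := by positivity
  have h2 : {t | a < ‖f t‖ ∧ ‖f t‖ ≤ b} ⊆ {t | ENNReal.ofReal (a ^ p) ≤ ‖f t‖ₑ ^ p} := by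
    intro t ht
    rw [mem_ofPred_eq, ← ofReal_norm, ENNReal.ofReal_rpow_of_nonneg (norm_nonneg _) hp.le]
    exact ENNReal.ofReal_le_ofReal (Real.rpow_le_rpow ha.le ht.1.le hp.le)
  refine (measure_mono h2).trans ?_
  rw [Real.div_rpow hF0 ha.le, ENNReal.ofReal_div_of_pos hap,
    ENNReal.le_div_iff_mul_le (Or.inl (by simpa using hap)) (Or.inl ENNReal.ofReal_ne_top), mul_comm]
  exact h1

theorem lintegral_levelPart_le (hf : StronglyMeasurable f) {p a b F r : ℝ} (hp : 0 < p) (ha : 0 < a)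
    (hb : 0 ≤ b) (hr : 0 < r)
    (hF0 : 0 ≤ F) (hF : ∫⁻ t in Icc 0 1, ‖f t‖ₑ ^ p = ENNReal.ofReal (F ^ p)) :
    ∫⁻ t in Icc 0 1, ‖levelPart f a b t‖ₑ ^ r ≤ ENNReal.ofReal (b ^ r * (F / a) ^ p) := by
  set E := {t | a < ‖f t‖ ∧ ‖f t‖ ≤ b} with hE
  calc _ ≤ ∫⁻ t in Icc 0 1, E.indicator (fun _ => ENNReal.ofReal (b ^ r)) t := by
        refine lintegral_mono fun t => ?_
        by_cases ht : t ∈ E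
        · simp only [levelPart, ← hE]
          rw [indicator_of_mem ht, indicator_of_mem ht, ← ofReal_norm,
            ENNReal.ofReal_rpow_of_nonneg (norm_nonneg _) hr.le]
          exact ENNReal.ofReal_le_ofReal (Real.rpow_le_rpow (norm_nonneg _) ht.2 hr.le)
        · simp only [levelPart, ← hE]
          rw [indicator_of_notMem ht, indicator_of_notMem ht]
          simp [hr]
    _ ≤ _ := by
        rw [lintegral_indicator_const (measurableSet_level hf a b), ENNReal.ofReal_mul (by positivity)]
        exact mul_le_mul' le_rfl (volume_level_le hf hp ha hF0 hF)

/-- Where ‖f‖ > b and p > 1, one has ‖f‖ ≤ b^(1-p) ‖f‖^p. -/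
theorem lintegral_upperPart_le {p b F : ℝ} (hp : 1 < p) (hb : 0 < b)
    (hF : ∫⁻ t in Icc 0 1, ‖f t‖ₑ ^ p = ENNReal.ofReal (F ^ p)) :
    ∫⁻ t in Icc 0 1, ‖upperPart f b t‖ₑ ≤ ENNReal.ofReal (b ^ (1 - p) * F ^ p) := by
  have hbp : 0 < b ^ (1 - p) := by positivity
  rw [ENNReal.ofReal_mul hbp.le, ← hF, ← lintegral_const_mul' _ _ ENNReal.ofReal_ne_top]
  refine lintegral_mono fun t => ?_
  by_cases ht : b < ‖f t‖
  · have hf0 : 0 < ‖f t‖ := hb.trans ht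
    have e : upperPart f b t = f t := indicator_of_mem (s := {t | b < ‖f t‖}) ht f
    rw [e, ← ofReal_norm, ENNReal.ofReal_rpow_of_nonneg hf0.le (by linarith),
      ← ENNReal.ofReal_mul hbp.le]
    refine ENNReal.ofReal_le_ofReal ?_
    have h1 : ‖f t‖ ^ (1 - p) ≤ b ^ (1 - p) :=
      Real.rpow_le_rpow_of_nonpos hb ht.le (by linarith)
    calc ‖f t‖ = ‖f t‖ ^ (1 - p) * ‖f t‖ ^ p := by
          rw [← Real.rpow_add hf0]; simp
      _ ≤ _ := mul_le_mul_of_nonneg_right h1 (by positivity)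
  · have e : upperPart f b t = 0 := indicator_of_notMem (s := {t | b < ‖f t‖}) ht f
    rw [e]; simp

/-- Where |f| lies between a and ca, Chebyshev's inequality for the measure of the piece bounds both
its L¹ and its L² norm. Log-convexity between L^∞ and L^(1/y) then gives the L^p bound with loss c;
the powers of a cancel because p(1 - θ/2) = 1. -/
theorem eLpNorm_curveExt_levelPart_le (hγ : ContinuousOn γ (Icc 0 1)) (hf : StronglyMeasurable f)
    (hfi : IntegrableOn f (Icc 0 1)) {p a c F y θ : ℝ} (hp : 0 < p) (ha : 0 < a) (hc : 0 ≤ c)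
    (hF0 : 0 < F) (hF : ∫⁻ t in Icc 0 1, ‖f t‖ₑ ^ p = ENNReal.ofReal (F ^ p)) (hy : 0 ≤ y)
    (hθ0 : 0 < θ) (hθ1 : θ < 1) (hθp : p * (1 - θ / 2) = 1) {B : ℝ≥0∞}
    (hB : ∀ g : ℝ → ℂ, MemLp g 2 (volume.restrict (Icc 0 1)) →
      eLpNorm (curveExt γ lam (Icc 0 1) g) (ENNReal.ofReal y)⁻¹ μ ≤
        B * eLpNorm g 2 (volume.restrict (Icc 0 1))) :
    eLpNorm (curveExt γ lam (Icc 0 1) (levelPart f a (c * a))) (ENNReal.ofReal (θ * y))⁻¹ μ ≤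
      B ^ θ * ENNReal.ofReal (c * F) := by
  set g := levelPart f a (c * a) with hg
  have hθ2 : 0 < 1 - θ := by linarith
  have hgi : IntegrableOn g (Icc 0 1) := hfi.indicator (measurableSet_level hf _ _)
  have hg1 : ∫⁻ t in Icc 0 1, ‖g t‖ₑ ≤ ENNReal.ofReal (c * a * (F / a) ^ p) := by
    have := lintegral_levelPart_le (b := c * a) hf hp ha (by positivity) one_pos hF0.le hF
    simpa using this
  have hg2 : eLpNorm g 2 (volume.restrict (Icc 0 1)) ≤
      ENNReal.ofReal (c * a * (F / a) ^ (p / 2)) := by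
    have h1 := lintegral_levelPart_le (b := c * a) hf hp ha (by positivity) two_pos hF0.le hF
    have h2 := eLpNorm_inv_ofReal (μ := volume.restrict (Icc 0 1)) g two_pos
    rw [inv_ofReal_one_div two_pos, ENNReal.ofReal_ofNat] at h2
    rw [h2]
    refine (ENNReal.rpow_le_rpow h1 (by norm_num)).trans_eq ?_
    rw [ENNReal.ofReal_rpow_of_nonneg (by positivity) (by norm_num), Real.mul_rpow (by positivity)
      (by positivity), ← Real.rpow_mul (by positivity), ← Real.rpow_mul (by positivity)]
    congr 2
    · norm_num
    · ring_nf
  have hgm : MemLp g 2 (volume.restrict (Icc 0 1)) :=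
    ⟨hgi.aestronglyMeasurable, hg2.trans_lt ENNReal.ofReal_lt_top⟩
  have hint := eLpNorm_interpolate (μ := μ)
    (measurable_curveExt_Icc (lam := lam) hγ hgi).aestronglyMeasurable le_rfl hy hθ0 hθ1
  have e0 : (1 - θ) * 0 + θ * y = θ * y := by ring
  rw [e0, ENNReal.ofReal_zero, ENNReal.inv_zero] at hint
  have hsup : eLpNorm (curveExt γ lam (Icc 0 1) g) ⊤ μ ≤ ENNReal.ofReal (c * a * (F / a) ^ p) := by
    rw [eLpNorm_exponent_top]
    exact eLpNormEssSup_le_of_ae_enorm_bound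
      (ae_of_all _ fun x => (enorm_curveExt_le _ x).trans hg1)
  calc _ ≤ ENNReal.ofReal (c * a * (F / a) ^ p) ^ (1 - θ) *
        (B * ENNReal.ofReal (c * a * (F / a) ^ (p / 2))) ^ θ :=
        hint.trans (mul_le_mul' (ENNReal.rpow_le_rpow hsup hθ2.le)
          (ENNReal.rpow_le_rpow ((hB g hgm).trans (mul_le_mul' le_rfl hg2)) hθ0.le))
    _ = B ^ θ * ENNReal.ofReal ((c * a * (F / a) ^ p) ^ (1 - θ) *
          (c * a * (F / a) ^ (p / 2)) ^ θ) := by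
        rw [ENNReal.mul_rpow_of_nonneg _ _ hθ0.le, ENNReal.ofReal_rpow_of_nonneg (by positivity)
          hθ2.le, ENNReal.ofReal_rpow_of_nonneg (by positivity) hθ0.le, mul_left_comm,
          ← ENNReal.ofReal_mul (by positivity)]
    _ = _ := by
        congr 2
        have hFa : 0 < F / a := by positivity
        have h1 : (c * a) ^ (1 - θ) * (c * a) ^ θ = c * a := by
          rw [← Real.rpow_add_of_nonneg (by positivity) hθ2.le hθ0.le]; simp
        have h2 : (F / a) ^ (p * (1 - θ)) * (F / a) ^ (p / 2 * θ) = F / a := by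
          rw [← Real.rpow_add hFa]
          have : p * (1 - θ) + p / 2 * θ = 1 := by linarith
          rw [this, Real.rpow_one]
        rw [Real.mul_rpow (x := c * a) (z := 1 - θ) (by positivity) (by positivity),
          Real.mul_rpow (x := c * a) (z := θ) (by positivity) (by positivity),
          ← Real.rpow_mul hFa.le, ← Real.rpow_mul hFa.le]
        calc _ = ((c * a) ^ (1 - θ) * (c * a) ^ θ) *
              ((F / a) ^ (p * (1 - θ)) * (F / a) ^ (p / 2 * θ)) := by ring
          _ = _ := by rw [h1, h2]; field_simp

end LevelSets

section

variable {d : ℕ} {γ : ℝ → EuclideanSpace ℝ (Fin d)} {α : ℝ}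

theorem curveExt_congr_ae {lam : ℝ} {f g : ℝ → ℂ} (h : f =ᵐ[volume.restrict (Icc 0 1)] g) :
    curveExt γ lam (Icc 0 1) f = curveExt γ lam (Icc 0 1) g := by
  ext1 x
  refine integral_congr_ae ?_
  filter_upwards [h] with t ht
  rw [ht]

/-- From `p = 2` to `1 < p < 2`, by interpolation with the trivial `L¹ → L^∞` bound. -/
theorem ExtBound.of_half (hγ : ContinuousOn γ (Icc 0 1)) {x y e : ℝ} (hx : 1 / 2 < x) (hx1 : x < 1)
    (hy : 0 ≤ y) (hy1 : y ≤ 1) (h : ExtBound γ α (1 / 2) y e) :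
    ExtBound γ α x (2 * (1 - x) * y) (2 * (1 - x) * e) := by
  set θ := 2 * (1 - x) with hθ
  have hθ0 : 0 < θ := by linarith
  have hθ1 : θ < 1 := by linarith
  set p := 1 / x with hpdef
  have hx0 : 0 < x := by linarith
  have hp1 : 1 < p := (one_lt_div hx0).mpr hx1
  have hp2 : p < 2 := by rw [hpdef, div_lt_iff₀ hx0]; linarith
  have hp0 : 0 < p := by linarith
  have hθp : p * (1 - θ / 2) = 1 := by rw [hθ, hpdef]; field_simp; ring
  intro ε hε
  -- f is cut at the heights Fλ^(-A) and Fλ^A. The L¹ norms of the parts below and above are at most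
  -- Fλ^(-A) and Fλ^(-A(p-1)), both at most Fλ^(-θe), so the trivial bound handles them.
  set A := (|θ * e| + 1) / (p - 1) with hA
  have hA0 : 0 < A := div_pos (by positivity) (by linarith)
  have hA1 : A * (p - 1) = |θ * e| + 1 := div_mul_cancel₀ _ (by linarith)
  have hA2 : |θ * e| + 1 ≤ A := by
    rw [← hA1]; exact mul_le_of_le_one_right hA0.le (by linarith)
  have hae : θ * e ≤ |θ * e| := le_abs_self _
  -- The number of levels does not depend on λ; the ratio λ^(2A/n) of consecutive heights, which is
  -- the loss per level, is at most λ^(ε/2).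
  obtain ⟨n, hn⟩ := exists_nat_ge (4 * A / ε)
  have hn0 : (0 : ℝ) < n := lt_of_lt_of_le (by positivity) hn
  have hnε : 2 * A / n ≤ ε / 2 := by
    rw [div_le_iff₀ hε] at hn
    rw [div_le_iff₀ hn0]; linarith
  obtain ⟨C, hC, H⟩ := h (ε / 2) (by positivity)
  set P : ℝ := (2 ^ α) ^ (θ * y) with hP
  have hP0 : 0 < P := by positivity
  refine ⟨2 * P + n * C ^ θ, by positivity, fun μ hμ hg lam hlam f₀ hf₀ => ?_⟩
  have hlam0 : 0 < lam := by linarith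
  obtain ⟨f, hf, hff⟩ := hf₀.1
  rw [curveExt_congr_ae hff, eLpNorm_congr_ae hff]
  have hfp : MemLp f (ENNReal.ofReal x)⁻¹ (volume.restrict (Icc 0 1)) := hf₀.ae_eq hff
  have hfi : IntegrableOn f (Icc 0 1) := memLp_integrableOn hx1.le hfp
  set G := growthNorm α μ
  have hy' : 0 ≤ θ * y := by positivity
  set Fe := eLpNorm f (ENNReal.ofReal x)⁻¹ (volume.restrict (Icc 0 1)) with hFe
  have hFtop : Fe ≠ ⊤ := hfp.2.ne
  rcases eq_or_ne Fe 0 with hF0 | hF0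
  · have := eLpNorm_curveExt_le_trivial (α := α) hy' hμ
      (enorm_curveExt_le_eLpNorm (γ := γ) (lam := lam) hx1.le hfp.1)
    rw [← hFe, hF0, mul_zero] at this
    exact this.trans zero_le
  set F := Fe.toReal with hFdef
  have hFpos : 0 < F := ENNReal.toReal_pos hF0 hFtop
  have hFF : Fe = ENNReal.ofReal F := (ENNReal.ofReal_toReal hFtop).symm
  have hFint : ∫⁻ t in Icc 0 1, ‖f t‖ₑ ^ p = ENNReal.ofReal (F ^ p) := by
    have h1 := eLpNorm_inv_ofReal (μ := volume.restrict (Icc 0 1)) f hp0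
    have h2 : 1 / p = x := by rw [hpdef, one_div_one_div]
    rw [h2, ← hFe, hFF] at h1
    rw [← ENNReal.ofReal_rpow_of_nonneg hFpos.le hp0.le, h1, ← ENNReal.rpow_mul, ← h2,
      one_div_mul_cancel hp0.ne', ENNReal.rpow_one]
  have hq : 1 ≤ (ENNReal.ofReal (θ * y))⁻¹ := by
    rw [ENNReal.one_le_inv]
    exact ENNReal.ofReal_le_one.mpr (mul_le_one₀ hθ1.le hy hy1)
  set c := lam ^ (2 * A / n) with hc
  have hc1 : 1 ≤ c := Real.one_le_rpow hlam (by positivity)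
  set τ : ℕ → ℝ := fun i => F * lam ^ (-A) * c ^ i with hτ
  have hτ0 : ∀ i, 0 < τ i := fun i => by rw [hτ]; positivity
  have hτs : ∀ i, τ (i + 1) = c * τ i := fun i => by rw [hτ]; simp only; rw [pow_succ]; ring
  have hτm : Monotone τ := monotone_nat_of_le_succ fun i => by
    rw [hτs]; exact le_mul_of_one_le_left (hτ0 i).le hc1
  have hτn : τ n = F * lam ^ A := by
    rw [hτ]; simp only
    rw [hc, ← Real.rpow_natCast, ← Real.rpow_mul hlam0.le, mul_assoc, ← Real.rpow_add hlam0]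
    congr 2; field_simp; ring
  have hτz : τ 0 = F * lam ^ (-A) := by rw [hτ]; simp
  set Q : ℝ := lam ^ (-(θ * e) + ε) with hQ
  have hpow : ∀ u : ℝ, u ≤ -(θ * e) + ε → lam ^ u ≤ Q := fun u hu =>
    Real.rpow_le_rpow_of_exponent_le hlam hu
  set N : (ℝ → ℂ) → ℝ≥0∞ := fun g =>
    eLpNorm (curveExt γ lam (Icc 0 1) g) (ENNReal.ofReal (θ * y))⁻¹ μ with hN
  have hend : ∀ g : ℝ → ℂ, (∫⁻ t in Icc 0 1, ‖g t‖ₑ) ≤ ENNReal.ofReal (F * Q) →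
      N g ≤ ENNReal.ofReal P * G ^ (θ * y) * ENNReal.ofReal (F * Q) := fun g hgB =>
    eLpNorm_curveExt_le_trivial (α := α) hy' hμ fun x => (enorm_curveExt_le _ x).trans hgB
  set low : ℝ → ℂ := indicator {t | τ 0 < ‖f t‖}ᶜ f with hlow
  have hlowi : IntegrableOn low (Icc 0 1) := hfi.indicator (measurableSet_upper hf _).compl
  have hdec : f = low + upperPart f (τ 0) := by
    rw [hlow, upperPart, indicator_compl_add_self]
  have hNlow : N low ≤ ENNReal.ofReal P * G ^ (θ * y) * ENNReal.ofReal (F * Q) := by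
    refine hend _ ?_
    calc _ ≤ ∫⁻ t in Icc (0 : ℝ) 1, ENNReal.ofReal (τ 0) := by
          refine lintegral_mono fun t => ?_
          by_cases ht : τ 0 < ‖f t‖
          · rw [hlow, indicator_of_notMem (by simpa using ht)]; simp
          · rw [hlow, indicator_of_mem (by simpa using ht), ← ofReal_norm]
            exact ENNReal.ofReal_le_ofReal (not_lt.mp ht)
      _ = ENNReal.ofReal (τ 0) := by simp
      _ ≤ _ := by
          rw [hτz]
          exact ENNReal.ofReal_le_ofReal
            (mul_le_mul_of_nonneg_left (hpow _ (by linarith)) hFpos.le)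
  have hNhigh : N (upperPart f (τ n)) ≤
      ENNReal.ofReal P * G ^ (θ * y) * ENNReal.ofReal (F * Q) := by
    refine hend _ ((lintegral_upperPart_le hp1 (hτ0 n) hFint).trans
      (ENNReal.ofReal_le_ofReal ?_))
    rw [hτn, Real.mul_rpow hFpos.le (by positivity), ← Real.rpow_mul hlam0.le, mul_right_comm,
      ← Real.rpow_add hFpos, sub_add_cancel, Real.rpow_one]
    exact mul_le_mul_of_nonneg_left (hpow _ (by linarith)) hFpos.le
  have hNmid : ∀ i ∈ Finset.range n, N (levelPart f (τ i) (τ (i + 1))) ≤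
      ENNReal.ofReal (C ^ θ) * G ^ (θ * y) * ENNReal.ofReal (F * Q) := by
    intro i _
    have h2 := eLpNorm_curveExt_levelPart_le (μ := μ) (lam := lam) hγ hf hfi hp0 (hτ0 i)
      (by linarith : 0 ≤ c) hFpos hFint hy hθ0 hθ1 hθp
      (B := ENNReal.ofReal C * G ^ y * ENNReal.ofReal (lam ^ (-e + ε / 2))) fun g hg2 => by
        have := H μ hμ hg lam hlam g
        rw [inv_ofReal_one_div two_pos, ENNReal.ofReal_ofNat] at this
        exact this hg2
    rw [← hτs] at h2
    refine h2.trans ?_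
    rw [ENNReal.mul_rpow_of_nonneg _ _ hθ0.le, ENNReal.mul_rpow_of_nonneg _ _ hθ0.le,
      ENNReal.ofReal_rpow_of_nonneg hC.le hθ0.le, ← ENNReal.rpow_mul, mul_comm y,
      ENNReal.ofReal_rpow_of_nonneg (by positivity) hθ0.le, mul_assoc _ _ (ENNReal.ofReal (c * F)),
      ← ENNReal.ofReal_mul (by positivity)]
    refine mul_le_mul' le_rfl (ENNReal.ofReal_le_ofReal ?_)
    rw [← mul_assoc, mul_comm _ F, hc, ← Real.rpow_mul hlam0.le, ← Real.rpow_add hlam0]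
    refine mul_le_mul_of_nonneg_left (hpow _ ?_) hFpos.le
    have : θ * (ε / 2) ≤ ε / 2 := mul_le_of_le_one_left (by positivity) hθ1.le
    linarith
  calc N f ≤ N low + N (upperPart f (τ 0)) := by
        nth_rewrite 1 [hdec]
        exact eLpNorm_curveExt_add_le hγ hlowi (hfi.indicator (measurableSet_upper hf _)) hq
    _ ≤ N low + (∑ i ∈ Finset.range n, N (levelPart f (τ i) (τ (i + 1))) +
          N (upperPart f (τ n))) :=
        add_le_add le_rfl (eLpNorm_curveExt_upperPart_le hγ hf hfi hq hτm n)
    _ ≤ ENNReal.ofReal P * G ^ (θ * y) * ENNReal.ofReal (F * Q) +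
          (n * (ENNReal.ofReal (C ^ θ) * G ^ (θ * y) * ENNReal.ofReal (F * Q)) +
          ENNReal.ofReal P * G ^ (θ * y) * ENNReal.ofReal (F * Q)) := by
        refine add_le_add hNlow (add_le_add ?_ hNhigh)
        refine (Finset.sum_le_card_nsmul _ _ _ hNmid).trans_eq ?_
        rw [Finset.card_range, nsmul_eq_mul]
    _ = (2 * ENNReal.ofReal P + n * ENNReal.ofReal (C ^ θ)) * G ^ (θ * y) *
          ENNReal.ofReal (F * Q) := by ring
    _ = _ := by
        rw [ENNReal.ofReal_add (by positivity) (by positivity),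
          ENNReal.ofReal_mul (p := 2) (by norm_num), ENNReal.ofReal_mul hn0.le,
          ENNReal.ofReal_natCast, ENNReal.ofReal_ofNat, ENNReal.ofReal_mul hFpos.le, hFF]
        ring

end

/-! ### The exponents and the estimates on the line p = 2 -/

/-- Along the pairs (d-ℓ, α-ℓ) the difference j - s is always d - α, so the integer part in β does
not change with ℓ. -/
theorem beta_eq {d : ℕ} {α : ℝ} {j : ℤ} {s : ℝ} (h : (j : ℝ) - s = d - α) :
    beta j s = ((codim d α : ℝ) + 1) * s + (j - 1 - codim d α) * (j - codim d α) / 2 := by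
  rw [beta, codim, h]

theorem codim_le (d : ℕ) (α : ℝ) : (codim d α : ℝ) ≤ d - α := Int.floor_le _

theorem lt_codim_add_one (d : ℕ) (α : ℝ) : (d : ℝ) - α < codim d α + 1 := Int.lt_floor_add_one _

section

variable {d : ℕ} {γ : ℝ → EuclideanSpace ℝ (Fin d)} {D : ℕ → ℝ → EuclideanSpace ℝ (Fin d)}
  {M α : ℝ}

/-- The value of `β_k` at `α - d + k`, where `m = [d - α]`. -/
noncomputable def betaAt (d : ℕ) (α m k : ℝ) : ℝ :=
  (m + 1) * (α - d + k) + (k - 1 - m) * (k - m) / 2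

/-- At the corner q = 2β_k this makes the restriction q ≥ 2k of the multilinear step automatic. It
may fail for k = m + 1. -/
theorem le_betaAt {m k : ℝ} (hm0 : 0 ≤ m) (hm : d - α < m + 1) (hk : m + 2 ≤ k) :
    k ≤ betaAt d α m k := by
  unfold betaAt
  have h1 : (m + 1) * (k - m - 1) ≤ (m + 1) * (α - d + k) :=
    mul_le_mul_of_nonneg_left (by linarith) (by linarith)
  have h2 : 0 ≤ m * (k - m - 2) := mul_nonneg hm0 (by linarith)
  have h3 : 0 ≤ (k - m - 2) * (k - m + 1) := mul_nonneg (by linarith) (by linarith)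
  nlinarith

/-- The parameter r is taken to be m + 1. When m = [d-α] this minimises r(α-d+k) + (k-r)(k-r+1)/2
over integers 1 ≤ r ≤ k, since raising r by one changes the value by α-d+r. Here m is still free. -/
theorem IsNondegBy.extBound_linear (hD : IsNondegBy γ D M) (hγ : ContinuousOn γ (Icc 0 1))
    {m k : ℕ} (hmk : m + 1 ≤ k) (hk : k ≤ d) {y : ℝ} (hy : 0 < y) (hky : 2 * k * y ≤ 1)
    (hβ : 2 * betaAt d α m k * y ≤ 1) :
    ExtBound γ α (1 / 2) y ((α - d + k) * y) := by
  have h := hD.extBound (α := α) (q := 1 / y) (k := k) (r := m + 1) hγ (by omega) hk (by omega) hmk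
    (by rw [le_div_iff₀ hy]; exact hky) (by
      have h1 : betaAt d α m k ≤ 1 / y / 2 := by
        rw [div_div, le_div_iff₀ (by positivity)]; linarith
      refine le_trans (le_of_eq ?_) h1
      unfold betaAt; push_cast; ring)
  rwa [one_div_one_div, div_div_eq_mul_div, div_one] at h

theorem IsNondegBy.extBound_corner (hD : IsNondegBy γ D M) (hγ : ContinuousOn γ (Icc 0 1))
    {m k : ℕ} (hmk : m + 1 ≤ k) (hk : k ≤ d) (hβ : k ≤ betaAt d α m k) :
    ExtBound γ α (1 / 2) (1 / (2 * betaAt d α m k))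
      ((α - d + k) * (1 / (2 * betaAt d α m k))) := by
  have hk1 : (0 : ℝ) < k := by exact_mod_cast (by omega : 0 < k)
  have hβ0 : 0 < betaAt d α m k := by linarith
  refine hD.extBound_linear hγ hmk hk (by positivity) ?_ ?_
  · rw [mul_one_div, div_le_one (by positivity)]; linarith
  · rw [mul_one_div, div_self (by positivity)]

theorem ExtBound.of_half_le (hγ : ContinuousOn γ (Icc 0 1)) {x y y' e e' : ℝ} (hx : 1 / 2 ≤ x)
    (hx1 : x < 1) (hy : 0 ≤ y) (hy1 : y ≤ 1) (h : ExtBound γ α (1 / 2) y e)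
    (hy' : y' = 2 * (1 - x) * y) (he' : e' = 2 * (1 - x) * e) : ExtBound γ α x y' e' := by
  subst hy' he'
  rcases hx.eq_or_lt with rfl | hx
  · have : (2 : ℝ) * (1 - 1 / 2) = 1 := by norm_num
    simpa only [this, one_mul] using h
  · exact h.of_half hγ hx hx1 hy hy1

/-- If m + 2 ≤ d, then β_d ≥ d and the multilinear route with k = d covers the range. If m + 1 = d,
then β_d = dα can be smaller than d, and the kernel decay takes over. -/
theorem IsNondegBy.extBound_half_full (hD : IsNondegBy γ D M) (hd : 2 ≤ d)
    (hγ : ContinuousOn γ (Icc 0 1)) {m : ℕ} (hα0 : 0 < α) (hm : m ≤ (d : ℝ) - α)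
    (hm' : (d : ℝ) - α < m + 1) {y : ℝ} (hy0 : 0 ≤ y) (hy : y ≤ 1 / 2)
    (hβ : betaAt d α m d * y < 1 / 2) : ExtBound γ α (1 / 2) y (α * y) := by
  rcases hy0.eq_or_lt with rfl | hy0
  · simpa using extBound_trivial (γ := γ) (α := α) (by norm_num) le_rfl
  have hmd : m + 1 ≤ d := by
    have : (m : ℝ) < d := by linarith
    exact_mod_cast this
  have hm0 : (0 : ℝ) ≤ m := Nat.cast_nonneg m
  rcases Nat.lt_or_ge (m + 1) d with hmd' | hmd'
  · have hmd2 : (m : ℝ) + 2 ≤ d := by exact_mod_cast hmd'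
    have hb := le_betaAt (d := d) (k := d) hm0 hm' hmd2
    have := hD.extBound_linear (α := α) hγ hmd le_rfl hy0 (by nlinarith) (by linarith)
    simpa using this
  · have hdm : (d : ℝ) = m + 1 := by exact_mod_cast (le_antisymm hmd' hmd)
    have hb : betaAt d α m d = d * α := by unfold betaAt; rw [hdm]; ring
    rw [hb] at hβ
    have h := hD.extBound_of_decay (α := α) (q := 1 / y) hd hγ
      (by rw [le_div_iff₀ hy0]; linarith) (by rw [lt_div_iff₀ hy0]; linarith)
    rwa [one_div_one_div, div_div_eq_mul_div, div_one] at h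

/-- Interpolation between the corners for k and k - 1. As β_k - β_{k-1} = k, the factor 2/|J| is
1/k. -/
theorem IsNondegBy.extBound_half_mid (hD : IsNondegBy γ D M)
    (hγ : ContinuousOn γ (Icc 0 1)) {m k : ℕ}
    (hm' : (d : ℝ) - α < m + 1) (hk : k ≤ d) (hmk : m + 3 ≤ k) {y : ℝ}
    (hβ : betaAt d α m (k - 1) * y ≤ 1 / 2) (hβ' : 1 / 2 ≤ betaAt d α m k * y) :
    ExtBound γ α (1 / 2) y ((α - d + k) * y - 1 / k * (betaAt d α m k * y - 1 / 2)) := by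
  obtain ⟨j, rfl⟩ : ∃ j, k = j + 1 := ⟨k - 1, by omega⟩
  have hm0 : (0 : ℝ) ≤ m := Nat.cast_nonneg m
  have hj : (m : ℝ) + 2 ≤ j := by exact_mod_cast (by omega : m + 2 ≤ j)
  have hdiff : betaAt d α m (j + 1 : ℕ) - betaAt d α m j = (j + 1 : ℕ) := by
    unfold betaAt; push_cast; ring
  have hb1 := le_betaAt (d := d) (α := α) (k := j) hm0 hm' hj
  have hb2 := le_betaAt (d := d) (α := α) (k := (j + 1 : ℕ)) hm0 hm' (by push_cast; linarith)
  have h1 := hD.extBound_corner (α := α) hγ (k := j) (m := m) (by omega) (by omega) hb1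
  have h2 := hD.extBound_corner (α := α) hγ (m := m) (by omega) hk hb2
  have ej : ((j + 1 : ℕ) : ℝ) - 1 = j := by push_cast; ring
  rw [ej] at hβ
  set b := betaAt d α m (j + 1 : ℕ) with hb
  set b' := betaAt d α m j with hb'
  have hj0 : (0 : ℝ) < (j + 1 : ℕ) := by positivity
  have hb0' : 0 < b' := by linarith
  have hb0 : 0 < b := by linarith
  have h := ExtBound.interpolate_between (y := y) (a := (α - d + (j + 1 : ℕ)) - b / (b - b'))
    (b := 1 / (b - b') / 2) hγ (by norm_num) (by positivity)
    (one_div_lt_one_div_of_lt (by positivity) (by linarith)) h2 h1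
    (by rw [hdiff]; field_simp; ring) (by
      have : b - b' ≠ 0 := by rw [hdiff]; exact hj0.ne'
      push_cast
      field_simp
      ring)
    (by rw [div_le_iff₀ (by positivity)]; linarith) (by rw [le_div_iff₀ (by positivity)]; linarith)
  rw [hdiff] at h
  convert! h using 1
  ring

/-- For k = m + 1 the binding condition is q ≥ 2k: as α - d + m ≤ 0, β_k is at most k. -/
theorem IsNondegBy.extBound_half_critical (hD : IsNondegBy γ D M)
    (hγ : ContinuousOn γ (Icc 0 1)) {m : ℕ} (hm : m ≤ (d : ℝ) - α) (hmd : m + 1 ≤ d) :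
    ExtBound γ α (1 / 2) (1 / (2 * (m + 1))) ((α - d + (m + 1)) * (1 / (2 * (m + 1)))) := by
  have hm0 : (0 : ℝ) < m + 1 := by positivity
  have h := hD.extBound_linear (α := α) hγ (m := m) (k := m + 1) le_rfl hmd
    (y := 1 / (2 * (m + 1))) (by positivity)
    (by push_cast; rw [mul_one_div, div_self (by positivity)])
    (by
      rw [mul_one_div, div_le_one (by positivity)]
      unfold betaAt; push_cast
      nlinarith)
  push_cast at h
  exact h

/-- Interpolation between the corner for k = m + 2 and the critical exponent q = 2(m+1), which is
determined by k and not by β; hence the different length of J. -/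
theorem IsNondegBy.extBound_half_lower (hD : IsNondegBy γ D M)
    (hγ : ContinuousOn γ (Icc 0 1)) {m : ℕ} (hm : m ≤ (d : ℝ) - α)
    (hm' : (d : ℝ) - α < m + 1) (hmd : m + 2 ≤ d) {y J : ℝ}
    (hJ : J = betaAt d α m (m + 2) - (m + 1))
    (hβ : (m + 1) * y ≤ 1 / 2) (hβ' : 1 / 2 ≤ betaAt d α m (m + 2) * y) :
    ExtBound γ α (1 / 2) y ((α - d + (m + 2)) * y - 1 / J * (betaAt d α m (m + 2) * y - 1 / 2)) := by
  have hm0 : (0 : ℝ) ≤ m := Nat.cast_nonneg m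
  have hb2 := le_betaAt (d := d) (α := α) (k := m + 2) hm0 hm' le_rfl
  have h2 := hD.extBound_corner (α := α) hγ (m := m) (k := m + 2) (by omega) hmd
    (by push_cast; exact hb2)
  push_cast at h2
  have h1 := hD.extBound_half_critical hγ hm (by omega)
  have hform : betaAt d α m (m + 2) = (m + 1) * (α - d + (m + 2)) + 1 := by unfold betaAt; ring
  set b := betaAt d α m (m + 2) with hb
  have hb0 : 0 < b := by linarith
  have hJ0 : 0 < J := by linarith
  have h := ExtBound.interpolate_between (y := y) (a := (α - d + (m + 2)) - b / J)
    (b := 1 / J / 2) hγ (by norm_num) (by positivity)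
    (one_div_lt_one_div_of_lt (by positivity) (by linarith)) h2 h1
    (by field_simp; ring) (by
      have : b = J + (m + 1) := by linarith
      rw [this]
      field_simp
      ring)
    (by rw [div_le_iff₀ (by positivity)]; linarith) (by rw [le_div_iff₀ (by positivity)]; linarith)
  convert! h using 1
  ring

/-- Interpolation between q = 2(m+1) and q = 2, whose exponents lie on one affine function of y. For
m = 0 the two endpoints coincide. -/
theorem IsNondegBy.extBound_half_last (hD : IsNondegBy γ D M)
    (hγ : ContinuousOn γ (Icc 0 1)) {m : ℕ} (hm : m ≤ (d : ℝ) - α) (hmd : m + 1 ≤ d)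
    {y : ℝ} (hβ : 1 / 2 ≤ (m + 1) * y) (hy : y ≤ 1 / 2) :
    ExtBound γ α (1 / 2) y ((α - d) * y + 1 / 2) := by
  have hm0 : (0 : ℝ) ≤ m := Nat.cast_nonneg m
  have h1 := hD.extBound_half_critical hγ hm hmd
  have hy1 : 1 / (2 * ((m : ℝ) + 1)) ≤ y := by rw [div_le_iff₀ (by positivity)]; linarith
  have e1 : (α - d + (m + 1)) * (1 / (2 * ((m : ℝ) + 1))) =
      (α - d) * (1 / (2 * (m + 1))) + 1 / 2 := by field_simp
  rcases Nat.eq_zero_or_pos m with rfl | hmpos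
  · have : y = 1 / (2 * (((0 : ℕ) : ℝ) + 1)) := by
      refine le_antisymm ?_ hy1; push_cast; norm_num; linarith
    rw [this, ← e1]; exact h1
  have hmpos' : (0 : ℝ) < m := by exact_mod_cast hmpos
  -- The endpoint q = 2 is the case k = r = 1; the argument `m := 0` encodes r = 1 and is unrelated
  -- to [d-α].
  have h2 := hD.extBound_linear (α := α) hγ (m := 0) (k := 1) le_rfl (by omega) (y := 1 / 2)
    (by norm_num) (by norm_num) (by unfold betaAt; push_cast; linarith)
  exact ExtBound.interpolate_between hγ (by norm_num) (by positivity)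
    (one_div_lt_one_div_of_lt two_pos (by linarith)) h1 h2 e1 (by push_cast; ring) hy1 hy

end

/-! ### Assembling the regions -/

section

variable {d : ℕ} {γ : ℝ → EuclideanSpace ℝ (Fin d)} {D : ℕ → ℝ → EuclideanSpace ℝ (Fin d)}
  {M α : ℝ}

theorem IsNondegBy.extBound_of_mem_regionA (hD : IsNondegBy γ D M) (hd : 2 ≤ d)
    (hγ : ContinuousOn γ (Icc 0 1)) (hα0 : 0 < α) (hαd : α ≤ d) {l : ℤ} (hl0 : -1 ≤ l)
    (hl1 : l ≤ d - 1 - codim d α) {x y : ℝ} (h : (x, y) ∈ regionA d α l) :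
    ExtBound γ α x y (eta d α x y l) := by
  have hmnn : 0 ≤ codim d α := Int.floor_nonneg.mpr (by linarith)
  obtain ⟨m, hm⟩ := Int.eq_ofNat_of_zero_le hmnn
  have hm1 : (m : ℝ) ≤ d - α := by have := codim_le d α; rw [hm] at this; exact_mod_cast this
  have hm2 : (d : ℝ) - α < m + 1 := by
    have := lt_codim_add_one d α; rw [hm] at this; exact_mod_cast this
  have hmd : m + 1 ≤ d := by
    have : (m : ℝ) < d := by linarith
    exact_mod_cast this
  have hm0 : (0 : ℝ) ≤ m := Nat.cast_nonneg m
  have hbeta : ∀ (j : ℤ) (s : ℝ), (j : ℝ) - s = d - α → beta j s = betaAt d α m j := by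
    intro j s hjs
    rw [beta_eq hjs, hm, betaAt]
    have : s = α - d + j := by linarith
    rw [this]; push_cast; ring
  obtain ⟨hx, hx1, hy0, hy1, hcase⟩ := h
  simp only at hx hx1 hy0 hy1 hcase
  rw [hm] at hcase hl1
  -- Where a region contains points with x = 1, they have y = 0 and η = 0, and the trivial estimate
  -- applies.
  have hzero : y = 0 → x = 1 → ExtBound γ α x y 0 := fun h1 h2 => by
    rw [h1, h2]; exact extBound_trivial le_rfl le_rfl
  -- The ray from (1,0) through (x,y) meets the line x = 1/2 at height y/(2(1-x)), and η is linear
  -- in (1-x, y); so it suffices to treat p = 2.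
  have hscale : ∀ e : ℝ, x < 1 → y ≤ 1 - x → ∀ e' : ℝ,
      ExtBound γ α (1 / 2) (y / (2 * (1 - x))) e' → e = 2 * (1 - x) * e' → ExtBound γ α x y e := by
    intro e hx2 hyx e' he' hee
    have h1 : 0 < 2 * (1 - x) := by linarith
    have h0 : 1 - x ≠ 0 := by linarith
    exact ExtBound.of_half_le hγ hx hx2 (by positivity) ((div_le_one h1).mpr (by linarith)) he'
      (by field_simp) hee
  by_cases hA : l = -1
  · rw [if_pos hA] at hcase
    rw [eta, if_pos hA]
    rw [show beta d α = betaAt d α m d from hbeta d α (by push_cast; ring)] at hcase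
    obtain ⟨h1, h2⟩ := hcase
    have hb0 : 0 < betaAt d α m d := by
      have : (m : ℝ) + 1 ≤ d := by exact_mod_cast hmd
      unfold betaAt
      have e1 : 0 < (m + 1 : ℝ) * (α - d + d) := by rw [sub_add_cancel]; positivity
      have e2 : 0 ≤ ((d : ℝ) - 1 - m) * (d - m) / 2 := by
        refine div_nonneg (mul_nonneg ?_ ?_) two_pos.le <;> linarith
      linarith
    have hx2 : x < 1 := by nlinarith
    have hθ : 0 < 2 * (1 - x) := by linarith
    have hx0 : 1 - x ≠ 0 := by linarith
    refine hscale _ hx2 h2 (α * (y / (2 * (1 - x)))) ?_ (by field_simp)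
    refine hD.extBound_half_full hd hγ hα0 hm1 hm2 (by positivity) ?_ ?_
    · rw [div_le_iff₀ hθ]; linarith
    · rw [← mul_div_assoc, div_lt_iff₀ hθ]; linarith
  rw [if_neg hA] at hcase
  have hl : 0 ≤ l := by omega
  -- The region ℓ belongs to the k-linear estimate with k = d - ℓ.
  obtain ⟨k, hk⟩ := Int.eq_ofNat_of_zero_le (a := d - l) (by omega)
  have hlk : l = d - k := by omega
  have hlr : (l : ℝ) = d - k := by rw [hlk]; push_cast; ring
  have hkd : k ≤ d := by omega
  have hmk : m + 1 ≤ k := by omega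
  have hbk : beta (d - l) (α - l) = betaAt d α m k := by
    rw [hbeta _ _ (by push_cast; ring), hlk]; push_cast; congr 1; ring
  have hbk1 : beta (d - l - 1) (α - l - 1) = betaAt d α m (k - 1) := by
    rw [hbeta _ _ (by push_cast; ring), hlk]; push_cast; congr 1; ring
  by_cases hB : l ≤ d - 3 - m
  · rw [if_pos hB, hbk, hbk1] at hcase
    obtain ⟨h1, h2⟩ := hcase
    have hmk3 : m + 3 ≤ k := by omega
    have hmk3' : (m : ℝ) + 3 ≤ k := by exact_mod_cast hmk3
    have hb1 := le_betaAt (d := d) (α := α) (k := k - 1) hm0 hm2 (by linarith)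
    have hx2 : x < 1 := by nlinarith
    have hyx : y ≤ 1 - x := by nlinarith
    have hθ : 0 < 2 * (1 - x) := by linarith
    have hx0 : 1 - x ≠ 0 := by linarith
    have hk0 : (0 : ℝ) < k := by linarith
    have hJ : lengthJ d α l = 2 * k := by
      rw [lengthJ, intervalJ, if_neg hA, if_pos (by rw [hm]; exact hB), Real.volume_Icc, hbk, hbk1]
      have : 2 * betaAt d α m k - 2 * betaAt d α m (k - 1) = 2 * k := by unfold betaAt; ring
      rw [this, ENNReal.toReal_ofReal (by positivity)]
    rw [eta, if_neg hA, if_pos (by rw [hm]; omega), hJ, hbk, hlr]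
    refine hscale _ hx2 hyx _ (hD.extBound_half_mid hγ (k := k) hm2 hkd hmk3 ?_ ?_) ?_
    · rw [← mul_div_assoc, div_le_iff₀ hθ]; linarith
    · rw [← mul_div_assoc, le_div_iff₀ hθ]; linarith
    · field_simp
      ring
  rw [if_neg hB] at hcase
  by_cases hC : l = d - 2 - m
  · have hk2 : k = m + 2 := by omega
    have hk2' : (k : ℝ) = m + 2 := by exact_mod_cast hk2
    have hfr : beta ((m : ℤ) + 2) (2 - Int.fract ((d : ℝ) - α)) = betaAt d α m (m + 2) := by
      rw [hbeta]
      · push_cast; rfl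
      · have h3 := Int.floor_add_fract ((d : ℝ) - α)
        have h4 : (⌊(d : ℝ) - α⌋ : ℤ) = (m : ℤ) := hm
        rw [h4] at h3
        push_cast at h3 ⊢
        linarith
    rw [if_pos hC, hfr] at hcase
    push_cast at hcase
    obtain ⟨h1, h2⟩ := hcase
    have hform : betaAt d α m (m + 2) = (m + 1) * (α - d + (m + 2)) + 1 := by unfold betaAt; ring
    have hJ0 : 0 < betaAt d α m (m + 2) - (m + 1) := by nlinarith
    have hJ : lengthJ d α l = 2 * (betaAt d α m (m + 2) - (m + 1)) := by
      rw [lengthJ, intervalJ, if_neg hA, if_neg (by rw [hm]; exact hB), if_pos (by rw [hm]; exact hC),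
        Real.volume_Icc, hbk, hm, hk2']
      push_cast
      rw [← mul_sub, ENNReal.toReal_ofReal (by linarith)]
    rw [eta, if_neg hA, if_pos (by rw [hm]; omega), hJ, hbk, hlr, hk2']
    have hyx : y ≤ 1 - x := by nlinarith
    rcases hx1.eq_or_lt with hx2 | hx2
    · have hy : y = 0 := by linarith
      have := hzero hy hx2
      rw [hy, hx2] at this ⊢
      simpa using this
    have hθ : 0 < 2 * (1 - x) := by linarith
    have hx0 : 1 - x ≠ 0 := by linarith
    refine hscale _ hx2 hyx _ (hD.extBound_half_lower hγ (m := m) hm1 hm2 (by omega) rfl ?_ ?_) ?_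
    · rw [← mul_div_assoc, div_le_iff₀ hθ]; linarith
    · rw [← mul_div_assoc, le_div_iff₀ hθ]; linarith
    · field_simp
      ring
  rw [if_neg hC] at hcase
  rw [eta, if_neg hA, if_neg (by rw [hm]; omega)]
  -- The segment x + y = 1 for m = 0 and the region for m ≥ 1 are brought to the same pair of
  -- inequalities.
  have hcond : 1 - x ≤ (m + 1) * y ∧ y ≤ 1 - x := by
    by_cases h0 : (m : ℤ) = 0
    · rw [if_pos h0] at hcase
      have : (m : ℝ) = 0 := by exact_mod_cast h0
      rw [this]; constructor <;> linarith
    · rw [if_neg h0] at hcase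
      obtain ⟨h1, h2, -⟩ := hcase
      push_cast at h1
      rw [div_le_iff₀ (by positivity)] at h1
      exact ⟨by linarith, h2⟩
  rcases hx1.eq_or_lt with hx2 | hx2
  · have hy : y = 0 := by linarith [hcond.2]
    have := hzero hy hx2
    rw [hy, hx2] at this ⊢
    simpa using this
  have hθ : 0 < 2 * (1 - x) := by linarith
  have hx0 : 1 - x ≠ 0 := by linarith
  refine hscale _ hx2 hcond.2 _ (hD.extBound_half_last hγ hm1 hmd ?_ ?_) ?_
  · rw [← mul_div_assoc, le_div_iff₀ hθ]; linarith [hcond.1]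
  · rw [div_le_iff₀ hθ]; linarith [hcond.2]
  · field_simp
    ring

end

/-! ### Conclusion for the operator with amplitude -/

theorem oscOp_eq_mul_curveExt {d : ℕ} (γ : ℝ → EuclideanSpace ℝ (Fin d))
    (a : EuclideanSpace ℝ (Fin d) → ℂ) (lam : ℝ) (f : ℝ → ℂ) (x : EuclideanSpace ℝ (Fin d)) :
    oscOp γ a lam f x = a x * curveExt γ lam (Icc 0 1) f x := rfl

theorem inv_ofReal_toReal_inv {p : ℝ≥0∞} (hp : 1 ≤ p) : (ENNReal.ofReal (p⁻¹).toReal)⁻¹ = p := by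
  rw [ENNReal.ofReal_toReal (ENNReal.inv_ne_top.mpr (one_pos.trans_le hp).ne'), inv_inv]

end OscCurve

theorem corollary2p4 (d : ℕ) (hd : 2 ≤ d) (α : ℝ) (hα0 : 0 < α) (hαd : α ≤ d)
    (γ : ℝ → EuclideanSpace ℝ (Fin d))
    (hγ : ContDiffOn ℝ ((d + 1 : ℕ) : WithTop ℕ∞) γ (Icc 0 1))
    (hnd : OscCurve.Nondegenerate γ)
    (l : ℤ) (hl0 : -1 ≤ l) (hl1 : l ≤ d - 1 - OscCurve.codim d α)
    (p q : ℝ≥0∞) (hp1 : 1 ≤ p) (hp2 : p ≤ 2) (hq : 1 ≤ q)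
    (hpq : ((p⁻¹).toReal, (q⁻¹).toReal) ∈ OscCurve.regionA d α l)
    (ε : ℝ) (hε : 0 < ε) :
    ∃ C : ℝ, 0 < C ∧
      ∀ μ : Measure (EuclideanSpace ℝ (Fin d)),
        μ (Metric.closedBall 0 1)ᶜ = 0 → OscCurve.HasGrowth α μ →
      ∀ a : EuclideanSpace ℝ (Fin d) → ℂ, Measurable a →
        Function.support a ⊆ Metric.closedBall 0 1 → (∀ x, ‖a x‖ ≤ 1) →
      ∀ lam : ℝ, 1 ≤ lam →
      ∀ f : ℝ → ℂ, MemLp f p (volume.restrict (Icc 0 1)) →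
        MemLp (OscCurve.oscOp γ a lam f) q μ ∧
        eLpNorm (OscCurve.oscOp γ a lam f) q μ ≤
          ENNReal.ofReal C * OscCurve.growthNorm α μ ^ (q⁻¹).toReal
            * ENNReal.ofReal
                (lam ^ (-OscCurve.eta d α (p⁻¹).toReal (q⁻¹).toReal l + ε))
            * eLpNorm f p (volume.restrict (Icc 0 1)) := by
  obtain ⟨D, M, hD⟩ := OscCurve.exists_isNondegBy hγ hnd
  obtain ⟨C, hC, H⟩ := hD.extBound_of_mem_regionA hd hγ.continuousOn hα0 hαd hl0 hl1 hpq ε hε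
  rw [OscCurve.inv_ofReal_toReal_inv hp1, OscCurve.inv_ofReal_toReal_inv hq] at H
  refine ⟨C, hC, fun μ hμ hg a ha _ ha1 lam hlam f hf => ?_⟩
  have hfin : IsFiniteMeasure μ := OscCurve.isFiniteMeasure_of_growth hμ hg
  have hle : eLpNorm (OscCurve.oscOp γ a lam f) q μ ≤
      eLpNorm (OscCurve.curveExt γ lam (Icc 0 1) f) q μ := by
    refine eLpNorm_mono fun x => ?_
    rw [OscCurve.oscOp_eq_mul_curveExt, norm_mul]
    exact mul_le_of_le_one_left (norm_nonneg _) (ha1 x)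
  have hbound := hle.trans (H μ hμ hg lam hlam f hf)
  have hm : Measurable (OscCurve.oscOp γ a lam f) :=
    ha.mul (OscCurve.measurable_curveExt_Icc hγ.continuousOn (hf.integrable hp1))
  refine ⟨⟨hm.aestronglyMeasurable, hbound.trans_lt ?_⟩, hbound⟩
  have h1 := ENNReal.rpow_ne_top_of_nonneg (ENNReal.toReal_nonneg (a := q⁻¹))
    (OscCurve.growthNorm_ne_top hg)
  exact ENNReal.mul_lt_top (ENNReal.mul_lt_top (ENNReal.mul_lt_top ENNReal.ofReal_lt_top h1.lt_top)
    ENNReal.ofReal_lt_top) hf.2
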